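/- Fix $\omega\in\mathbb R^2$ that is $(C,\tau)$-Diophantine, i.e. $|\omega\cdot k|\ge C(|k_1|+|k_2|)^{-\tau}$ for all $k\in\mathbb Z^2\setminus\{0\}$, with $C>0$, $\tau\ge1$, and put $\omega^\perp=(-\omega_2,\omega_1)$. Let $f(\varphi)=\sum_{|k_1|+|k_2|\le\Gamma}f_k\cos(k\cdot\varphi)$ with $f_k=f_{-k}>0$. On $T^*(\mathbb S^1\times\mathbb T^2)\ni(q,\varphi,p,A)$ consider the Hamiltonian $$H=\omega\cdot A+\tfrac{p^2}{2}+(\cos q-1)+\mu(1-\cos q)f(\varphi),\qquad \mu>0,$$ and its invariant tori $\mathcal T(B)=\{p=0,\ q=0,\ A=B\}$, $B\in\mathbb R^2$. Let $W^{s}(\mathcal T(B))$, resp. $W^u(\mathcal T(B))$, be the positive branch of the stable, resp. unstable, whisker: the set of points whose motion tends to $\mathcal T(B)$ as $t\to+\infty$, resp. $t\to-\infty$, and satisfies $0<q<2\pi$, $p>0$ for all $t\ge0$, resp. $t\le0$. For small $\mu$, over the angles $(q,\varphi)$ with $q$ bounded away from $0$ and $2\pi$, these are graphs $$p=p_0(q)+\mu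 p^{s,u}(q,\varphi,\mu),\quad A=B+\mu A^{s,u}(q,\varphi,\mu),\qquad p_0(q)=\sqrt{2(1-\cos q)}.$$ Put $\Delta A=A^s-A^u$ and $M_{se}=\partial\Delta A/\partial\varphi$. For $m>0$, the splitting condition with constant $m$ holds at $\varphi^0=(\varphi^0_1,\varphi^0_2)$ for the parameter $\mu$ if $$\Delta A(\pi,\varphi^0,\mu)=0\quad\text{and}\quad \det M_{se}(\pi,\varphi^0,\mu)\ge m.$$ Lemma. For every $m>0$ there are positive constants $\mu_0,\kappa,K$, depending only on $f,\omega,m$, such that the following holds for all $0<\mu<\mu_0$ and all $\varphi^0$ at which the splitting condition with constant $m$ holds. Put $\bar\delta=\kappa\mu$. There are $C^1$ functions $q,\varphi_1:(-\bar\delta,\bar\delta)\to\mathbb R$ with $q(0)=\pi$, $\varphi_1(0)=\varphi_1^0$ such that, for all $|\delta|<\bar\delta$ and all $B\in\mathbb R^2$, the whiskers $W^u(\mathcal T(B))$ and $W^s(\mathcal T(B+\delta\omega^\perp))$ intersect at the point of $W^u(\mathcal T(B))$ over the angles $(q(\delta),\varphi_1(\delta),\varphi_2^0)$, and the intersection is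 transversal in the energy level: near this point both whiskers are three-dimensional $C^1$ submanifolds, and their tangent spaces there together span the tangent space $\ker dH$ of the energy level. Moreover, for all $|\delta|<\bar\delta$, $$\frac{d\varphi_1}{d\delta}(\delta)\ne0,\qquad \Big|\frac{d\varphi_1}{d\delta}(\delta)\Big|\le\frac K\mu,\qquad \Big|\frac{dq}{d\delta}(\delta)\Big|\le\frac K\mu.$$ -/

import Mathlib

noncomputable section

namespace Isochronous

/-- Points `(q, φ, p, A)` of the phase space `T^*(S¹ × T²)`, the angles `q`, `φ₁`, `φ₂` being lifted
to the real line; everything below is `2π`-periodic in the angles. -/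
abbrev Phase : Type := ℝ × (Fin 2 → ℝ) × ℝ × (Fin 2 → ℝ)

/-- The wave vectors `k ∈ ℤ²` with `|k₁| + |k₂| ≤ Γ`. -/
def waveVectors (Γ : ℕ) : Finset (ℤ × ℤ) :=
  (Finset.Icc (-(Γ : ℤ)) Γ ×ˢ Finset.Icc (-(Γ : ℤ)) Γ).filter fun k => |k.1| + |k.2| ≤ (Γ : ℤ)

/-- `f(φ) = ∑_{|k₁| + |k₂| ≤ Γ} f_k cos (k · φ)`, where `c k` is the coefficient `f_k`. -/
def trigPoly (Γ : ℕ) (c : ℤ × ℤ → ℝ) (φ : Fin 2 → ℝ) : ℝ :=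
  ∑ k ∈ waveVectors Γ, c k * Real.cos (k.1 * φ 0 + k.2 * φ 1)

/-- `ω` is a `(C, τ)`-Diophantine vector. -/
def IsDiophantine (ω : Fin 2 → ℝ) (C τ : ℝ) : Prop :=
  0 < C ∧ 1 ≤ τ ∧
    ∀ k : ℤ × ℤ, k ≠ 0 → C * (|(k.1 : ℝ)| + |(k.2 : ℝ)|) ^ (-τ) ≤ |ω 0 * k.1 + ω 1 * k.2|

/-- `ω^⊥`. -/
def perp (ω : Fin 2 → ℝ) : Fin 2 → ℝ := ![-ω 1, ω 0]

/-- `H = ω · A + p² / 2 + (cos q - 1) + μ (1 - cos q) f(φ)`. -/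
def hamiltonian (f : (Fin 2 → ℝ) → ℝ) (ω : Fin 2 → ℝ) (μ : ℝ) : Phase → ℝ :=
  fun (q, φ, p, A) =>
    (ω 0 * A 0 + ω 1 * A 1) + p ^ 2 / 2 + (Real.cos q - 1) + μ * ((1 - Real.cos q) * f φ)

/-- The Hamiltonian vector field of `H`:
`q' = ∂H/∂p`, `φ' = ∂H/∂A`, `p' = -∂H/∂q`, `A' = -∂H/∂φ`. -/
def hamiltonianField (H : Phase → ℝ) (z : Phase) : Phase :=
  (fderiv ℝ H z (0, 0, 1, 0),
   fun i => fderiv ℝ H z (0, 0, 0, Pi.single i 1),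
   -fderiv ℝ H z (1, 0, 0, 0),
   fun i => -fderiv ℝ H z (0, Pi.single i 1, 0, 0))

/-- The invariant torus `T(B) = {p = 0, q = 0 mod 2π, A = B}`. -/
def torus (B : Fin 2 → ℝ) : Set Phase :=
  {z | ∃ n : ℤ, ∃ φ : Fin 2 → ℝ, z = (2 * Real.pi * n, φ, 0, B)}

/-- The positive branch of the stable whisker `W^s(T(B))`: the points whose motion tends to `T(B)`
as `t → +∞` and has `p > 0`, `0 < q < 2π` for all `t ≥ 0`. -/
def stableWhisker (H : Phase → ℝ) (B : Fin 2 → ℝ) : Set Phase :=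
  {z | ∃ γ : ℝ → Phase, IsIntegralCurve γ (fun _ => hamiltonianField H) ∧ γ 0 = z ∧
    Filter.Tendsto (fun t => Metric.infDist (γ t) (torus B)) Filter.atTop (nhds 0) ∧
    ∀ t, 0 ≤ t → 0 < (γ t).1 ∧ (γ t).1 < 2 * Real.pi ∧ 0 < (γ t).2.2.1}

/-- The positive branch of the unstable whisker `W^u(T(B))`: the points whose motion tends to `T(B)`
as `t → -∞` and has `p > 0`, `0 < q < 2π` for all `t ≤ 0`. -/
def unstableWhisker (H : Phase → ℝ) (B : Fin 2 → ℝ) : Set Phase :=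
  {z | ∃ γ : ℝ → Phase, IsIntegralCurve γ (fun _ => hamiltonianField H) ∧ γ 0 = z ∧
    Filter.Tendsto (fun t => Metric.infDist (γ t) (torus B)) Filter.atBot (nhds 0) ∧
    ∀ t, t ≤ 0 → 0 < (γ t).1 ∧ (γ t).1 < 2 * Real.pi ∧ 0 < (γ t).2.2.1}

/-- The momenta `(p, A)` of the point of `W` with angles `(q, φ)`, for a set `W` that is a graph
over the angles near `(q, φ)`. -/
def graphMomenta (W : Set Phase) (q : ℝ) (φ : Fin 2 → ℝ) : ℝ × (Fin 2 → ℝ) :=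
  Classical.epsilon fun y : ℝ × (Fin 2 → ℝ) => (q, φ, y.1, y.2) ∈ W

/-- The unperturbed separatrix `p₀(q)`. -/
def p₀ (q : ℝ) : ℝ := Real.sqrt (2 * (1 - Real.cos q))

/- The graph functions `p^u, A^u, p^s, A^s`, defined by
`W^{u,s}(T(B)) = {(q, φ, p₀(q) + μ p^{u,s}(q, φ), B + μ A^{u,s}(q, φ))}`. They do not depend on `B`,
as the equations of motion do not contain `A`, so they are read off at `B = 0`. -/

/-- `p^u`. -/
def pU (f : (Fin 2 → ℝ) → ℝ) (ω : Fin 2 → ℝ) (μ q : ℝ) (φ : Fin 2 → ℝ) : ℝ :=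
  μ⁻¹ * ((graphMomenta (unstableWhisker (hamiltonian f ω μ) 0) q φ).1 - p₀ q)

/-- `A^u`. -/
def AU (f : (Fin 2 → ℝ) → ℝ) (ω : Fin 2 → ℝ) (μ q : ℝ) (φ : Fin 2 → ℝ) : Fin 2 → ℝ :=
  μ⁻¹ • (graphMomenta (unstableWhisker (hamiltonian f ω μ) 0) q φ).2

/-- `A^s`. -/
def AS (f : (Fin 2 → ℝ) → ℝ) (ω : Fin 2 → ℝ) (μ q : ℝ) (φ : Fin 2 → ℝ) : Fin 2 → ℝ :=
  μ⁻¹ • (graphMomenta (stableWhisker (hamiltonian f ω μ) 0) q φ).2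

/-- `ΔA = A^s - A^u`. -/
def ΔA (f : (Fin 2 → ℝ) → ℝ) (ω : Fin 2 → ℝ) (μ q : ℝ) (φ : Fin 2 → ℝ) : Fin 2 → ℝ :=
  AS f ω μ q φ - AU f ω μ q φ

/-- `F(q, φ, δ) = δ ω^⊥ + μ ΔA(q, φ)`. -/
def splittingMap (f : (Fin 2 → ℝ) → ℝ) (ω : Fin 2 → ℝ) (μ q : ℝ) (φ : Fin 2 → ℝ) (δ : ℝ) :
    Fin 2 → ℝ :=
  δ • perp ω + μ • ΔA f ω μ q φ

/-- The south-east block `M_se = ∂ ΔA / ∂ φ` of the splitting matrix `∂(Δp, ΔA) / ∂(q, φ)`. -/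
def Mse (f : (Fin 2 → ℝ) → ℝ) (ω : Fin 2 → ℝ) (μ q : ℝ) (φ : Fin 2 → ℝ) :
    Matrix (Fin 2) (Fin 2) ℝ :=
  Matrix.of fun i j => fderiv ℝ (fun x => ΔA f ω μ q x i) φ (Pi.single j 1)

/-- The splitting condition: `(π, φ₀)` is a homoclinic point, and `det M_se(π, φ₀)` is positive and
of order one, the order being quantified by the constant `m > 0`. -/
def SplittingCondition (f : (Fin 2 → ℝ) → ℝ) (ω : Fin 2 → ℝ) (m μ : ℝ) (φ₀ : Fin 2 → ℝ) : Prop :=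
  splittingMap f ω μ Real.pi φ₀ 0 = 0 ∧ m ≤ (Mse f ω μ Real.pi φ₀).det

/-- Near `z`, the set `S` is a `C¹` submanifold of codimension `k`, with tangent space `T` at `z`. -/
def HasTangentSpaceAt (k : ℕ) (S : Set Phase) (z : Phase) (T : Submodule ℝ Phase) : Prop :=
  ∃ (U : Set Phase) (G : Phase → Fin k → ℝ), IsOpen U ∧ z ∈ U ∧ ContDiffOn ℝ 1 G U ∧
    S ∩ U = {x ∈ U | G x = 0} ∧ Function.Surjective (fderiv ℝ G z) ∧
    T = LinearMap.ker (fderiv ℝ G z : Phase →ₗ[ℝ] (Fin k → ℝ))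

/-- The three-dimensional sets `S` and `S'` intersect transversally at `z` inside the
five-dimensional energy level of `H` through `z`: their tangent spaces span that of the level. -/
def TransversalAt (H : Phase → ℝ) (S S' : Set Phase) (z : Phase) : Prop :=
  z ∈ S ∧ z ∈ S' ∧ ∃ T T' : Submodule ℝ Phase,
    HasTangentSpaceAt 3 S z T ∧ HasTangentSpaceAt 3 S' z T' ∧
    T ⊔ T' = LinearMap.ker (fderiv ℝ H z : Phase →ₗ[ℝ] ℝ)

/-- The point of `W^u(T(B))` over the angles `(q, φ)`. -/
def unstablePoint (f : (Fin 2 → ℝ) → ℝ) (ω : Fin 2 → ℝ) (μ : ℝ) (B : Fin 2 → ℝ) (q : ℝ)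
    (φ : Fin 2 → ℝ) : Phase :=
  (q, φ, p₀ q + μ * pU f ω μ q φ, B + μ • AU f ω μ q φ)

end Isochronous

end

noncomputable section

namespace Isochronous

open MeasureTheory Set Filter Topology

/-! The angles turn rigidly, `φ(t) = φ + tω`, and `A` is a quadrature, so a whisker is governed by
`(q, p)` alone. In the variables `T = -cos (q/2)`, `w = p / (2 sin (q/2))` the equations become `T'
= (1 - T²) w`, `w' = T (w² - 1 + μ f(φ + tω))`, with unperturbed solution `T = tanh t`, `w = 1`.
Writing `T = tanh t - e^{-t} d`, `w = 1 + u`, asymptotic motions become zeros of a smooth map on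
bounded functions of time: `d` is integrated forward from the initial angle, `u` backward from
infinity. The implicit function theorem (`exists_solutionMap`) makes the solution `C¹` in `(μ, q,
φ)`, across `μ = 0`. A priori estimates (`IsReducedMotion.exists_defect_eq_zero`) show that every
whisker motion starting near `q = π` is this solution. So near `q = π` the stable whisker is exactly
a `C¹` graph (`exists_isStableGraph`); the reversal `(q, φ, t) ↦ (2π - q, -φ, -t)` gives the
unstable one.

The whiskers of `T(B)` and `T(B + δω^⊥)` lie on the same energy level because `ω · ω^⊥ = 0`. Over
given angles, equality of the actions therefore forces equality of `p > 0`, and an intersection is a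
solution of the two equations `μ ΔA = -δ ω^⊥`. Since the flow is tangent to both whiskers, at such a
point `p ∂_q ΔA + (∂_φ ΔA) ω = 0` (`fderiv_actionGap_flow`), hence by Cramer's rule `p det ∂ΔA/∂(q,
φ₁) = ω₂ det M_se` (`mul_det_eq`), where `ω₂ ≠ 0` by the Diophantine condition at `k = (0, 1)`. Thus
`ΔA` is a local diffeomorphism in `(q, φ₁)` with `φ₂` frozen. Periodicity in `φ` and compactness
make its size uniform in `φ⁰` and `μ` (`exists_inverse_actionGap`). The curve is the local inverse
evaluated at `-(δ/μ) ω^⊥`, which explains the range `κμ` and the bounds `K/μ`.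

Transversality holds because `det M_se` stays positive along the curve, so the slopes of the two
graphs differ by a surjection onto the actions. For `dφ₁/dδ ≠ 0` one uses that whiskers are
Lagrangian (`expIntegral_slope_mul_symm`): `M_se` is symmetric with positive determinant, hence
definite. If `dφ₁/dδ = 0`, then `∂_q ΔA` would be parallel to `ω^⊥`, and the flow relation would
give `ω · M_se ω = 0` (`ne_zero_of_apply_eq_perp`). -/

/-- Bounded continuous functions of time; only their values at times `t ≥ 0` matter. -/
abbrev BC : Type := BoundedContinuousFunction ℝ ℝ

/-- The bounded continuous function that agrees with `f` on `[0, ∞)` and is constant on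
`(-∞, 0]`. -/
def ofHalfLine (f : ℝ → ℝ) (hf : ContinuousOn f (Ici 0)) (C : ℝ) (hC : ∀ t, 0 ≤ t → |f t| ≤ C) :
    BC :=
  BoundedContinuousFunction.ofNormedAddCommGroup (fun t => f (max t 0))
    (hf.comp_continuous (by fun_prop) fun t => le_max_right t 0) C
    fun t => hC _ (le_max_right t 0)

theorem ofHalfLine_apply {f : ℝ → ℝ} {hf : ContinuousOn f (Ici 0)} {C : ℝ}
    {hC : ∀ t, 0 ≤ t → |f t| ≤ C} (t : ℝ) : ofHalfLine f hf C hC t = f (max t 0) := rfl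

theorem ofHalfLine_apply_of_nonneg {f : ℝ → ℝ} {hf : ContinuousOn f (Ici 0)} {C : ℝ}
    {hC : ∀ t, 0 ≤ t → |f t| ≤ C} {t : ℝ} (ht : 0 ≤ t) : ofHalfLine f hf C hC t = f t := by
  rw [ofHalfLine_apply, max_eq_left ht]

theorem norm_ofHalfLine_le {f : ℝ → ℝ} {hf : ContinuousOn f (Ici 0)} {C : ℝ}
    {hC : ∀ t, 0 ≤ t → |f t| ≤ C} : ‖ofHalfLine f hf C hC‖ ≤ C :=
  BoundedContinuousFunction.norm_ofNormedAddCommGroup_le _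
    ((abs_nonneg _).trans (hC 0 le_rfl)) _

theorem BC.abs_apply_le (h : BC) (t : ℝ) : |h t| ≤ ‖h‖ := h.norm_coe_le_norm t

/-! ### Exponential bounds for the hyperbolic functions. -/

theorem cosh_le_exp {t : ℝ} (ht : 0 ≤ t) : Real.cosh t ≤ Real.exp t := by
  rw [Real.cosh_eq]
  have : Real.exp (-t) ≤ Real.exp t := Real.exp_le_exp.2 (by linarith)
  linarith

theorem exp_le_two_mul_cosh (t : ℝ) : Real.exp t ≤ 2 * Real.cosh t := by
  rw [Real.cosh_eq]
  have := Real.exp_pos (-t)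
  linarith

theorem exp_div_cosh_sq_le (t : ℝ) : Real.exp t / Real.cosh t ^ 2 ≤ 4 * Real.exp (-t) := by
  have h := exp_le_two_mul_cosh t
  have hc := Real.cosh_pos t
  have he := Real.exp_pos t
  rw [div_le_iff₀ (by positivity), Real.exp_neg]
  have : Real.exp t ^ 2 ≤ (2 * Real.cosh t) ^ 2 := by gcongr
  field_simp
  nlinarith

theorem inv_cosh_sq_le (t : ℝ) : (Real.cosh t ^ 2)⁻¹ ≤ 4 * Real.exp (-2 * t) := by
  have h := exp_div_cosh_sq_le t
  have he := Real.exp_pos (-t)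
  calc (Real.cosh t ^ 2)⁻¹ = Real.exp (-t) * (Real.exp t / Real.cosh t ^ 2) := by
        rw [Real.exp_neg]; field_simp
    _ ≤ Real.exp (-t) * (4 * Real.exp (-t)) := by gcongr
    _ = 4 * Real.exp (-2 * t) := by
        rw [show -2 * t = -t + -t by ring, Real.exp_add]; ring

/-! ### The basic operators -/

theorem continuous_forward (h : BC) :
    Continuous fun t => Real.exp t / Real.cosh t ^ 2 *
      ∫ r in (0 : ℝ)..t, Real.exp (-r) * Real.cosh r ^ 2 * h r := by
  have hc : Continuous fun r => Real.exp (-r) * Real.cosh r ^ 2 * h r := by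
    have := h.continuous
    fun_prop
  refine Continuous.mul ?_ (intervalIntegral.continuous_primitive
    (fun a b => hc.intervalIntegrable a b) 0)
  exact Real.continuous_exp.div (by fun_prop) fun t => (pow_pos (Real.cosh_pos t) 2).ne'

/-- The kernel `e^t cosh⁻² t · e^{-r} cosh² r` is at most `4 e^{-(t - r)}`: even after
multiplication by `e^t` the homogeneous equation contracts, so integrating forward from time `0`
preserves boundedness. -/
theorem abs_forward_le (h : BC) {t : ℝ} (ht : 0 ≤ t) :
    |Real.exp t / Real.cosh t ^ 2 * ∫ r in (0 : ℝ)..t, Real.exp (-r) * Real.cosh r ^ 2 * h r|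
      ≤ 4 * ‖h‖ := by
  have h1 : |∫ r in (0 : ℝ)..t, Real.exp (-r) * Real.cosh r ^ 2 * h r|
      ≤ ∫ r in (0 : ℝ)..t, ‖h‖ * Real.exp r := by
    rw [← Real.norm_eq_abs]
    refine intervalIntegral.norm_integral_le_of_norm_le ht ?_
      (by apply Continuous.intervalIntegrable; fun_prop)
    refine Eventually.of_forall fun r hr => ?_
    have hr0 : 0 ≤ r := hr.1.le
    rw [Real.norm_eq_abs, abs_mul, abs_of_nonneg (by positivity), mul_comm]
    have hcr := cosh_le_exp hr0
    have hp := Real.cosh_pos r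
    have : Real.exp (-r) * Real.cosh r ^ 2 ≤ Real.exp r := by
      calc Real.exp (-r) * Real.cosh r ^ 2 ≤ Real.exp (-r) * Real.exp r ^ 2 := by gcongr
        _ = Real.exp r := by rw [Real.exp_neg]; field_simp
    exact mul_le_mul (h.abs_apply_le r) this (by positivity) (norm_nonneg h)
  rw [intervalIntegral.integral_const_mul, integral_exp, Real.exp_zero] at h1
  have h2 := exp_div_cosh_sq_le t
  have hp : 0 < Real.cosh t ^ 2 := pow_pos (Real.cosh_pos t) 2
  rw [abs_mul, abs_of_nonneg (by positivity)]
  calc _ ≤ (4 * Real.exp (-t)) * (‖h‖ * (Real.exp t - 1)) := by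
        gcongr
    _ = 4 * ‖h‖ * (1 - Real.exp (-t)) := by
        rw [Real.exp_neg]; field_simp
    _ ≤ 4 * ‖h‖ * 1 := by
        gcongr
        have := Real.exp_pos (-t)
        linarith
    _ = _ := mul_one _

/-- The operator `h ↦ y`, where `y' = (1 - 2 tanh t) y + h`, `y(0) = 0`. -/
def forwardOp : BC →L[ℝ] BC :=
  LinearMap.mkContinuous
    { toFun := fun h => ofHalfLine (fun t => Real.exp t / Real.cosh t ^ 2 *
        ∫ r in (0 : ℝ)..t, Real.exp (-r) * Real.cosh r ^ 2 * h r)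
        (continuous_forward h).continuousOn (4 * ‖h‖) fun _ => abs_forward_le h
      map_add' := fun h k => by
        ext t
        have hi : ∀ (h : BC), IntervalIntegrable (fun r => Real.exp (-r) * Real.cosh r ^ 2 * h r)
            volume 0 (max t 0) := fun h => by
          have := h.continuous
          apply Continuous.intervalIntegrable; fun_prop
        simp only [ofHalfLine_apply, BoundedContinuousFunction.coe_add, Pi.add_apply]
        simp_rw [mul_add (_ * _) (h _)]
        rw [intervalIntegral.integral_add (hi h) (hi k), mul_add]
      map_smul' := fun c h => by
        ext t
        simp only [ofHalfLine_apply, BoundedContinuousFunction.coe_smul, smul_eq_mul,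
          RingHom.id_apply]
        simp_rw [mul_left_comm _ c]
        rw [intervalIntegral.integral_const_mul]
        ring } 4 fun _ => norm_ofHalfLine_le

theorem forwardOp_apply (h : BC) {t : ℝ} (ht : 0 ≤ t) :
    forwardOp h t = Real.exp t / Real.cosh t ^ 2 *
      ∫ r in (0 : ℝ)..t, Real.exp (-r) * Real.cosh r ^ 2 * h r := by
  change ofHalfLine _ _ _ _ t = _
  rw [ofHalfLine_apply_of_nonneg ht]

theorem integrableOn_exp_mul (h : BC) (c : ℝ) {b : ℝ} (hb : b < 0) :
    IntegrableOn (fun r => Real.exp (b * r) * h r) (Ioi c) := by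
  have : IntegrableOn (fun r => Real.exp (b * r)) (Ioi c) := by
    simpa using integrableOn_exp_mul_Ioi hb c
  exact this.mul_bdd (c := ‖h‖) (by have := h.continuous; fun_prop)
    (Eventually.of_forall fun r => h.norm_coe_le_norm r)

theorem integrableOn_inv_cosh_sq_mul (h : BC) (c : ℝ) :
    IntegrableOn (fun r => (Real.cosh r ^ 2)⁻¹ * h r) (Ioi c) := by
  have h1 : IntegrableOn (fun r => 4 * ‖h‖ * Real.exp (-2 * r)) (Ioi c) :=
    (integrableOn_exp_mul_Ioi (by norm_num) c).const_mul _
  refine h1.mono' ?_ (Eventually.of_forall fun r => ?_)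
  · have hc : Continuous fun r => (Real.cosh r ^ 2)⁻¹ * h r :=
      (Continuous.inv₀ (by fun_prop) fun t => (pow_pos (Real.cosh_pos t) 2).ne').mul h.continuous
    exact hc.aestronglyMeasurable
  · rw [Real.norm_eq_abs, abs_mul, abs_of_nonneg (by positivity)]
    calc _ ≤ (4 * Real.exp (-2 * r)) * ‖h‖ := by
          gcongr
          · exact inv_cosh_sq_le r
          · exact h.abs_apply_le r
      _ = _ := by ring

/-- The homogeneous solution `cosh² t` grows like `e^{2t}`, so a bounded solution must be integrated
back from infinity. Its kernel is at most `4 e^{-2(r - t)}`, whose integral over `r > t` is `2`. -/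
theorem abs_backward_le (h : BC) {t : ℝ} (ht : 0 ≤ t) :
    |Real.cosh t ^ 2 * ∫ r in Ioi t, (Real.cosh r ^ 2)⁻¹ * h r| ≤ 2 * ‖h‖ := by
  have h1 : |∫ r in Ioi t, (Real.cosh r ^ 2)⁻¹ * h r| ≤
      ∫ r in Ioi t, 4 * ‖h‖ * Real.exp (-2 * r) := by
    rw [← Real.norm_eq_abs]
    refine norm_integral_le_of_norm_le
      ((integrableOn_exp_mul_Ioi (by norm_num) t).const_mul _) (Eventually.of_forall fun r => ?_)
    rw [Real.norm_eq_abs, abs_mul, abs_of_nonneg (by positivity)]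
    calc _ ≤ (4 * Real.exp (-2 * r)) * ‖h‖ := by
          gcongr
          · exact inv_cosh_sq_le r
          · exact h.abs_apply_le r
      _ = _ := by ring
  rw [integral_const_mul, integral_exp_mul_Ioi (by norm_num)] at h1
  have hc := cosh_le_exp ht
  have hp := Real.cosh_pos t
  rw [abs_mul, abs_of_nonneg (by positivity)]
  calc _ ≤ Real.exp t ^ 2 * (4 * ‖h‖ * (-Real.exp (-2 * t) / -2)) := by gcongr
    _ = 2 * ‖h‖ * (Real.exp t ^ 2 * Real.exp (-2 * t)) := by ring
    _ = _ := by
      rw [← Real.exp_nat_mul, ← Real.exp_add]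
      simp

theorem setIntegral_Ioi_eq_sub {f : ℝ → ℝ} (hf : ∀ c, IntegrableOn f (Ioi c)) (t : ℝ) :
    ∫ r in Ioi t, f r = (∫ r in Ioi 0, f r) - ∫ r in (0 : ℝ)..t, f r := by
  rw [← intervalIntegral.integral_Ioi_sub_Ioi' (hf 0) (hf t)]
  ring

theorem continuous_inv_cosh_sq_mul (h : BC) :
    Continuous fun r => (Real.cosh r ^ 2)⁻¹ * h r :=
  (Continuous.inv₀ (by fun_prop) fun t => (pow_pos (Real.cosh_pos t) 2).ne').mul h.continuous

theorem continuous_backward (h : BC) :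
    Continuous fun t => Real.cosh t ^ 2 * ∫ r in Ioi t, (Real.cosh r ^ 2)⁻¹ * h r := by
  rw [funext fun t => congrArg (Real.cosh t ^ 2 * ·)
    (setIntegral_Ioi_eq_sub (integrableOn_inv_cosh_sq_mul h) t)]
  have := intervalIntegral.continuous_primitive (μ := volume)
    (fun a b => (continuous_inv_cosh_sq_mul h).intervalIntegrable a b) 0
  fun_prop

/-- The operator `h ↦ y`, where `y` is the bounded solution of `y' = 2 tanh t y - h`. -/
def backwardOp : BC →L[ℝ] BC :=
  LinearMap.mkContinuous
    { toFun := fun h => ofHalfLine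
        (fun t => Real.cosh t ^ 2 * ∫ r in Ioi t, (Real.cosh r ^ 2)⁻¹ * h r)
        (continuous_backward h).continuousOn (2 * ‖h‖) fun _ => abs_backward_le h
      map_add' := fun h k => by
        ext t
        simp only [ofHalfLine_apply, BoundedContinuousFunction.coe_add, Pi.add_apply]
        simp_rw [mul_add _ (h _)]
        rw [integral_add (integrableOn_inv_cosh_sq_mul h _) (integrableOn_inv_cosh_sq_mul k _),
          mul_add]
      map_smul' := fun c h => by
        ext t
        simp only [ofHalfLine_apply, BoundedContinuousFunction.coe_smul, smul_eq_mul,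
          RingHom.id_apply]
        simp_rw [mul_left_comm _ c]
        rw [integral_const_mul]
        ring } 2 fun _ => norm_ofHalfLine_le

theorem backwardOp_apply (h : BC) {t : ℝ} (ht : 0 ≤ t) :
    backwardOp h t = Real.cosh t ^ 2 * ∫ r in Ioi t, (Real.cosh r ^ 2)⁻¹ * h r := by
  change ofHalfLine _ _ _ _ t = _
  rw [ofHalfLine_apply_of_nonneg ht]

/-- The functional `h ↦ ∫₀^∞ e^{-r} h(r) dr`. -/
def expIntegral : BC →L[ℝ] ℝ :=
  LinearMap.mkContinuous
    { toFun := fun h => ∫ r in Ioi (0 : ℝ), Real.exp (-1 * r) * h r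
      map_add' := fun h k => by
        simp only [BoundedContinuousFunction.coe_add, Pi.add_apply]
        simp_rw [mul_add _ (h _)]
        exact integral_add (integrableOn_exp_mul h 0 (by norm_num))
          (integrableOn_exp_mul k 0 (by norm_num))
      map_smul' := fun c h => by
        simp only [BoundedContinuousFunction.coe_smul, smul_eq_mul, RingHom.id_apply]
        simp_rw [mul_left_comm _ c]
        exact integral_const_mul _ _ } 1 fun h => by
    refine (norm_integral_le_of_norm_le (g := fun r => ‖h‖ * Real.exp (-1 * r))
      ((integrableOn_exp_mul_Ioi (by norm_num) 0).const_mul _)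
      (Eventually.of_forall fun r => ?_)).trans ?_
    · rw [Real.norm_eq_abs, abs_mul, Real.abs_exp, mul_comm]
      gcongr
      exact h.abs_apply_le r
    · rw [integral_const_mul, integral_exp_mul_Ioi (by norm_num)]
      simp

theorem expIntegral_apply (h : BC) :
    expIntegral h = ∫ r in Ioi (0 : ℝ), Real.exp (-1 * r) * h r := rfl

/-! ### The differential equations satisfied by the images -/

theorem hasDerivAt_exp_div_cosh_sq (t : ℝ) :
    HasDerivAt (fun t => Real.exp t / Real.cosh t ^ 2)
      (Real.exp t / Real.cosh t ^ 2 * (1 - 2 * Real.tanh t)) t := by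
  have hp := (Real.cosh_pos t).ne'
  refine ((Real.hasDerivAt_exp t).div ((Real.hasDerivAt_cosh t).pow 2)
    (pow_ne_zero 2 hp)).congr_deriv ?_
  rw [Real.tanh_eq_sinh_div_cosh]
  simp
  field_simp

theorem hasDerivAt_forwardOp (h : BC) {t : ℝ} (ht : 0 < t) :
    HasDerivAt (forwardOp h) ((1 - 2 * Real.tanh t) * forwardOp h t + h t) t := by
  have hp := (Real.cosh_pos t).ne'
  have hc : Continuous fun r => Real.exp (-r) * Real.cosh r ^ 2 * h r := by
    have := h.continuous
    fun_prop
  have h1 := (hasDerivAt_exp_div_cosh_sq t).mul (hc.integral_hasStrictDerivAt 0 t).hasDerivAt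
  have h2 : (forwardOp h : ℝ → ℝ) =ᶠ[𝓝 t] fun t => Real.exp t / Real.cosh t ^ 2 *
      ∫ r in (0 : ℝ)..t, Real.exp (-r) * Real.cosh r ^ 2 * h r := by
    filter_upwards [lt_mem_nhds ht] with s hs using forwardOp_apply h hs.le
  refine (h1.congr_of_eventuallyEq h2).congr_deriv ?_
  rw [forwardOp_apply h ht.le, Real.exp_neg]
  field_simp

theorem hasDerivAt_backwardOp (h : BC) {t : ℝ} (ht : 0 < t) :
    HasDerivAt (backwardOp h) (2 * Real.tanh t * backwardOp h t - h t) t := by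
  have hp := (Real.cosh_pos t).ne'
  have h1 := ((Real.hasDerivAt_cosh t).pow 2).mul
    (((continuous_inv_cosh_sq_mul h).integral_hasStrictDerivAt 0 t).hasDerivAt.const_sub
      (∫ r in Ioi 0, (Real.cosh r ^ 2)⁻¹ * h r))
  have h2 : (backwardOp h : ℝ → ℝ) =ᶠ[𝓝 t] fun t => Real.cosh t ^ 2 *
      ((∫ r in Ioi 0, (Real.cosh r ^ 2)⁻¹ * h r) -
        ∫ r in (0 : ℝ)..t, (Real.cosh r ^ 2)⁻¹ * h r) := by
    filter_upwards [lt_mem_nhds ht] with s hs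
    rw [backwardOp_apply h hs.le, setIntegral_Ioi_eq_sub (integrableOn_inv_cosh_sq_mul h)]
  refine (h1.congr_of_eventuallyEq h2).congr_deriv ?_
  rw [backwardOp_apply h ht.le, setIntegral_Ioi_eq_sub (integrableOn_inv_cosh_sq_mul h) t,
    Real.tanh_eq_sinh_div_cosh]
  simp only [Nat.cast_ofNat, Nat.add_one_sub_one, pow_one, Pi.pow_apply]
  field_simp
  ring

theorem hasDerivAt_tanh (t : ℝ) : HasDerivAt Real.tanh (1 - Real.tanh t ^ 2) t := by
  have hp := (Real.cosh_pos t).ne'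
  have h := (Real.hasDerivAt_sinh t).div (Real.hasDerivAt_cosh t) hp
  have h2 : Real.tanh = Real.sinh / Real.cosh := funext Real.tanh_eq_sinh_div_cosh
  rw [h2]
  refine h.congr_deriv ?_
  simp only [Pi.div_apply]
  field_simp

theorem one_sub_tanh_sq (t : ℝ) : 1 - Real.tanh t ^ 2 = (Real.cosh t ^ 2)⁻¹ := by
  have hp := (Real.cosh_pos t).ne'
  rw [Real.tanh_eq_sinh_div_cosh, div_pow, eq_comm, inv_eq_one_div, eq_sub_iff_add_eq,
    ← add_div, div_eq_one_iff_eq (pow_ne_zero 2 hp), Real.cosh_sq]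
  ring

theorem continuous_tanh : Continuous Real.tanh :=
  continuous_iff_continuousAt.2 fun t => (hasDerivAt_tanh t).continuousAt

/-! ### The fixed point equation for the stable whisker -/

/-- `e^{-t}`. -/
def expW : BC :=
  ofHalfLine (fun t => Real.exp (-t)) (by fun_prop) 1 fun t ht => by
    rw [Real.abs_exp]; exact Real.exp_le_one_iff.2 (by linarith)

/-- `e^t / cosh² t`. -/
def sechW : BC :=
  ofHalfLine (fun t => Real.exp t / Real.cosh t ^ 2)
    (fun t _ => (hasDerivAt_exp_div_cosh_sq t).continuousAt.continuousWithinAt) 4 fun t ht => by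
    have := Real.cosh_pos t
    rw [abs_of_nonneg (by positivity)]
    have h1 : Real.exp (-t) ≤ 1 := Real.exp_le_one_iff.2 (by linarith)
    linarith [exp_div_cosh_sq_le t]

/-- `tanh t`. -/
def tanhW : BC :=
  ofHalfLine Real.tanh continuous_tanh.continuousOn 1 fun t _ => (Real.abs_tanh_lt_one t).le

theorem expW_apply {t : ℝ} (ht : 0 ≤ t) : expW t = Real.exp (-t) := ofHalfLine_apply_of_nonneg ht

theorem sechW_apply {t : ℝ} (ht : 0 ≤ t) : sechW t = Real.exp t / Real.cosh t ^ 2 :=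
  ofHalfLine_apply_of_nonneg ht

theorem tanhW_apply {t : ℝ} (ht : 0 ≤ t) : tanhW t = Real.tanh t := ofHalfLine_apply_of_nonneg ht

/-- `T = tanh t - e^{-t} d`, the variable `-cos (q / 2)` along a motion. -/
def slope (d : BC) : BC := tanhW - expW * d

/-- `e^t (1 - T²)`. -/
def density (d : BC) : BC := sechW + (2 : ℝ) • (tanhW * d) - expW * (d * d)

/-- The inhomogeneity of the equation for `d`. -/
def sourceD (d u : BC) : BC := expW * (d * d) - density d * u

/-- The inhomogeneity of the equation for `u`. -/
def sourceU (G d u : BC) : BC := slope d * (u * u + G) - (2 : ℝ) • (expW * d * u)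

/-- The defect in the integral equations of the stable whisker: `x = (D₀, G)` holds the initial value
and the forcing, `y = (d, u)` the unknown. -/
def defect (z : (ℝ × BC) × (BC × BC)) : BC × BC :=
  (z.2.1 - z.1.1 • sechW - forwardOp (sourceD z.2.1 z.2.2),
    z.2.2 + backwardOp (sourceU z.1.2 z.2.1 z.2.2))

/-- `defect` is a polynomial in the Banach algebra `BC`, composed with bounded linear operators. -/
theorem contDiff_defect : ContDiff ℝ 1 defect := by
  unfold defect sourceD sourceU density slope
  fun_prop

theorem hasDerivAt_density {d : ℝ → BC} {d' : BC} {s : ℝ} (hd : HasDerivAt d d' s) :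
    HasDerivAt (fun s => density (d s)) ((2 : ℝ) • (slope (d s) * d')) s := by
  unfold density slope
  refine ((((hd.const_mul tanhW).const_smul (2 : ℝ)).const_add sechW).sub
    ((hd.mul hd).const_mul expW)).congr_deriv ?_
  simp only [two_smul]
  ring

theorem hasDerivAt_slope {d : ℝ → BC} {d' : BC} {s : ℝ} (hd : HasDerivAt d d' s) :
    HasDerivAt (fun s => slope (d s)) (-(expW * d')) s :=
  (hd.const_mul expW).const_sub tanhW

/-- The linearization of `sourceD`. -/
def sourceD' (d u d' u' : BC) : BC :=
  (2 : ℝ) • (expW * d * d') - ((2 : ℝ) • (slope d * d') * u + density d * u')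

/-- The linearization of `sourceU`. -/
def sourceU' (G d u G' d' u' : BC) : BC :=
  slope d * ((2 : ℝ) • (u * u') + G') - expW * d' * (u * u + G)
    - (2 : ℝ) • (expW * (d' * u + d * u'))

theorem hasDerivAt_sourceD {d u : ℝ → BC} {d' u' : BC} {s : ℝ} (hd : HasDerivAt d d' s)
    (hu : HasDerivAt u u' s) :
    HasDerivAt (fun s => sourceD (d s) (u s)) (sourceD' (d s) (u s) d' u') s := by
  unfold sourceD sourceD'
  refine (((hd.mul hd).const_mul expW).sub ((hasDerivAt_density hd).mul hu)).congr_deriv ?_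
  simp only [two_smul]
  ring

theorem hasDerivAt_sourceU {G d u : ℝ → BC} {G' d' u' : BC} {s : ℝ} (hG : HasDerivAt G G' s)
    (hd : HasDerivAt d d' s) (hu : HasDerivAt u u' s) :
    HasDerivAt (fun s => sourceU (G s) (d s) (u s)) (sourceU' (G s) (d s) (u s) G' d' u') s := by
  unfold sourceU sourceU'
  refine (((hasDerivAt_slope hd).mul ((hu.mul hu).add hG)).sub
    (((hd.const_mul expW).mul hu).const_smul (2 : ℝ))).congr_deriv ?_
  simp only [two_smul, Pi.add_apply, Pi.mul_apply]
  ring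

theorem hasDerivAt_defect {a : ℝ → ℝ} {G d u : ℝ → BC} {a' : ℝ} {G' d' u' : BC} {s : ℝ}
    (ha : HasDerivAt a a' s) (hG : HasDerivAt G G' s) (hd : HasDerivAt d d' s)
    (hu : HasDerivAt u u' s) :
    HasDerivAt (fun s => defect ((a s, G s), (d s, u s)))
      (d' - a' • sechW - forwardOp (sourceD' (d s) (u s) d' u'),
        u' + backwardOp (sourceU' (G s) (d s) (u s) G' d' u')) s :=
  ((hd.sub (ha.smul_const sechW)).sub
      (forwardOp.hasFDerivAt.comp_hasDerivAt s (hasDerivAt_sourceD hd hu))).prodMk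
    (hu.add (backwardOp.hasFDerivAt.comp_hasDerivAt s (hasDerivAt_sourceU hG hd hu)))

theorem defect_zero : defect 0 = 0 := by
  simp [defect, sourceD, sourceU]

/-- The derivative of `defect` at zero in the direction of the unknowns. -/
def defectEquiv : (BC × BC) ≃L[ℝ] (BC × BC) :=
  ContinuousLinearEquiv.equivOfInverse
    ((ContinuousLinearMap.fst ℝ BC BC + forwardOp ∘L
      (ContinuousLinearMap.mul ℝ BC sechW ∘L ContinuousLinearMap.snd ℝ BC BC)).prod
      (ContinuousLinearMap.snd ℝ BC BC))
    ((ContinuousLinearMap.fst ℝ BC BC - forwardOp ∘L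
      (ContinuousLinearMap.mul ℝ BC sechW ∘L ContinuousLinearMap.snd ℝ BC BC)).prod
      (ContinuousLinearMap.snd ℝ BC BC))
    (fun y => by simp) (fun y => by simp)

/-- At zero the only surviving linear term of the two sources is `-sechW * u` in `sourceD`. The
linearization is the identity plus a strictly triangular term. -/
theorem isInvertible_fderiv_defect :
    (fderiv ℝ defect 0 ∘L .inr ℝ (ℝ × BC) (BC × BC)).IsInvertible := by
  refine ⟨defectEquiv, ?_⟩
  refine ContinuousLinearMap.ext fun y => ?_
  have h1 := hasDerivAt_defect (s := 0) (hasDerivAt_const (0 : ℝ) (0 : ℝ))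
    (hasDerivAt_const (0 : ℝ) (0 : BC)) ((hasDerivAt_id (0 : ℝ)).smul_const y.1)
    ((hasDerivAt_id (0 : ℝ)).smul_const y.2)
  have h2 : HasDerivAt (fun s : ℝ => s • ((0 : ℝ × BC), y)) ((1 : ℝ) • ((0 : ℝ × BC), y)) 0 :=
    HasDerivAt.smul_const (hasDerivAt_id' (0 : ℝ)) ((0 : ℝ × BC), y)
  have hdef : HasFDerivAt defect (fderiv ℝ defect 0) ((0 : ℝ) • ((0 : ℝ × BC), y)) := by
    rw [zero_smul]
    exact (contDiff_defect.differentiable (by norm_num) 0).hasFDerivAt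
  have h3 := hdef.comp_hasDerivAt (0 : ℝ) h2
  have h4 : (defect ∘ fun s : ℝ => s • ((0 : ℝ × BC), y)) =
      fun s => defect ((0, 0), (id s • y.1, id s • y.2)) := by
    ext1 s
    simp [Prod.smul_def]
    rfl
  rw [h4] at h3
  have h5 := h3.unique h1
  simp only [ContinuousLinearMap.comp_apply, ContinuousLinearMap.inr_apply]
  rw [one_smul] at h5
  refine Eq.trans ?_ h5.symm
  simp [defectEquiv, sourceD', sourceU', density]

/-- The bound `‖Ψ x‖ < 1` gives `1 + u > 0`, hence `p > 0`. The uniqueness clause is what later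
identifies every whisker motion with this solution. -/
theorem exists_solutionMap : ∃ (Ψ : ℝ × BC → BC × BC) (ε : ℝ), 0 < ε ∧
    ContDiffOn ℝ 1 Ψ (Metric.ball 0 ε) ∧
    (∀ x ∈ Metric.ball (0 : ℝ × BC) ε, ‖Ψ x‖ < 1 ∧ defect (x, Ψ x) = 0) ∧
    ∀ x ∈ Metric.ball (0 : ℝ × BC) ε, ∀ y ∈ Metric.ball (0 : BC × BC) ε,
      defect (x, y) = 0 → y = Ψ x := by
  have hc : ContDiffAt ℝ 1 defect 0 := contDiff_defect.contDiffAt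
  have hi := isInvertible_fderiv_defect
  have hn : (1 : WithTop ℕ∞) ≠ 0 := by norm_num
  set Ψ := hc.implicitFunction hn hi with hΨ
  have h1 : ∀ᶠ x in 𝓝 (0 : ℝ × BC), defect (x, Ψ x) = 0 := by
    have := hc.eventually_apply_implicitFunction hn hi
    rwa [defect_zero] at this
  have h2 : ∀ᶠ v in 𝓝 (0 : (ℝ × BC) × (BC × BC)), defect v = 0 ↔ Ψ v.1 = v.2 := by
    have := hc.eventually_apply_eq_iff_implicitFunction hn hi
    rwa [defect_zero] at this
  have h3 : ContDiffAt ℝ 1 Ψ 0 := hc.contDiffAt_implicitFunction hn hi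
  have h4 : ∀ᶠ x in 𝓝 (0 : ℝ × BC), ContDiffAt ℝ 1 Ψ x := h3.eventually (by simp)
  have h0 : Ψ 0 = 0 := hc.implicitFunction_apply_self hn hi
  have h5 : ∀ᶠ x in 𝓝 (0 : ℝ × BC), ‖Ψ x‖ < 1 := by
    have := h3.continuousAt.norm
    exact this.eventually_lt_const (by simp [h0])
  obtain ⟨ε₁, hε₁, h6⟩ := Metric.eventually_nhds_iff_ball.1 (h1.and (h4.and h5))
  obtain ⟨ε₂, hε₂, h7⟩ := Metric.eventually_nhds_iff_ball.1 h2
  refine ⟨Ψ, min ε₁ ε₂, lt_min hε₁ hε₂, fun x hx => ?_, fun x hx => ?_, fun x hx y hy hxy => ?_⟩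
  · exact (h6 x (Metric.ball_subset_ball (min_le_left _ _) hx)).2.1.contDiffWithinAt
  · have := h6 x (Metric.ball_subset_ball (min_le_left _ _) hx)
    exact ⟨this.2.2, this.1⟩
  · refine ((h7 (x, y) ?_).1 hxy).symm
    have hx' := Metric.ball_subset_ball (min_le_right ε₁ ε₂) hx
    have hy' := Metric.ball_subset_ball (min_le_right ε₁ ε₂) hy
    rw [mem_ball_zero_iff] at hx' hy' ⊢
    exact max_lt hx' hy'

/-! ### The perturbation along an orbit -/

/-- `k · φ`. -/
def phase (k : ℤ × ℤ) (φ : Fin 2 → ℝ) : ℝ := k.1 * φ 0 + k.2 * φ 1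

/-- The `i`-th component of `k`. -/
def comp (k : ℤ × ℤ) (i : Fin 2) : ℝ := ![(k.1 : ℝ), k.2] i

theorem phase_add_smul (k : ℤ × ℤ) (φ ψ : Fin 2 → ℝ) (t : ℝ) :
    phase k (φ + t • ψ) = phase k φ + phase k ψ * t := by
  simp [phase]; ring

theorem phase_single (k : ℤ × ℤ) (i : Fin 2) : phase k (Pi.single i 1) = comp k i := by
  fin_cases i <;> simp [phase, comp]

/-- The partial derivative `∂ᵢ f`. -/
def gradPoly (Γ : ℕ) (c : ℤ × ℤ → ℝ) (i : Fin 2) (φ : Fin 2 → ℝ) : ℝ :=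
  ∑ k ∈ waveVectors Γ, c k * (-(comp k i * Real.sin (phase k φ)))

theorem contDiff_phase (k : ℤ × ℤ) {n : WithTop ℕ∞} : ContDiff ℝ n (phase k) := by
  unfold phase; fun_prop

theorem contDiff_trigPoly (Γ : ℕ) (c : ℤ × ℤ → ℝ) {n : WithTop ℕ∞} :
    ContDiff ℝ n (trigPoly Γ c) := by
  unfold trigPoly; fun_prop

theorem contDiff_gradPoly (Γ : ℕ) (c : ℤ × ℤ → ℝ) (i : Fin 2) {n : WithTop ℕ∞} :
    ContDiff ℝ n (gradPoly Γ c i) := by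
  unfold gradPoly
  have := fun k => contDiff_phase k (n := n)
  fun_prop

theorem hasDerivAt_phase (k : ℤ × ℤ) (φ ψ : Fin 2 → ℝ) (s : ℝ) :
    HasDerivAt (fun s => phase k (φ + s • ψ)) (phase k ψ) s := by
  simp_rw [phase_add_smul]
  simpa using ((hasDerivAt_id s).const_mul (phase k ψ)).const_add (phase k φ)

theorem hasDerivAt_trigPoly_line (Γ : ℕ) (c : ℤ × ℤ → ℝ) (φ : Fin 2 → ℝ) (i : Fin 2) (s : ℝ) :
    HasDerivAt (fun s : ℝ => trigPoly Γ c (φ + s • Pi.single i 1))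
      (gradPoly Γ c i (φ + s • Pi.single i 1)) s := by
  unfold trigPoly gradPoly
  refine HasDerivAt.fun_sum fun k _ => ?_
  refine ((hasDerivAt_phase k φ (Pi.single i 1) s).cos.const_mul (c k)).congr_deriv ?_
  rw [phase_single]
  ring

/-! ### The vector field -/

/-- The Hamiltonian vector field in explicit form. -/
def flowField (Γ : ℕ) (c : ℤ × ℤ → ℝ) (ω : Fin 2 → ℝ) (μ : ℝ) (z : Phase) : Phase :=
  (z.2.2.1, ω, Real.sin z.1 * (1 - μ * trigPoly Γ c z.2.1),
    fun i => -(μ * ((1 - Real.cos z.1) * gradPoly Γ c i z.2.1)))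

theorem contDiff_hamiltonian (Γ : ℕ) (c : ℤ × ℤ → ℝ) (ω : Fin 2 → ℝ) (μ : ℝ) {n : WithTop ℕ∞} :
    ContDiff ℝ n (hamiltonian (trigPoly Γ c) ω μ) := by
  unfold hamiltonian
  have := contDiff_trigPoly Γ c (n := n)
  fun_prop

theorem contDiff_flowField (Γ : ℕ) (c : ℤ × ℤ → ℝ) (ω : Fin 2 → ℝ) (μ : ℝ) {n : WithTop ℕ∞} :
    ContDiff ℝ n (flowField Γ c ω μ) := by
  unfold flowField
  have := contDiff_trigPoly Γ c (n := n)
  have := fun i => contDiff_gradPoly Γ c i (n := n)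
  fun_prop

theorem fderiv_hamiltonian_eq {Γ : ℕ} {c : ℤ × ℤ → ℝ} {ω : Fin 2 → ℝ} {μ : ℝ} {z v : Phase} {r : ℝ}
    (h : HasDerivAt (fun s : ℝ => hamiltonian (trigPoly Γ c) ω μ (z + s • v)) r 0) :
    fderiv ℝ (hamiltonian (trigPoly Γ c) ω μ) z v = r := by
  rw [← ((contDiff_hamiltonian Γ c ω μ (n := 1)).differentiable
    (by norm_num) z).lineDeriv_eq_fderiv]
  exact h.deriv

theorem hamiltonianField_eq (Γ : ℕ) (c : ℤ × ℤ → ℝ) (ω : Fin 2 → ℝ) (μ : ℝ) :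
    hamiltonianField (hamiltonian (trigPoly Γ c) ω μ) = flowField Γ c ω μ := by
  funext ⟨q, φ, p, A⟩
  have h0 := hasDerivAt_id' (0 : ℝ)
  refine Prod.ext ?_ (Prod.ext ?_ (Prod.ext ?_ ?_))
  · refine fderiv_hamiltonian_eq ?_
    simp only [hamiltonian, Prod.smul_mk, smul_zero, add_zero, smul_eq_mul, mul_zero,
      mul_one]
    refine ((((((h0.const_add p).fun_pow 2).div_const 2).const_add _).add_const _).add_const
      _).congr_deriv ?_
    simp [flowField]
  · funext i
    refine fderiv_hamiltonian_eq ?_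
    simp only [hamiltonian, Prod.smul_mk, smul_zero, add_zero, smul_eq_mul, mul_zero,
      Pi.add_apply, Pi.smul_apply]
    refine ((((((h0.mul_const ((Pi.single i 1 : Fin 2 → ℝ) 0)).const_add (A 0)).const_mul (ω 0)).fun_add
      (((h0.mul_const ((Pi.single i 1 : Fin 2 → ℝ) 1)).const_add (A 1)).const_mul (ω 1))).add_const _).add_const
      _ |>.add_const _).congr_deriv ?_
    fin_cases i <;> simp [flowField]
  · refine neg_eq_iff_eq_neg.2 (fderiv_hamiltonian_eq ?_)
    simp only [hamiltonian, Prod.smul_mk, smul_zero, add_zero, smul_eq_mul, mul_zero,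
      mul_one]
    have hc := (h0.const_add q).cos
    refine (((hc.sub_const 1).const_add _).fun_add
      (((hc.const_sub 1).mul_const _).const_mul μ)).congr_deriv ?_
    simp [flowField]
    ring
  · funext i
    refine neg_eq_iff_eq_neg.2 (fderiv_hamiltonian_eq ?_)
    simp only [hamiltonian, Prod.smul_mk, smul_zero, add_zero, smul_eq_mul, mul_zero]
    refine ((((hasDerivAt_trigPoly_line Γ c φ i 0).const_mul _).const_mul μ).const_add
      _).congr_deriv ?_
    simp [flowField]

/-! ### Global existence of motions -/

theorem exists_bound_trigPoly (Γ : ℕ) (c : ℤ × ℤ → ℝ) :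
    ∃ C, 0 ≤ C ∧ (∀ φ, |trigPoly Γ c φ| ≤ C) ∧ ∀ i φ, |gradPoly Γ c i φ| ≤ C := by
  refine ⟨∑ k ∈ waveVectors Γ, |c k| * (1 + |comp k 0| + |comp k 1|), by positivity,
    fun φ => ?_, fun i φ => ?_⟩
  · refine (Finset.abs_sum_le_sum_abs _ _).trans (Finset.sum_le_sum fun k _ => ?_)
    rw [abs_mul]
    gcongr
    have := Real.abs_cos_le_one (k.1 * φ 0 + k.2 * φ 1)
    linarith [abs_nonneg (comp k 0), abs_nonneg (comp k 1)]
  · refine (Finset.abs_sum_le_sum_abs _ _).trans (Finset.sum_le_sum fun k _ => ?_)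
    rw [abs_mul, abs_neg, abs_mul]
    gcongr
    have h1 := Real.abs_sin_le_one (phase k φ)
    have h2 : |comp k i| * |Real.sin (phase k φ)| ≤ |comp k i| :=
      mul_le_of_le_one_right (abs_nonneg _) h1
    have h3 : |comp k i| ≤ |comp k 0| + |comp k 1| := by
      fin_cases i <;> simp
    linarith

theorem exists_norm_flowField_le (Γ : ℕ) (c : ℤ × ℤ → ℝ) (ω : Fin 2 → ℝ) (μ : ℝ) :
    ∃ C, 0 ≤ C ∧ ∀ z, ‖flowField Γ c ω μ z‖ ≤ ‖z‖ + C := by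
  obtain ⟨C, hC, h1, h2⟩ := exists_bound_trigPoly Γ c
  refine ⟨‖ω‖ + (1 + |μ| * C) + |μ| * (2 * C), by positivity, fun z => ?_⟩
  have hz := norm_nonneg z
  have hω := norm_nonneg ω
  have hμ : 0 ≤ |μ| * C := by positivity
  refine max_le ?_ (max_le ?_ (max_le ?_ ?_))
  · have : ‖z.2.2.1‖ ≤ ‖z‖ := (norm_fst_le _).trans ((norm_snd_le _).trans (norm_snd_le _))
    change ‖z.2.2.1‖ ≤ _
    linarith
  · change ‖ω‖ ≤ _
    linarith
  · change |Real.sin z.1 * (1 - μ * trigPoly Γ c z.2.1)| ≤ _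
    have : |1 - μ * trigPoly Γ c z.2.1| ≤ 1 + |μ| * C := by
      refine (abs_sub _ _).trans ?_
      rw [abs_one, abs_mul]
      gcongr
      exact h1 _
    have h3 := Real.abs_sin_le_one z.1
    rw [abs_mul]
    have : |Real.sin z.1| * |1 - μ * trigPoly Γ c z.2.1| ≤ 1 * (1 + |μ| * C) := by gcongr
    linarith
  · refine (pi_norm_le_iff_of_nonneg (by linarith)).2 fun i => ?_
    change |-(μ * ((1 - Real.cos z.1) * gradPoly Γ c i z.2.1))| ≤ _
    rw [abs_neg, abs_mul, abs_mul]
    have h3 : |1 - Real.cos z.1| ≤ 2 := by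
      rw [abs_le]; constructor <;> linarith [Real.neg_one_le_cos z.1, Real.cos_le_one z.1]
    have : |μ| * (|1 - Real.cos z.1| * |gradPoly Γ c i z.2.1|) ≤ |μ| * (2 * C) := by
      gcongr
      exact h2 _ _
    linarith

/-- Linear growth of the field makes the local existence time independent of the starting point, so
local solutions extend to all times. -/
theorem exists_isIntegralCurve_of_norm_le {E : Type*} [NormedAddCommGroup E] [NormedSpace ℝ E]
    [FiniteDimensional ℝ E] {v : E → E} (hv : ContDiff ℝ 1 v) {C : ℝ} (hC : 0 ≤ C)
    (hvC : ∀ x, ‖v x‖ ≤ ‖x‖ + C) (x : E) : ∃ γ : ℝ → E, γ 0 = x ∧ IsIntegralCurve γ fun _ => v := by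
  have : CompleteSpace E := FiniteDimensional.complete ℝ E
  have : ProperSpace E := FiniteDimensional.proper ℝ E
  have hloc : ∀ x : E, ∃ γ : ℝ → E, γ 0 = x ∧
      IsMIntegralCurveOn (I := modelWithCornersSelf ℝ E) γ v (Ioo (-(1 / 2)) (1 / 2)) := by
    intro x
    obtain ⟨K, hK⟩ := (isCompact_closedBall x (‖x‖ + C + 1)).exists_bound_of_continuousOn
      ((hv.continuous_fderiv (by norm_num)).norm.continuousOn)
    have hlip : LipschitzOnWith K.toNNReal v (Metric.closedBall x (‖x‖ + C + 1)) := by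
      refine (convex_closedBall _ _).lipschitzOnWith_of_nnnorm_fderiv_le
        (fun y _ => hv.differentiable (by norm_num) y) fun y hy => ?_
      have := hK y hy
      rw [norm_norm] at this
      exact NNReal.le_toNNReal_of_coe_le (by simpa using this)
    have hr : 0 ≤ ‖x‖ + C + 1 := by positivity
    -- On the ball of radius `R = ‖x‖ + C + 1` about `x` the field is bounded by `2R`, so a solution
    -- cannot leave it within time `1/2`.
    have hPL : IsPicardLindelof (fun _ => v) (tmin := -(1 / 2)) (tmax := 1 / 2)
        ⟨0, by norm_num, by norm_num⟩ x (‖x‖ + C + 1).toNNReal 0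
        (2 * (‖x‖ + C + 1)).toNNReal K.toNNReal := by
      refine IsPicardLindelof.of_time_independent (fun y hy => ?_) ?_ ?_
      · rw [Real.coe_toNNReal _ hr, mem_closedBall_iff_norm] at hy
        rw [Real.coe_toNNReal _ (by positivity)]
        have := hvC y
        have h3 : ‖y‖ ≤ ‖y - x‖ + ‖x‖ := by simpa using norm_add_le (y - x) x
        linarith
      · rwa [Real.coe_toNNReal _ hr]
      · rw [Real.coe_toNNReal _ hr, Real.coe_toNNReal _ (by positivity)]
        norm_num
        linarith
    obtain ⟨γ, hγ0, hγ⟩ := hPL.exists_eq_forall_mem_Icc_hasDerivWithinAt₀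
    refine ⟨γ, hγ0, fun t ht => ?_⟩
    have h1 := (hγ t (Ioo_subset_Icc_self ht)).mono Ioo_subset_Icc_self
    exact h1.hasFDerivWithinAt.hasMFDerivWithinAt
  obtain ⟨γ, hγ0, hγ⟩ := exists_isMIntegralCurve_of_isMIntegralCurveOn
    (I := modelWithCornersSelf ℝ E) (v := v)
    (contMDiff_vectorSpace_iff_contDiff.2 hv) (by norm_num : (0 : ℝ) < 1 / 2) hloc x
  refine ⟨γ, hγ0, fun t => ?_⟩
  have h1 : HasFDerivAt γ ((1 : ℝ →L[ℝ] ℝ).smulRight (v (γ t))) t := (hγ t).hasFDerivAt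
  simpa using h1.hasDerivAt

theorem exists_motion (Γ : ℕ) (c : ℤ × ℤ → ℝ) (ω : Fin 2 → ℝ) (μ : ℝ) (z : Phase) :
    ∃ γ : ℝ → Phase, γ 0 = z ∧ IsIntegralCurve γ fun _ => flowField Γ c ω μ := by
  obtain ⟨C, hC, h⟩ := exists_norm_flowField_le Γ c ω μ
  exact exists_isIntegralCurve_of_norm_le (contDiff_flowField Γ c ω μ) hC h z

/-! ### The perturbation along an orbit as a bounded continuous function of time -/

/-- `cos (a t)`. -/
def cosW (a : ℝ) : BC :=
  BoundedContinuousFunction.ofNormedAddCommGroup (fun t => Real.cos (a * t)) (by fun_prop) 1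
    fun t => Real.abs_cos_le_one _

/-- `sin (a t)`. -/
def sinW (a : ℝ) : BC :=
  BoundedContinuousFunction.ofNormedAddCommGroup (fun t => Real.sin (a * t)) (by fun_prop) 1
    fun t => Real.abs_sin_le_one _

/-- The function `t ↦ cos (k · (φ + t ω))`. -/
def cosOrbit (ω : Fin 2 → ℝ) (k : ℤ × ℤ) (φ : Fin 2 → ℝ) : BC :=
  Real.cos (phase k φ) • cosW (phase k ω) - Real.sin (phase k φ) • sinW (phase k ω)

/-- The function `t ↦ sin (k · (φ + t ω))`. -/
def sinOrbit (ω : Fin 2 → ℝ) (k : ℤ × ℤ) (φ : Fin 2 → ℝ) : BC :=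
  Real.sin (phase k φ) • cosW (phase k ω) + Real.cos (phase k φ) • sinW (phase k ω)

theorem cosOrbit_apply (ω : Fin 2 → ℝ) (k : ℤ × ℤ) (φ : Fin 2 → ℝ) (t : ℝ) :
    cosOrbit ω k φ t = Real.cos (phase k (φ + t • ω)) := by
  rw [phase_add_smul, Real.cos_add]
  rfl

theorem sinOrbit_apply (ω : Fin 2 → ℝ) (k : ℤ × ℤ) (φ : Fin 2 → ℝ) (t : ℝ) :
    sinOrbit ω k φ t = Real.sin (phase k (φ + t • ω)) := by
  rw [phase_add_smul, Real.sin_add]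
  rfl

/-- The addition theorem separates `φ` from `t`: `φ` enters only through two scalar coefficients of
fixed elements of `BC`, so the dependence is smooth in the sup norm over all times. -/
theorem contDiff_cosOrbit (ω : Fin 2 → ℝ) (k : ℤ × ℤ) {n : WithTop ℕ∞} :
    ContDiff ℝ n (cosOrbit ω k) := by
  unfold cosOrbit
  have := contDiff_phase k (n := n)
  fun_prop

theorem contDiff_sinOrbit (ω : Fin 2 → ℝ) (k : ℤ × ℤ) {n : WithTop ℕ∞} :
    ContDiff ℝ n (sinOrbit ω k) := by
  unfold sinOrbit
  have := contDiff_phase k (n := n)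
  fun_prop

theorem hasDerivAt_cosOrbit (ω : Fin 2 → ℝ) (k : ℤ × ℤ) (φ : Fin 2 → ℝ) (j : Fin 2) (s : ℝ) :
    HasDerivAt (fun s : ℝ => cosOrbit ω k (φ + s • Pi.single j 1))
      (-(comp k j • sinOrbit ω k (φ + s • Pi.single j 1))) s := by
  have h := hasDerivAt_phase k φ (Pi.single j 1) s
  refine ((h.cos.smul_const _).sub (h.sin.smul_const _)).congr_deriv ?_
  rw [phase_single, sinOrbit]
  module

theorem hasDerivAt_sinOrbit (ω : Fin 2 → ℝ) (k : ℤ × ℤ) (φ : Fin 2 → ℝ) (j : Fin 2) (s : ℝ) :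
    HasDerivAt (fun s : ℝ => sinOrbit ω k (φ + s • Pi.single j 1))
      (comp k j • cosOrbit ω k (φ + s • Pi.single j 1)) s := by
  have h := hasDerivAt_phase k φ (Pi.single j 1) s
  refine ((h.sin.smul_const _).add (h.cos.smul_const _)).congr_deriv ?_
  rw [phase_single, cosOrbit]
  module

/-- The function `t ↦ f (φ + t ω)`. -/
def polyOrbit (Γ : ℕ) (c : ℤ × ℤ → ℝ) (ω φ : Fin 2 → ℝ) : BC :=
  ∑ k ∈ waveVectors Γ, c k • cosOrbit ω k φ

/-- The function `t ↦ ∂ᵢ f (φ + t ω)`. -/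
def gradOrbit (Γ : ℕ) (c : ℤ × ℤ → ℝ) (ω : Fin 2 → ℝ) (i : Fin 2) (φ : Fin 2 → ℝ) : BC :=
  ∑ k ∈ waveVectors Γ, c k • -(comp k i • sinOrbit ω k φ)

/-- The function `t ↦ ∂ⱼ ∂ᵢ f (φ + t ω)`. -/
def hessOrbit (Γ : ℕ) (c : ℤ × ℤ → ℝ) (ω : Fin 2 → ℝ) (i j : Fin 2) (φ : Fin 2 → ℝ) : BC :=
  ∑ k ∈ waveVectors Γ, c k • -(comp k i • comp k j • cosOrbit ω k φ)

theorem BC.sum_apply {ι : Type*} (s : Finset ι) (f : ι → BC) (t : ℝ) :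
    (∑ i ∈ s, f i) t = ∑ i ∈ s, f i t := by
  rw [BoundedContinuousFunction.coe_sum, Finset.sum_apply]

theorem polyOrbit_apply (Γ : ℕ) (c : ℤ × ℤ → ℝ) (ω φ : Fin 2 → ℝ) (t : ℝ) :
    polyOrbit Γ c ω φ t = trigPoly Γ c (φ + t • ω) := by
  rw [polyOrbit, BC.sum_apply]
  refine Finset.sum_congr rfl fun k _ => ?_
  change c k * cosOrbit ω k φ t = _
  rw [cosOrbit_apply]
  rfl

theorem gradOrbit_apply (Γ : ℕ) (c : ℤ × ℤ → ℝ) (ω : Fin 2 → ℝ) (i : Fin 2) (φ : Fin 2 → ℝ)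
    (t : ℝ) : gradOrbit Γ c ω i φ t = gradPoly Γ c i (φ + t • ω) := by
  rw [gradOrbit, BC.sum_apply]
  refine Finset.sum_congr rfl fun k _ => ?_
  change c k * -(comp k i * sinOrbit ω k φ t) = _
  rw [sinOrbit_apply]

theorem contDiff_polyOrbit (Γ : ℕ) (c : ℤ × ℤ → ℝ) (ω : Fin 2 → ℝ) {n : WithTop ℕ∞} :
    ContDiff ℝ n (polyOrbit Γ c ω) := by
  unfold polyOrbit
  have := fun k => contDiff_cosOrbit ω k (n := n)
  fun_prop

theorem contDiff_gradOrbit (Γ : ℕ) (c : ℤ × ℤ → ℝ) (ω : Fin 2 → ℝ) (i : Fin 2) {n : WithTop ℕ∞} :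
    ContDiff ℝ n (gradOrbit Γ c ω i) := by
  unfold gradOrbit
  have := fun k => contDiff_sinOrbit ω k (n := n)
  fun_prop

theorem hasDerivAt_polyOrbit (Γ : ℕ) (c : ℤ × ℤ → ℝ) (ω φ : Fin 2 → ℝ) (j : Fin 2) (s : ℝ) :
    HasDerivAt (fun s : ℝ => polyOrbit Γ c ω (φ + s • Pi.single j 1))
      (gradOrbit Γ c ω j (φ + s • Pi.single j 1)) s :=
  HasDerivAt.fun_sum fun k _ => (hasDerivAt_cosOrbit ω k φ j s).const_smul (c k)

theorem hasDerivAt_gradOrbit (Γ : ℕ) (c : ℤ × ℤ → ℝ) (ω : Fin 2 → ℝ) (i : Fin 2) (φ : Fin 2 → ℝ)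
    (j : Fin 2) (s : ℝ) :
    HasDerivAt (fun s : ℝ => gradOrbit Γ c ω i (φ + s • Pi.single j 1))
      (hessOrbit Γ c ω i j (φ + s • Pi.single j 1)) s :=
  HasDerivAt.fun_sum fun k _ =>
    (((hasDerivAt_sinOrbit ω k φ j s).const_smul (comp k i)).neg).const_smul (c k)

theorem hessOrbit_symm (Γ : ℕ) (c : ℤ × ℤ → ℝ) (ω : Fin 2 → ℝ) (i j : Fin 2) (φ : Fin 2 → ℝ) :
    hessOrbit Γ c ω i j φ = hessOrbit Γ c ω j i φ := by
  refine Finset.sum_congr rfl fun k _ => ?_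
  rw [smul_comm (comp k i)]

theorem trigPoly_add_two_pi (Γ : ℕ) (c : ℤ × ℤ → ℝ) (φ : Fin 2 → ℝ) (n : Fin 2 → ℤ) :
    trigPoly Γ c (φ + fun i => 2 * Real.pi * n i) = trigPoly Γ c φ := by
  refine Finset.sum_congr rfl fun k _ => ?_
  congr 1
  rw [← Real.cos_add_int_mul_two_pi (k.1 * φ 0 + k.2 * φ 1) (k.1 * n 0 + k.2 * n 1)]
  congr 1
  push_cast
  simp only [Pi.add_apply]
  ring

theorem gradPoly_add_two_pi (Γ : ℕ) (c : ℤ × ℤ → ℝ) (i : Fin 2) (φ : Fin 2 → ℝ) (n : Fin 2 → ℤ) :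
    gradPoly Γ c i (φ + fun i => 2 * Real.pi * n i) = gradPoly Γ c i φ := by
  refine Finset.sum_congr rfl fun k _ => ?_
  congr 3
  rw [← Real.sin_add_int_mul_two_pi (phase k φ) (k.1 * n 0 + k.2 * n 1)]
  congr 1
  push_cast
  simp only [phase, Pi.add_apply]
  ring

theorem polyOrbit_add_two_pi (Γ : ℕ) (c : ℤ × ℤ → ℝ) (ω φ : Fin 2 → ℝ) (n : Fin 2 → ℤ) :
    polyOrbit Γ c ω (φ + fun i => 2 * Real.pi * n i) = polyOrbit Γ c ω φ := by
  ext t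
  rw [polyOrbit_apply, polyOrbit_apply, add_right_comm, trigPoly_add_two_pi]

theorem gradOrbit_add_two_pi (Γ : ℕ) (c : ℤ × ℤ → ℝ) (ω : Fin 2 → ℝ) (i : Fin 2) (φ : Fin 2 → ℝ)
    (n : Fin 2 → ℤ) :
    gradOrbit Γ c ω i (φ + fun i => 2 * Real.pi * n i) = gradOrbit Γ c ω i φ := by
  ext t
  rw [gradOrbit_apply, gradOrbit_apply, add_right_comm, gradPoly_add_two_pi]

/-- Evenness of `f` is the source of the reversibility of the flow. -/
theorem trigPoly_neg (Γ : ℕ) (c : ℤ × ℤ → ℝ) (φ : Fin 2 → ℝ) :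
    trigPoly Γ c (-φ) = trigPoly Γ c φ := by
  refine Finset.sum_congr rfl fun k _ => ?_
  rw [← Real.cos_neg]
  congr 2
  simp only [Pi.neg_apply]
  ring

theorem gradPoly_neg (Γ : ℕ) (c : ℤ × ℤ → ℝ) (i : Fin 2) (φ : Fin 2 → ℝ) :
    gradPoly Γ c i (-φ) = -gradPoly Γ c i φ := by
  rw [gradPoly, gradPoly, ← Finset.sum_neg_distrib]
  refine Finset.sum_congr rfl fun k _ => ?_
  have : phase k (-φ) = -phase k φ := by simp [phase]; ring
  rw [this, Real.sin_neg]
  ring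

theorem exists_norm_polyOrbit_le (Γ : ℕ) (c : ℤ × ℤ → ℝ) (ω : Fin 2 → ℝ) :
    ∃ C, 0 ≤ C ∧ ∀ φ, ‖polyOrbit Γ c ω φ‖ ≤ C := by
  obtain ⟨C, hC, h, -⟩ := exists_bound_trigPoly Γ c
  refine ⟨C, hC, fun φ => (BoundedContinuousFunction.norm_le hC).2 fun t => ?_⟩
  rw [polyOrbit_apply]
  exact h _

/-! ### Motions from solutions of the integral equations -/

theorem slope_apply (d : BC) (t : ℝ) : slope d t = tanhW t - expW t * d t := rfl

theorem density_apply (d : BC) (t : ℝ) :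
    density d t = sechW t + 2 * (tanhW t * d t) - expW t * (d t * d t) := rfl

theorem sourceD_apply (d u : BC) (t : ℝ) :
    sourceD d u t = expW t * (d t * d t) - density d t * u t := rfl

theorem sourceU_apply (G d u : BC) (t : ℝ) :
    sourceU G d u t = slope d t * (u t * u t + G t) - 2 * (expW t * d t * u t) := rfl

theorem expW_mul_sechW {t : ℝ} (ht : 0 ≤ t) : expW t * sechW t = 1 - Real.tanh t ^ 2 := by
  have hp := (Real.cosh_pos t).ne'
  rw [expW_apply ht, sechW_apply ht, one_sub_tanh_sq, Real.exp_neg]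
  field_simp

theorem one_sub_slope_sq (d : BC) {t : ℝ} (ht : 0 ≤ t) :
    1 - slope d t ^ 2 = expW t * density d t := by
  have h := expW_mul_sechW ht
  rw [slope_apply, density_apply, tanhW_apply ht]
  linear_combination -h

theorem hasDerivAt_expW {t : ℝ} (ht : 0 < t) : HasDerivAt expW (-expW t) t := by
  have h2 : (expW : ℝ → ℝ) =ᶠ[𝓝 t] fun t => Real.exp (-t) := by
    filter_upwards [lt_mem_nhds ht] with s hs using expW_apply hs.le
  refine ((hasDerivAt_neg t).exp.congr_of_eventuallyEq h2).congr_deriv ?_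
  rw [expW_apply ht.le]; ring

theorem hasDerivAt_tanhW {t : ℝ} (ht : 0 < t) : HasDerivAt tanhW (1 - Real.tanh t ^ 2) t := by
  have h2 : (tanhW : ℝ → ℝ) =ᶠ[𝓝 t] Real.tanh := by
    filter_upwards [lt_mem_nhds ht] with s hs using tanhW_apply hs.le
  exact (hasDerivAt_tanh t).congr_of_eventuallyEq h2

theorem hasDerivAt_sechW {t : ℝ} (ht : 0 < t) :
    HasDerivAt sechW ((1 - 2 * Real.tanh t) * sechW t) t := by
  have h2 : (sechW : ℝ → ℝ) =ᶠ[𝓝 t] fun t => Real.exp t / Real.cosh t ^ 2 := by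
    filter_upwards [lt_mem_nhds ht] with s hs using sechW_apply hs.le
  refine ((hasDerivAt_exp_div_cosh_sq t).congr_of_eventuallyEq h2).congr_deriv ?_
  rw [sechW_apply ht.le]; ring

theorem defect_eq_zero_iff {a : ℝ} {G d u : BC} :
    defect ((a, G), (d, u)) = 0 ↔
      d = a • sechW + forwardOp (sourceD d u) ∧ u = -backwardOp (sourceU G d u) := by
  rw [defect, Prod.mk_eq_zero, sub_sub, sub_eq_zero, add_eq_zero_iff_eq_neg]

/-- This undoes the substitution `T = tanh t - e^{-t} d`, `w = 1 + u`; the equation for `d` was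
obtained from this one. -/
theorem hasDerivAt_slope_of_defect {a : ℝ} {G d u : BC} (hz : defect ((a, G), (d, u)) = 0) {t : ℝ}
    (ht : 0 < t) : HasDerivAt (slope d) ((1 - slope d t ^ 2) * (1 + u t)) t := by
  have h1 := (defect_eq_zero_iff.1 hz).1
  have hd : HasDerivAt d ((1 - 2 * Real.tanh t) * d t + sourceD d u t) t := by
    have h2 : HasDerivAt (a • sechW + forwardOp (sourceD d u) : BC) _ t :=
      ((hasDerivAt_sechW ht).const_mul a).add (hasDerivAt_forwardOp (sourceD d u) ht)
    rw [← h1] at h2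
    refine h2.congr_deriv ?_
    have h3 : d t = a * sechW t + forwardOp (sourceD d u) t := by
      conv_lhs => rw [h1]
      rfl
    rw [h3]; ring
  have h4 : HasDerivAt (slope d) _ t := (hasDerivAt_tanhW ht).sub ((hasDerivAt_expW ht).mul hd)
  refine h4.congr_deriv ?_
  rw [one_sub_slope_sq d ht.le, sourceD_apply, density_apply, ← expW_mul_sechW ht.le,
    tanhW_apply ht.le]
  ring

theorem hasDerivAt_of_defect {a : ℝ} {G d u : BC} (hz : defect ((a, G), (d, u)) = 0) {t : ℝ}
    (ht : 0 < t) : HasDerivAt u (slope d t * ((1 + u t) ^ 2 - 1 + G t)) t := by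
  have h1 := (defect_eq_zero_iff.1 hz).2
  have h2 : HasDerivAt (-backwardOp (sourceU G d u) : BC) _ t :=
    (hasDerivAt_backwardOp (sourceU G d u) ht).neg
  rw [← h1] at h2
  refine h2.congr_deriv ?_
  have h3 : u t = -backwardOp (sourceU G d u) t := by
    conv_lhs => rw [h1]
    rfl
  have h4 : backwardOp (sourceU G d u) t = -u t := by rw [h3]; ring
  rw [h4, sourceU_apply, slope_apply, tanhW_apply ht.le]
  ring

theorem slope_zero_of_defect {a : ℝ} {G d u : BC} (hz : defect ((a, G), (d, u)) = 0) :
    slope d 0 = -a := by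
  have h1 := (defect_eq_zero_iff.1 hz).1
  have h3 : d 0 = a * sechW 0 + forwardOp (sourceD d u) 0 := by
    conv_lhs => rw [h1]
    rfl
  rw [slope_apply, h3, forwardOp_apply _ le_rfl, tanhW_apply le_rfl, expW_apply le_rfl,
    sechW_apply le_rfl]
  simp

theorem tendsto_tanh_atTop : Tendsto Real.tanh atTop (𝓝 1) := by
  have h : ∀ t : ℝ, Real.tanh t = 1 - 2 * (Real.exp (2 * t) + 1)⁻¹ := fun t => by
    have h2 : Real.exp (2 * t) = Real.exp t * Real.exp t := by rw [← Real.exp_add]; ring_nf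
    rw [Real.tanh_eq_sinh_div_cosh, Real.sinh_eq, Real.cosh_eq, h2, Real.exp_neg]
    have := Real.exp_pos t
    field_simp
    ring
  have h3 : Tendsto (fun t : ℝ => Real.exp (2 * t) + 1) atTop atTop :=
    tendsto_atTop_add_const_right _ _
      (Real.tendsto_exp_atTop.comp (tendsto_id.const_mul_atTop (by norm_num)))
  rw [funext h]
  simpa using (h3.inv_tendsto_atTop.const_mul 2).const_sub 1

theorem tendsto_expW_mul (h : BC) : Tendsto (fun t => expW t * h t) atTop (𝓝 0) := by
  have h1 : Tendsto (fun t : ℝ => Real.exp (-t) * ‖h‖) atTop (𝓝 0) := by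
    simpa using Real.tendsto_exp_neg_atTop_nhds_zero.mul_const ‖h‖
  refine squeeze_zero_norm' ?_ h1
  filter_upwards [eventually_ge_atTop 0] with t ht
  rw [expW_apply ht, Real.norm_eq_abs, abs_mul, Real.abs_exp]
  gcongr
  exact h.abs_apply_le t

theorem tendsto_slope (d : BC) : Tendsto (slope d) atTop (𝓝 1) := by
  have h1 : Tendsto tanhW atTop (𝓝 1) := by
    refine tendsto_tanh_atTop.congr' ?_
    filter_upwards [eventually_ge_atTop 0] with t ht using (tanhW_apply ht).symm
  have h2 := h1.sub (tendsto_expW_mul d)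
  rwa [sub_zero] at h2

/-- Since `(1 - T²)' = -2 T w (1 - T²)`, the product of `1 - T²` with the integrating factor `exp ∫
2 T w` is constant, and it is positive at time `0`. -/
theorem slope_sq_lt_one {a : ℝ} {G d u : BC} (hz : defect ((a, G), (d, u)) = 0) (ha : |a| < 1)
    {t : ℝ} (ht : 0 ≤ t) : 0 < 1 - slope d t ^ 2 := by
  set g : ℝ → ℝ := fun t => (1 - slope d t ^ 2) *
    Real.exp (∫ r in (0 : ℝ)..t, 2 * (slope d r * (1 + u r))) with hg
  have hcont : Continuous fun r => 2 * (slope d r * (1 + u r)) := by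
    have := (slope d).continuous
    have := u.continuous
    fun_prop
  have hgc : Continuous g := by
    have := (slope d).continuous
    have := intervalIntegral.continuous_primitive (μ := volume)
      (fun a b => hcont.intervalIntegrable a b) 0
    fun_prop
  have hg0 : g 0 = 1 - a ^ 2 := by
    simp [hg, slope_zero_of_defect hz]
  have hpos : 0 < g t := by
    rcases ht.eq_or_lt with rfl | ht
    · rw [hg0]
      have := (sq_lt_one_iff_abs_lt_one a).2 ha
      linarith
    · obtain ⟨s, hs, h⟩ := exists_hasDerivAt_eq_slope g (fun _ => 0) ht hgc.continuousOn
        fun s hs => by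
          have h1 := hasDerivAt_slope_of_defect hz hs.1
          have h2 := (hcont.integral_hasStrictDerivAt 0 s).hasDerivAt.exp
          refine (((h1.fun_pow 2).const_sub 1).mul h2).congr_deriv ?_
          simp only [Nat.cast_ofNat, Nat.add_one_sub_one, pow_one]
          ring
      have h3 : g t - g 0 = 0 := by
        rw [eq_div_iff (by linarith)] at h
        linarith
      have := (sq_lt_one_iff_abs_lt_one a).2 ha
      linarith
  exact (pos_iff_pos_of_mul_pos hpos).2 (Real.exp_pos _)

/-- A curve that solves a differential equation for `t > 0` can be continued by a motion that is
given for `t ≤ 0`. -/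
theorem exists_isIntegralCurve_eqOn {E : Type*} [NormedAddCommGroup E] [NormedSpace ℝ E] {v : E → E}
    (hv : Continuous v) {γ η : ℝ → E} (hγ : Continuous γ)
    (hγ' : ∀ t, 0 < t → HasDerivAt γ (v (γ t)) t) (hη : IsIntegralCurve η fun _ => v)
    (h0 : η 0 = γ 0) : ∃ ζ : ℝ → E, IsIntegralCurve ζ (fun _ => v) ∧ ∀ t, 0 ≤ t → ζ t = γ t := by
  classical
  refine ⟨fun t => if t < 0 then η t else γ t, fun t => ?_, fun t ht => if_neg ht.not_gt⟩
  rcases lt_trichotomy t 0 with ht | rfl | ht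
  · have h1 : (fun t => if t < 0 then η t else γ t) =ᶠ[𝓝 t] η := by
      filter_upwards [gt_mem_nhds ht] with s hs using if_pos hs
    simp only [if_pos ht]
    exact (hη t).congr_of_eventuallyEq h1
  · simp only [lt_irrefl, if_false]
    have hl : HasDerivWithinAt (fun t => if t < 0 then η t else γ t) (v (γ 0)) (Iic 0) 0 := by
      have := (hη 0).hasDerivWithinAt (s := Iic 0)
      rw [h0] at this
      refine this.congr (fun s hs => ?_) (by simp [h0])
      rcases (mem_Iic.1 hs).eq_or_lt with rfl | hs
      · simp [h0]
      · exact if_pos hs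
    -- The right derivative at `0` is the limit of the derivatives at positive times, which exists
    -- by continuity of the field along the curve.
    have hr : HasDerivWithinAt (fun t => if t < 0 then η t else γ t) (v (γ 0)) (Ici 0) 0 := by
      have h2 : HasDerivWithinAt γ (v (γ 0)) (Ici 0) 0 := by
        refine hasDerivWithinAt_Ici_of_tendsto_deriv (s := Ioi 0)
          (fun s hs => (hγ' s hs).differentiableAt.differentiableWithinAt)
          hγ.continuousAt.continuousWithinAt self_mem_nhdsWithin ?_
        have h3 : Tendsto (fun s => v (γ s)) (𝓝[>] 0) (𝓝 (v (γ 0))) :=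
          ((hv.comp hγ).tendsto 0).mono_left nhdsWithin_le_nhds
        refine h3.congr' ?_
        filter_upwards [self_mem_nhdsWithin] with s hs using (hγ' s hs).deriv.symm
      exact h2.congr (fun s hs => if_neg (mem_Ici.1 hs).not_gt) (by simp)
    have := hl.union hr
    rwa [Iic_union_Ici, hasDerivWithinAt_univ] at this
  · have h1 : (fun t => if t < 0 then η t else γ t) =ᶠ[𝓝 t] γ := by
      filter_upwards [lt_mem_nhds ht] with s hs using if_neg hs.not_gt
    simp only [if_neg ht.not_gt]
    exact (hγ' t ht).congr_of_eventuallyEq h1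

/-- The momenta of the point of the whisker with given angles, in terms of the solution `(d, u)` of
the integral equations. -/
def whiskerAction (Γ : ℕ) (c : ℤ × ℤ → ℝ) (ω φ : Fin 2 → ℝ) (d : BC) (i : Fin 2) : ℝ :=
  expIntegral ((2 : ℝ) • (density d * gradOrbit Γ c ω i φ))

theorem integrand_whiskerAction (Γ : ℕ) (c : ℤ × ℤ → ℝ) (ω φ : Fin 2 → ℝ) (d : BC) (i : Fin 2)
    {r : ℝ} (hr : 0 ≤ r) :
    Real.exp (-1 * r) * ((2 : ℝ) • (density d * gradOrbit Γ c ω i φ)) r =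
      2 * (1 - slope d r ^ 2) * gradPoly Γ c i (φ + r • ω) := by
  rw [one_sub_slope_sq d hr, expW_apply hr, ← gradOrbit_apply, neg_one_mul]
  change _ * (2 * (density d r * gradOrbit Γ c ω i φ r)) = _
  ring

theorem whiskerAction_eq (Γ : ℕ) (c : ℤ × ℤ → ℝ) (ω φ : Fin 2 → ℝ) (d : BC) (i : Fin 2) :
    whiskerAction Γ c ω φ d i =
      ∫ r in Ioi (0 : ℝ), 2 * (1 - slope d r ^ 2) * gradPoly Γ c i (φ + r • ω) := by
  rw [whiskerAction, expIntegral_apply]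
  exact setIntegral_congr_fun measurableSet_Ioi fun r hr =>
    integrand_whiskerAction Γ c ω φ d i (mem_Ioi.1 hr).le

theorem integrableOn_whiskerAction (Γ : ℕ) (c : ℤ × ℤ → ℝ) (ω φ : Fin 2 → ℝ) (d : BC)
    (i : Fin 2) :
    IntegrableOn (fun r => 2 * (1 - slope d r ^ 2) * gradPoly Γ c i (φ + r • ω)) (Ioi 0) :=
  (integrableOn_exp_mul ((2 : ℝ) • (density d * gradOrbit Γ c ω i φ)) 0
    (by norm_num : (-1 : ℝ) < 0)).congr_fun
    (fun r hr => integrand_whiskerAction Γ c ω φ d i (mem_Ioi.1 hr).le) measurableSet_Ioi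

/-- The motion belonging to a solution of the integral equations. -/
def whiskerMotion (Γ : ℕ) (c : ℤ × ℤ → ℝ) (ω : Fin 2 → ℝ) (μ : ℝ) (B φ : Fin 2 → ℝ) (d u : BC)
    (t : ℝ) : Phase :=
  (2 * Real.arccos (-slope d t), φ + t • ω, 2 * Real.sqrt (1 - slope d t ^ 2) * (1 + u t),
    fun i => B i + μ * (whiskerAction Γ c ω φ d i -
      ∫ r in (0 : ℝ)..t, 2 * (1 - slope d r ^ 2) * gradPoly Γ c i (φ + r • ω)))

/-! ### The curve built from `(d, u)` is a motion in the stable whisker. -/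

section Motion

variable (Γ : ℕ) (c : ℤ × ℤ → ℝ) (ω : Fin 2 → ℝ) (μ : ℝ) (B φ : Fin 2 → ℝ) (d u : BC)

theorem continuous_whiskerAction_integrand (i : Fin 2) :
    Continuous fun r : ℝ => 2 * (1 - slope d r ^ 2) * gradPoly Γ c i (φ + r • ω) := by
  have := (slope d).continuous
  have := (contDiff_gradPoly Γ c i (n := 0)).continuous
  fun_prop

theorem continuous_whiskerMotion : Continuous (whiskerMotion Γ c ω μ B φ d u) := by
  have := (slope d).continuous
  have := u.continuous
  have := Real.continuous_arccos
  have := fun i => intervalIntegral.continuous_primitive (μ := volume)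
    (fun a b => (continuous_whiskerAction_integrand Γ c ω φ d i).intervalIntegrable a b) 0
  unfold whiskerMotion
  fun_prop

variable {Γ c ω μ B φ d u}

/-- With `cos (q/2) = -T` and `sin (q/2) = √(1 - T²)`, double-angle formulas give `sin q = -2 T √(1
- T²)` and `1 - cos q = 2 (1 - T²)`, which turns the reduced equations back into Hamilton's. -/
theorem hasDerivAt_whiskerMotion {a : ℝ} (ha : |a| < 1)
    (hz : defect ((a, μ • polyOrbit Γ c ω φ), (d, u)) = 0) {t : ℝ} (ht : 0 < t) :
    HasDerivAt (whiskerMotion Γ c ω μ B φ d u)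
      (flowField Γ c ω μ (whiskerMotion Γ c ω μ B φ d u t)) t := by
  have hpos := slope_sq_lt_one hz ha ht.le
  have hT := hasDerivAt_slope_of_defect hz ht
  have hu := hasDerivAt_of_defect hz ht
  have hlt : |slope d t| < 1 := (sq_lt_one_iff_abs_lt_one _).1 (by linarith)
  have hlt' := abs_lt.1 hlt
  have hs := Real.sqrt_pos.2 hpos
  have hss := Real.sq_sqrt hpos.le
  have hne := hs.ne'
  have hcos : Real.cos (Real.arccos (-slope d t)) = -slope d t :=
    Real.cos_arccos (by linarith) (by linarith)
  have hsin : Real.sin (Real.arccos (-slope d t)) = Real.sqrt (1 - slope d t ^ 2) := by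
    rw [Real.sin_arccos, neg_sq]
  refine HasDerivAt.prodMk ?_ (HasDerivAt.prodMk ?_ (HasDerivAt.prodMk ?_ ?_))
  · have h1 := (Real.hasDerivAt_arccos (x := -slope d t) (by linarith) (by linarith)).comp t hT.neg
    refine (h1.const_mul 2).congr_deriv ?_
    change _ = 2 * Real.sqrt (1 - slope d t ^ 2) * (1 + u t)
    rw [neg_sq]
    field_simp
    rw [hss]
  · refine (((hasDerivAt_id t).smul_const ω).const_add φ).congr_deriv ?_
    rw [one_smul]
  · have h1 := (((hT.fun_pow 2).const_sub 1).sqrt hpos.ne').const_mul 2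
    refine (h1.mul (hu.const_add 1)).congr_deriv ?_
    change _ = Real.sin (2 * Real.arccos (-slope d t)) * (1 - μ * trigPoly Γ c (φ + t • ω))
    rw [Real.sin_two_mul, hcos, hsin, ← polyOrbit_apply]
    change _ + _ * (_ * (_ + μ * polyOrbit Γ c ω φ t)) = _
    generalize polyOrbit Γ c ω φ t = g at *
    generalize Real.sqrt (1 - slope d t ^ 2) = s at *
    rw [← hss]
    field_simp
    simp only [Nat.cast_ofNat, Nat.add_one_sub_one, pow_one]
    ring
  · refine hasDerivAt_pi.2 fun i => ?_
    have h1 := ((continuous_whiskerAction_integrand Γ c ω φ d i).integral_hasStrictDerivAt 0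
      t).hasDerivAt
    refine (((h1.const_sub (whiskerAction Γ c ω φ d i)).const_mul μ).const_add (B i)).congr_deriv ?_
    change _ = -(μ * ((1 - Real.cos (2 * Real.arccos (-slope d t))) *
      gradPoly Γ c i (φ + t • ω)))
    rw [Real.cos_two_mul, hcos]
    ring

theorem whiskerMotion_zero {q : ℝ} (hq : 0 < q) (hq' : q < 2 * Real.pi)
    (hz : defect ((Real.cos (q / 2), μ • polyOrbit Γ c ω φ), (d, u)) = 0) :
    whiskerMotion Γ c ω μ B φ d u 0 =
      (q, φ, 2 * Real.sin (q / 2) * (1 + u 0), B + μ • whiskerAction Γ c ω φ d) := by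
  have hsl := slope_zero_of_defect hz
  refine Prod.ext ?_ (Prod.ext ?_ (Prod.ext ?_ ?_))
  · change 2 * Real.arccos (-slope d 0) = q
    rw [hsl, neg_neg, Real.arccos_cos (by linarith) (by linarith)]
    ring
  · change φ + (0 : ℝ) • ω = φ
    simp
  · change 2 * Real.sqrt (1 - slope d 0 ^ 2) * (1 + u 0) = 2 * Real.sin (q / 2) * (1 + u 0)
    rw [hsl, neg_sq, ← Real.sin_sq, Real.sqrt_sq]
    exact (Real.sin_pos_of_pos_of_lt_pi (by linarith) (by linarith)).le
  · funext i
    change B i + μ * (whiskerAction Γ c ω φ d i - ∫ r in (0 : ℝ)..0, _) = _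
    rw [intervalIntegral.integral_same, sub_zero]
    rfl

theorem tendsto_infDist_whiskerMotion :
    Tendsto (fun t => Metric.infDist (whiskerMotion Γ c ω μ B φ d u t) (torus B)) atTop (𝓝 0) := by
  have hT := tendsto_slope d
  have hq : Tendsto (fun t => 2 * Real.arccos (-slope d t)) atTop (𝓝 (2 * Real.pi)) := by
    have h1 := (Real.continuous_arccos.tendsto (-1)).comp hT.neg
    rw [Real.arccos_neg_one] at h1
    exact h1.const_mul 2
  have hp : Tendsto (fun t => 2 * Real.sqrt (1 - slope d t ^ 2) * (1 + u t)) atTop (𝓝 0) := by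
    have h1 : Tendsto (fun t => 2 * Real.sqrt (1 - slope d t ^ 2)) atTop (𝓝 0) := by
      have h2 := (Real.continuous_sqrt.tendsto _).comp ((hT.pow 2).const_sub 1)
      simpa using h2.const_mul 2
    have h3 : Tendsto (fun t => 2 * Real.sqrt (1 - slope d t ^ 2) * (1 + ‖u‖)) atTop (𝓝 0) := by
      simpa using h1.mul_const (1 + ‖u‖)
    refine squeeze_zero_norm (fun t => ?_) h3
    rw [Real.norm_eq_abs, abs_mul, abs_of_nonneg (by positivity)]
    gcongr
    refine (abs_add_le _ _).trans ?_
    rw [abs_one]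
    gcongr
    exact u.abs_apply_le t
  have hA : ∀ i, Tendsto (fun t => B i + μ * (whiskerAction Γ c ω φ d i -
      ∫ r in (0 : ℝ)..t, 2 * (1 - slope d r ^ 2) * gradPoly Γ c i (φ + r • ω))) atTop
      (𝓝 (B i)) := fun i => by
    have h1 := intervalIntegral_tendsto_integral_Ioi 0
      (integrableOn_whiskerAction Γ c ω φ d i) tendsto_id
    rw [← whiskerAction_eq] at h1
    simpa using ((h1.const_sub (whiskerAction Γ c ω φ d i)).const_mul μ).const_add (B i)
  have h1 : Tendsto (fun t => dist (2 * Real.arccos (-slope d t)) (2 * Real.pi)) atTop (𝓝 0) :=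
    tendsto_iff_dist_tendsto_zero.1 hq
  have h2 : Tendsto (fun t => dist (2 * Real.sqrt (1 - slope d t ^ 2) * (1 + u t)) 0) atTop
      (𝓝 0) := tendsto_iff_dist_tendsto_zero.1 hp
  have h3 := tendsto_iff_dist_tendsto_zero.1 (tendsto_pi_nhds.2 hA)
  have h4 := h1.max ((tendsto_const_nhds (x := (0 : ℝ))).max (h2.max h3))
  simp only [max_self] at h4
  refine squeeze_zero (fun t => Metric.infDist_nonneg) (fun t => ?_) h4
  -- The motion ends on the copy of the torus at `q = 2π`, hence `n = 1`. The comparison point moves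
  -- with the rotation, so the angle `φ` contributes no distance.
  have hmem : ((2 * Real.pi, φ + t • ω, 0, B) : Phase) ∈ torus B := ⟨1, φ + t • ω, by simp⟩
  refine (Metric.infDist_le_dist_of_mem hmem).trans (le_of_eq ?_)
  rw [Prod.dist_eq, Prod.dist_eq, Prod.dist_eq]
  simp [whiskerMotion]

theorem mem_stableWhisker_of_defect {q : ℝ} (hq : 0 < q) (hq' : q < 2 * Real.pi) (hu : ‖u‖ < 1)
    (hz : defect ((Real.cos (q / 2), μ • polyOrbit Γ c ω φ), (d, u)) = 0) :
    ((q, φ, 2 * Real.sin (q / 2) * (1 + u 0), B + μ • whiskerAction Γ c ω φ d) : Phase) ∈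
      stableWhisker (hamiltonian (trigPoly Γ c) ω μ) B := by
  have ha : |Real.cos (q / 2)| < 1 := by
    rw [← sq_lt_one_iff_abs_lt_one]
    have h1 := Real.sin_pos_of_pos_of_lt_pi (x := q / 2) (by linarith) (by linarith)
    have h2 := Real.sin_sq_add_cos_sq (q / 2)
    nlinarith
  -- The integral equations describe only `t ≥ 0`, while membership asks for a motion on all of `ℝ`;
  -- the past is supplied by global existence.
  obtain ⟨η, hη0, hη⟩ := exists_motion Γ c ω μ (whiskerMotion Γ c ω μ B φ d u 0)
  obtain ⟨ζ, hζ, hζ'⟩ := exists_isIntegralCurve_eqOn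
    (contDiff_flowField Γ c ω μ (n := 0)).continuous (continuous_whiskerMotion Γ c ω μ B φ d u)
    (fun t ht => hasDerivAt_whiskerMotion ha hz ht) hη hη0
  refine ⟨ζ, ?_, ?_, ?_, fun t ht => ?_⟩
  · rwa [hamiltonianField_eq]
  · rw [hζ' 0 le_rfl, whiskerMotion_zero hq hq' hz]
  · refine (tendsto_infDist_whiskerMotion (Γ := Γ) (c := c) (ω := ω) (μ := μ) (B := B) (φ := φ)
      (d := d) (u := u)).congr' ?_
    filter_upwards [eventually_ge_atTop 0] with t ht
    rw [hζ' t ht]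
  · rw [hζ' t ht]
    have hpos := slope_sq_lt_one hz ha ht
    have hlt : |slope d t| < 1 := (sq_lt_one_iff_abs_lt_one _).1 (by linarith)
    have hlt' := abs_lt.1 hlt
    refine ⟨?_, ?_, ?_⟩
    · change 0 < 2 * Real.arccos (-slope d t)
      have := Real.arccos_pos.2 (by linarith : -slope d t < 1)
      linarith
    · change 2 * Real.arccos (-slope d t) < 2 * Real.pi
      have h1 := (Real.arccos_le_pi (-slope d t)).lt_of_ne fun h =>
        absurd (Real.arccos_eq_pi.1 h) (by linarith)
      linarith
    · change 0 < 2 * Real.sqrt (1 - slope d t ^ 2) * (1 + u t)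
      have h1 := (abs_le.1 (u.abs_apply_le t)).1
      have h2 := Real.sqrt_pos.2 hpos
      have h3 : 0 < 1 + u t := by linarith
      positivity

end Motion

/-! ### Solutions of the integral equations from motions -/

/-- `T = -cos (q / 2)` and `w = p / (2 sin (q / 2))` along a motion that is asymptotic to a torus. -/
structure IsReducedMotion (G : BC) (T w : ℝ → ℝ) : Prop where
  hasDerivAt_fst : ∀ t, 0 ≤ t → HasDerivAt T ((1 - T t ^ 2) * w t) t
  hasDerivAt_snd : ∀ t, 0 ≤ t → HasDerivAt w (T t * (w t ^ 2 - 1 + G t)) t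
  pos : ∀ t, 0 ≤ t → 0 < w t
  sq_lt : ∀ t, 0 ≤ t → 0 < 1 - T t ^ 2
  tendsto : Tendsto (fun t => 1 - T t ^ 2) atTop (𝓝 0)
  tendsto_mul : Tendsto (fun t => (1 - T t ^ 2) * w t ^ 2) atTop (𝓝 0)
  le_zero : -(1 / 2) ≤ T 0

theorem monotoneOn_Ici_of_hasDerivAt {f f' : ℝ → ℝ} (h : ∀ t, 0 ≤ t → HasDerivAt f (f' t) t)
    (h' : ∀ t, 0 ≤ t → 0 ≤ f' t) : MonotoneOn f (Ici 0) := by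
  refine monotoneOn_of_deriv_nonneg (convex_Ici 0)
    (fun t ht => (h t ht).continuousAt.continuousWithinAt)
    (fun t ht => (h t (interior_subset ht)).differentiableAt.differentiableWithinAt) fun t ht => ?_
  rw [(h t (interior_subset ht)).deriv]
  exact h' t (interior_subset ht)

theorem antitoneOn_Ici_of_hasDerivAt {f f' : ℝ → ℝ} (h : ∀ t, 0 ≤ t → HasDerivAt f (f' t) t)
    (h' : ∀ t, 0 ≤ t → f' t ≤ 0) : AntitoneOn f (Ici 0) := by
  have := monotoneOn_Ici_of_hasDerivAt (fun t ht => (h t ht).neg)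
    fun t ht => neg_nonneg.2 (h' t ht)
  simpa using this.neg

theorem MonotoneOn.le_of_tendsto_Ici {f : ℝ → ℝ} (h : MonotoneOn f (Ici 0)) {L : ℝ}
    (hL : Tendsto f atTop (𝓝 L)) {t : ℝ} (ht : 0 ≤ t) : f t ≤ L := by
  refine ge_of_tendsto hL ?_
  filter_upwards [eventually_ge_atTop t] with s hs using h ht (mem_Ici.2 (ht.trans hs)) hs

namespace IsReducedMotion

variable {G : BC} {T w : ℝ → ℝ} (h : IsReducedMotion G T w)
include h

theorem le_fst {t : ℝ} (ht : 0 ≤ t) : -(1 / 2) ≤ T t :=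
  h.le_zero.trans (monotoneOn_Ici_of_hasDerivAt h.hasDerivAt_fst
    (fun t ht => (mul_pos (h.sq_lt t ht) (h.pos t ht)).le) (mem_Ici.2 le_rfl) ht ht)

theorem fst_lt {t : ℝ} (ht : 0 ≤ t) : T t < 1 :=
  (abs_lt.1 ((sq_lt_one_iff_abs_lt_one _).1 (by linarith [h.sq_lt t ht]))).2

theorem tendsto_fst : Tendsto T atTop (𝓝 1) := by
  have h1 : Tendsto (fun t => 1 - T t) atTop (𝓝 0) := by
    have h2 : Tendsto (fun t => 2 * (1 - T t ^ 2)) atTop (𝓝 0) := by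
      simpa using h.tendsto.const_mul 2
    refine squeeze_zero' ?_ ?_ h2
    · filter_upwards [eventually_ge_atTop 0] with t ht using by linarith [h.fst_lt ht]
    · filter_upwards [eventually_ge_atTop 0] with t ht
      nlinarith [h.fst_lt ht, h.le_fst ht]
  simpa using h1.const_sub 1

/-- Up to a factor, `Y = (1 - T²)(w² - 1)` is the pendulum energy. Since `Y' = 2 T G T'` with `T`
increasing to `1` and `Y → 0`, one gets `|Y| ≤ 2‖G‖ (1 - T)`. Cancelling `1 - T` leaves the factor
`1 + T ≥ 1/2`. -/
theorem abs_sq_sub_one_le {t : ℝ} (ht : 0 ≤ t) : |w t ^ 2 - 1| ≤ 4 * ‖G‖ := by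
  set Y : ℝ → ℝ := fun t => (1 - T t ^ 2) * (w t ^ 2 - 1) with hY
  have hYd : ∀ t, 0 ≤ t → HasDerivAt Y (2 * T t * G t * ((1 - T t ^ 2) * w t)) t := fun t ht => by
    refine ((((h.hasDerivAt_fst t ht).fun_pow 2).const_sub 1).mul
      (((h.hasDerivAt_snd t ht).fun_pow 2).sub_const 1)).congr_deriv ?_
    simp only [Nat.cast_ofNat, Nat.add_one_sub_one, pow_one]
    ring
  have hYt : Tendsto Y atTop (𝓝 0) := by
    have := h.tendsto_mul.sub h.tendsto
    rw [sub_zero] at this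
    refine this.congr fun t => ?_
    simp only [hY]; ring
  have hb : ∀ t, 0 ≤ t → |T t * G t| ≤ ‖G‖ := fun t ht => by
    rw [abs_mul]
    have h1 : |T t| ≤ 1 := ((sq_lt_one_iff_abs_lt_one _).1 (by linarith [h.sq_lt t ht])).le
    calc _ ≤ 1 * ‖G‖ := mul_le_mul h1 (G.abs_apply_le t) (abs_nonneg _) zero_le_one
      _ = _ := one_mul _
  have h1 : Y t + 2 * ‖G‖ * T t ≤ 0 + 2 * ‖G‖ * 1 :=
    MonotoneOn.le_of_tendsto_Ici (monotoneOn_Ici_of_hasDerivAt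
      (fun t ht => (hYd t ht).add ((h.hasDerivAt_fst t ht).const_mul (2 * ‖G‖))) fun t ht => by
        have h2 := (abs_le.1 (hb t ht)).1
        have h3 := mul_pos (h.sq_lt t ht) (h.pos t ht)
        nlinarith) (hYt.add (h.tendsto_fst.const_mul _)) ht
  have h2 : 2 * ‖G‖ * T t - Y t ≤ 2 * ‖G‖ * 1 - 0 :=
    MonotoneOn.le_of_tendsto_Ici (monotoneOn_Ici_of_hasDerivAt
      (fun t ht => ((h.hasDerivAt_fst t ht).const_mul (2 * ‖G‖)).sub (hYd t ht)) fun t ht => by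
        have h2 := (abs_le.1 (hb t ht)).2
        have h3 := mul_pos (h.sq_lt t ht) (h.pos t ht)
        nlinarith) ((h.tendsto_fst.const_mul _).sub hYt) ht
  have hlt := h.fst_lt ht
  have hle := h.le_fst ht
  have h3 : (1 - T t) * ((1 + T t) * |w t ^ 2 - 1|) ≤ (1 - T t) * (2 * ‖G‖) := by
    have : |Y t| ≤ 2 * ‖G‖ * (1 - T t) := abs_le.2 ⟨by linarith, by linarith⟩
    rw [hY, abs_mul, abs_of_pos (h.sq_lt t ht)] at this
    linarith
  have h4 := le_of_mul_le_mul_left h3 (by linarith)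
  nlinarith [abs_nonneg (w t ^ 2 - 1)]

theorem abs_sub_one_le {t : ℝ} (ht : 0 ≤ t) : |w t - 1| ≤ 4 * ‖G‖ := by
  refine le_trans ?_ (h.abs_sq_sub_one_le ht)
  have hw := h.pos t ht
  rw [show w t ^ 2 - 1 = (w t - 1) * (w t + 1) by ring, abs_mul, abs_of_pos (by linarith : 0 < w t + 1)]
  nlinarith [abs_nonneg (w t - 1)]

/-- In the coordinate `X = (1 - T)/(1 + T)` the equation for `T` is linear, and the unperturbed `X`
is `e^{-2t}`. As `w` is within `4‖G‖` of `1`, `X` is squeezed between two exponentials. -/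
theorem hasDerivAt_ratio {t : ℝ} (ht : 0 ≤ t) :
    HasDerivAt (fun t => (1 - T t) / (1 + T t)) (-2 * w t * ((1 - T t) / (1 + T t))) t := by
  have h0 : 1 + T t ≠ 0 := by linarith [h.le_fst ht]
  have h1 := h.hasDerivAt_fst t ht
  refine ((h1.const_sub 1).div (h1.const_add 1) h0).congr_deriv ?_
  field_simp
  ring

theorem ratio_le {t : ℝ} (ht : 0 ≤ t) :
    (1 - T t) / (1 + T t) ≤ (1 - T 0) / (1 + T 0) * Real.exp (-(2 * (1 - 4 * ‖G‖) * t)) := by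
  have h1 : AntitoneOn (fun t => (1 - T t) / (1 + T t) * Real.exp (2 * (1 - 4 * ‖G‖) * t))
      (Ici 0) := by
    refine antitoneOn_Ici_of_hasDerivAt (fun t ht => (h.hasDerivAt_ratio ht).mul
      (((hasDerivAt_id' t).const_mul (2 * (1 - 4 * ‖G‖))).exp)) fun t ht => ?_
    have h2 := (abs_le.1 (h.abs_sub_one_le ht)).1
    have h3 : 0 < (1 - T t) / (1 + T t) :=
      div_pos (by linarith [h.fst_lt ht]) (by linarith [h.le_fst ht])
    have h4 := mul_pos h3 (Real.exp_pos (2 * (1 - 4 * ‖G‖) * t))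
    nlinarith
  have h2 := h1 (mem_Ici.2 le_rfl) ht ht
  simp only [mul_zero, Real.exp_zero, mul_one] at h2
  rwa [Real.exp_neg, ← div_eq_mul_inv, le_div_iff₀ (Real.exp_pos _)]

theorem le_ratio {t : ℝ} (ht : 0 ≤ t) :
    (1 - T 0) / (1 + T 0) * Real.exp (-(2 * (1 + 4 * ‖G‖) * t)) ≤ (1 - T t) / (1 + T t) := by
  have h1 : MonotoneOn (fun t => (1 - T t) / (1 + T t) * Real.exp (2 * (1 + 4 * ‖G‖) * t))
      (Ici 0) := by
    refine monotoneOn_Ici_of_hasDerivAt (fun t ht => (h.hasDerivAt_ratio ht).mul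
      (((hasDerivAt_id' t).const_mul (2 * (1 + 4 * ‖G‖))).exp)) fun t ht => ?_
    have h2 := (abs_le.1 (h.abs_sub_one_le ht)).2
    have h3 : 0 < (1 - T t) / (1 + T t) :=
      div_pos (by linarith [h.fst_lt ht]) (by linarith [h.le_fst ht])
    have h4 := mul_pos h3 (Real.exp_pos (2 * (1 + 4 * ‖G‖) * t))
    nlinarith
  have h2 := h1 (mem_Ici.2 le_rfl) ht ht
  simp only [mul_zero, Real.exp_zero, mul_one] at h2
  rwa [Real.exp_neg, ← div_eq_mul_inv, div_le_iff₀ (Real.exp_pos _)]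

/-- The difference `tanh t - T` is comparable to `X - e^{-2t}`. The rates `2(1 ± η)` differ from
`2`, but after multiplication by `e^t` an exponential decay remains and absorbs the factor `t`
coming from the change of rate. This is the reason for the weight `e^{-t}`, rather than `e^{-2t}`,
in front of `d`. -/
theorem abs_tanh_sub_le (hG : 4 * ‖G‖ ≤ 1 / 4) {t : ℝ} (ht : 0 ≤ t) :
    |Real.exp t * (Real.tanh t - T t)| ≤ 8 * |T 0| + 32 * ‖G‖ := by
  set η := 4 * ‖G‖ with hη
  have hη0 : 0 ≤ η := by positivity
  set X := (1 - T t) / (1 + T t) with hX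
  set X₀ := (1 - T 0) / (1 + T 0) with hX₀
  have hle := h.le_fst ht
  have hlt := h.fst_lt ht
  have hle0 := h.le_zero
  have hXpos : 0 < X := div_pos (by linarith) (by linarith)
  have hX₀pos : 0 < X₀ := div_pos (by linarith [h.fst_lt le_rfl]) (by linarith)
  have hX1 : |X₀ - 1| ≤ 4 * |T 0| := by
    have h1 : X₀ - 1 = -2 * T 0 / (1 + T 0) := by
      rw [hX₀]
      have : 1 + T 0 ≠ 0 := by linarith
      field_simp
      ring
    rw [h1, abs_div, abs_mul, abs_of_pos (by linarith : 0 < 1 + T 0), div_le_iff₀ (by linarith)]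
    norm_num
    nlinarith [abs_nonneg (T 0)]
  have hE := Real.exp_pos t
  have hfrac : Real.exp t * (Real.tanh t - T t) =
      2 * (Real.exp t * X - Real.exp (-t)) / ((1 + X) * (1 + Real.exp (-t) ^ 2)) := by
    have h1 : T t = (1 - X) / (1 + X) := by
      rw [hX]
      have : 1 + T t ≠ 0 := by linarith
      field_simp
      ring
    rw [h1, Real.tanh_eq_sinh_div_cosh, Real.sinh_eq, Real.cosh_eq, Real.exp_neg]
    field_simp
    ring
  have hkey : ∀ s : ℝ, 1 / 2 ≤ s → Real.exp (-(s * t)) * t ≤ 2 := fun s hs => by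
    have h1 : Real.exp (-(s * t)) ≤ Real.exp (-(t / 2)) := Real.exp_le_exp.2 (by nlinarith)
    have h2 := Real.add_one_le_exp (t / 2)
    have h3 : Real.exp (-(t / 2)) * Real.exp (t / 2) = 1 := by rw [← Real.exp_add]; simp
    have h4 := Real.exp_pos (-(t / 2))
    nlinarith
  -- `e^{-st} - e^{-rt} ≤ (r - s) t e^{-st}`, with `r - s ≤ 2η` and `t e^{-st} ≤ 2`.
  have hdiff : ∀ s r : ℝ, 1 / 2 ≤ s → s ≤ r → r ≤ s + 2 * η →
      Real.exp (-(s * t)) - Real.exp (-(r * t)) ≤ 4 * η := fun s r hs hsr hr => by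
    have h1 : Real.exp (-(r * t)) = Real.exp (-(s * t)) * Real.exp (-((r - s) * t)) := by
      rw [← Real.exp_add]; ring_nf
    have h2 := Real.add_one_le_exp (-((r - s) * t))
    have h3 := hkey s hs
    have h4 := Real.exp_pos (-(s * t))
    have h5 : (r - s) * (Real.exp (-(s * t)) * t) ≤ (2 * η) * 2 :=
      mul_le_mul (by linarith) h3 (by positivity) (by positivity)
    rw [h1]
    nlinarith
  have hup : Real.exp t * X - Real.exp (-t) ≤ 4 * |T 0| + 4 * η := by
    have h1 := h.ratio_le ht
    have h2 : Real.exp t * X ≤ X₀ * Real.exp (-((1 - 2 * η) * t)) := by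
      calc Real.exp t * X ≤ Real.exp t * (X₀ * Real.exp (-(2 * (1 - η) * t))) := by gcongr
        _ = X₀ * (Real.exp t * Real.exp (-(2 * (1 - η) * t))) := by ring
        _ = _ := by rw [← Real.exp_add]; ring_nf
    have h3 : Real.exp (-((1 - 2 * η) * t)) ≤ 1 := Real.exp_le_one_iff.2 (by nlinarith)
    have h4 := Real.exp_pos (-((1 - 2 * η) * t))
    have h5 := hdiff (1 - 2 * η) 1 (by linarith) (by linarith) (by linarith)
    rw [one_mul] at h5
    have h6 := (abs_le.1 hX1).2
    have h7 : (X₀ - 1) * Real.exp (-((1 - 2 * η) * t)) ≤ 4 * |T 0| := by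
      nlinarith [abs_nonneg (T 0)]
    linarith
  have hlow : Real.exp (-t) - Real.exp t * X ≤ 4 * |T 0| + 4 * η := by
    have h1 := h.le_ratio ht
    have h2 : X₀ * Real.exp (-((1 + 2 * η) * t)) ≤ Real.exp t * X := by
      calc X₀ * Real.exp (-((1 + 2 * η) * t))
          = X₀ * (Real.exp t * Real.exp (-(2 * (1 + η) * t))) := by
            rw [← Real.exp_add]; ring_nf
        _ = Real.exp t * (X₀ * Real.exp (-(2 * (1 + η) * t))) := by ring
        _ ≤ _ := by gcongr
    have h3 : Real.exp (-((1 + 2 * η) * t)) ≤ 1 := Real.exp_le_one_iff.2 (by nlinarith)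
    have h4 := Real.exp_pos (-((1 + 2 * η) * t))
    have h5 := hdiff 1 (1 + 2 * η) (by linarith) (by linarith) (by linarith)
    rw [one_mul] at h5
    have h6 := (abs_le.1 hX1).1
    have h7 : (1 - X₀) * Real.exp (-((1 + 2 * η) * t)) ≤ 4 * |T 0| := by
      nlinarith [abs_nonneg (T 0)]
    linarith
  have habs : |Real.exp t * X - Real.exp (-t)| ≤ 4 * |T 0| + 4 * η :=
    abs_le.2 ⟨by linarith, hup⟩
  have hden : 1 ≤ (1 + X) * (1 + Real.exp (-t) ^ 2) := by
    nlinarith [sq_nonneg (Real.exp (-t))]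
  rw [hfrac, abs_div, abs_of_pos (by linarith : 0 < (1 + X) * (1 + Real.exp (-t) ^ 2)), abs_mul,
    div_le_iff₀ (by linarith), abs_two]
  have : 0 ≤ 8 * |T 0| + 32 * ‖G‖ := by positivity
  nlinarith

end IsReducedMotion

/-- Equality in `BC` concerns all real times; as everything is frozen at negative times, it suffices
to check `t ≥ 0`. -/
theorem forwardOp_max (h : BC) (t : ℝ) : forwardOp h (max t 0) = forwardOp h t := by
  change ofHalfLine _ _ _ _ _ = ofHalfLine _ _ _ _ _
  simp [ofHalfLine_apply]

theorem backwardOp_max (h : BC) (t : ℝ) : backwardOp h (max t 0) = backwardOp h t := by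
  change ofHalfLine _ _ _ _ _ = ofHalfLine _ _ _ _ _
  simp [ofHalfLine_apply]

theorem sechW_max (t : ℝ) : sechW (max t 0) = sechW t := by
  rw [sechW_apply (le_max_right t 0)]
  rfl

/-- This is variation of constants in both components; boundedness of `d` and `u` is the content of
the preceding estimates. -/
theorem IsReducedMotion.exists_defect_eq_zero {G : BC} {T w : ℝ → ℝ} (h : IsReducedMotion G T w)
    (hG : 4 * ‖G‖ ≤ 1 / 4) :
    ∃ d u : BC, defect ((-T 0, G), (d, u)) = 0 ∧ (∀ t, 0 ≤ t → slope d t = T t) ∧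
      (∀ t, 0 ≤ t → 1 + u t = w t) ∧ ‖d‖ ≤ 8 * |T 0| + 32 * ‖G‖ ∧ ‖u‖ ≤ 4 * ‖G‖ := by
  have hTc : ∀ t, 0 ≤ t → ContinuousWithinAt T (Ici 0) t := fun t ht =>
    (h.hasDerivAt_fst t ht).continuousAt.continuousWithinAt
  have hdc : ContinuousOn (fun t => Real.exp t * (Real.tanh t - T t)) (Ici 0) := fun t ht =>
    Real.continuous_exp.continuousWithinAt.mul
      (continuous_tanh.continuousWithinAt.sub (hTc t ht))
  have huc : ContinuousOn (fun t => w t - 1) (Ici 0) := fun t ht =>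
    ((h.hasDerivAt_snd t ht).continuousAt.sub continuousAt_const).continuousWithinAt
  set d : BC := ofHalfLine _ hdc _ fun t ht => h.abs_tanh_sub_le hG ht with hd
  set u : BC := ofHalfLine _ huc _ fun t ht => h.abs_sub_one_le ht with hu
  have hdt : ∀ t, 0 ≤ t → d t = Real.exp t * (Real.tanh t - T t) := fun t ht =>
    ofHalfLine_apply_of_nonneg ht
  have hut : ∀ t, 0 ≤ t → u t = w t - 1 := fun t ht => ofHalfLine_apply_of_nonneg ht
  have hexp : ∀ t : ℝ, Real.exp (-t) * Real.exp t = 1 := fun t => by rw [← Real.exp_add]; simp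
  have hslope : ∀ t, 0 ≤ t → slope d t = T t := fun t ht => by
    rw [slope_apply, tanhW_apply ht, expW_apply ht, hdt t ht, ← mul_assoc, hexp]
    ring
  have hed : ∀ t, 0 ≤ t → expW t * d t = Real.tanh t - T t := fun t ht => by
    rw [expW_apply ht, hdt t ht, ← mul_assoc, hexp, one_mul]
  refine ⟨d, u, defect_eq_zero_iff.2 ⟨?_, ?_⟩, hslope, fun t ht => ?_, norm_ofHalfLine_le,
    norm_ofHalfLine_le⟩
  · have key : ∀ t, 0 ≤ t → d t = -T 0 * sechW t + forwardOp (sourceD d u) t := fun t ht => by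
      have h1 : ∫ r in (0 : ℝ)..t, Real.exp (-r) * Real.cosh r ^ 2 * sourceD d u r =
          Real.cosh t ^ 2 * (Real.tanh t - T t) - Real.cosh 0 ^ 2 * (Real.tanh 0 - T 0) := by
        refine intervalIntegral.integral_eq_sub_of_hasDerivAt
          (f := fun t => Real.cosh t ^ 2 * (Real.tanh t - T t)) (fun r hr => ?_) ?_
        · rw [uIcc_of_le ht] at hr
          have hr0 := hr.1
          have hp := (Real.cosh_pos r).ne'
          refine ((((Real.hasDerivAt_cosh r).fun_pow 2).mul
            ((hasDerivAt_tanh r).fun_sub (h.hasDerivAt_fst r hr0))).congr_deriv ?_)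
          have h2 : Real.exp (-r) * sourceD d u r =
              (Real.tanh r - T r) ^ 2 - (1 - T r ^ 2) * (w r - 1) := by
            have h3 := one_sub_slope_sq d hr0
            rw [hslope r hr0] at h3
            rw [sourceD_apply, ← hed r hr0, h3, ← hut r hr0, ← expW_apply hr0]
            ring
          have h3 : Real.sinh r = Real.cosh r * Real.tanh r := by
            rw [Real.tanh_eq_sinh_div_cosh]; field_simp
          simp only [Nat.cast_ofNat, Nat.add_one_sub_one, pow_one]
          rw [h3]
          linear_combination (-Real.cosh r ^ 2) * h2
        · have := (sourceD d u).continuous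
          apply Continuous.intervalIntegrable
          fun_prop
      have hp := (Real.cosh_pos t).ne'
      rw [forwardOp_apply _ ht, h1, sechW_apply ht, hdt t ht, Real.cosh_zero, Real.tanh_zero]
      field_simp
      ring
    ext t
    have h1 := key (max t 0) (le_max_right t 0)
    rw [forwardOp_max, sechW_max] at h1
    rw [show d t = d (max t 0) by simp [hd, ofHalfLine_apply], h1]
    rfl
  · have key : ∀ t, 0 ≤ t → u t = -backwardOp (sourceU G d u) t := fun t ht => by
      -- The boundary term at infinity vanishes because `w - 1` is bounded; this excludes the
      -- growing homogeneous solution `cosh² t`.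
      have h1 : ∫ r in Ioi t, (Real.cosh r ^ 2)⁻¹ * sourceU G d u r =
          0 - (Real.cosh t ^ 2)⁻¹ * (w t - 1) := by
        refine integral_Ioi_of_hasDerivAt_of_tendsto'
          (f := fun t => (Real.cosh t ^ 2)⁻¹ * (w t - 1)) (fun r hr => ?_)
          (integrableOn_inv_cosh_sq_mul _ _) ?_
        · have hr0 : 0 ≤ r := ht.trans hr
          have hp := (Real.cosh_pos r).ne'
          refine ((((Real.hasDerivAt_cosh r).fun_pow 2).fun_inv (pow_ne_zero 2 hp)).mul
            ((h.hasDerivAt_snd r hr0).sub_const 1)).congr_deriv ?_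
          have h2 : sourceU G d u r = T r * ((w r - 1) * (w r - 1) + G r)
              - 2 * ((Real.tanh r - T r) * (w r - 1)) := by
            rw [sourceU_apply, hslope r hr0, hed r hr0, hut r hr0]
          rw [h2]
          have h3 : Real.sinh r = Real.cosh r * Real.tanh r := by
            rw [Real.tanh_eq_sinh_div_cosh]; field_simp
          simp only [Nat.cast_ofNat, Nat.add_one_sub_one, pow_one]
          rw [h3]
          field_simp
          ring
        · have h4 : Tendsto (fun t : ℝ => 4 * Real.exp (-2 * t) * (4 * ‖G‖)) atTop (𝓝 0) := by
            have h5 : Tendsto (fun t : ℝ => Real.exp (-2 * t)) atTop (𝓝 0) :=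
              Real.tendsto_exp_atBot.comp (tendsto_id.const_mul_atTop_of_neg (by norm_num))
            simpa using (h5.const_mul 4).mul_const (4 * ‖G‖)
          refine squeeze_zero_norm' ?_ h4
          filter_upwards [eventually_ge_atTop 0] with r hr
          rw [Real.norm_eq_abs, abs_mul, abs_of_nonneg (by positivity)]
          have := inv_cosh_sq_le r
          have := h.abs_sub_one_le hr
          gcongr
      have hp := (Real.cosh_pos t).ne'
      rw [backwardOp_apply _ ht, h1, hut t ht]
      field_simp
      ring
    ext t
    have h1 := key (max t 0) (le_max_right t 0)
    rw [backwardOp_max] at h1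
    rw [show u t = u (max t 0) by simp [hu, ofHalfLine_apply], h1]
    rfl
  · rw [hut t ht]; ring

/-! ### The whisker as a set of motions -/

theorem torus_nonempty (B : Fin 2 → ℝ) : (torus B).Nonempty := ⟨_, 0, 0, rfl⟩

theorem abs_momentum_le_infDist (z : Phase) (B : Fin 2 → ℝ) :
    |z.2.2.1| ≤ Metric.infDist z (torus B) := by
  refine (Metric.le_infDist (torus_nonempty B)).2 ?_
  rintro _ ⟨n, φ, rfl⟩
  rw [Prod.dist_eq, Prod.dist_eq, Prod.dist_eq]
  refine le_max_of_le_right (le_max_of_le_right (le_max_of_le_left ?_))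
  simp

theorem abs_action_sub_le_infDist (z : Phase) (B : Fin 2 → ℝ) (i : Fin 2) :
    |z.2.2.2 i - B i| ≤ Metric.infDist z (torus B) := by
  refine (Metric.le_infDist (torus_nonempty B)).2 ?_
  rintro _ ⟨n, φ, rfl⟩
  rw [Prod.dist_eq, Prod.dist_eq, Prod.dist_eq]
  refine le_max_of_le_right (le_max_of_le_right (le_max_of_le_right ?_))
  exact dist_le_pi_dist z.2.2.2 B i

/-- `|sin (q/2)|` is `2π`-periodic in `q`, so the estimate is insensitive to which copy of the torus
is near. -/
theorem abs_sin_half_le_infDist (z : Phase) (B : Fin 2 → ℝ) :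
    |Real.sin (z.1 / 2)| ≤ Metric.infDist z (torus B) := by
  refine (Metric.le_infDist (torus_nonempty B)).2 ?_
  rintro _ ⟨n, φ, rfl⟩
  rw [Prod.dist_eq]
  refine le_max_of_le_left ?_
  have h1 : |Real.sin (z.1 / 2)| = |Real.sin (z.1 / 2 - n * Real.pi)| := by
    rw [Real.sin_sub_int_mul_pi, abs_mul, abs_zpow, abs_neg, abs_one, one_zpow, one_mul]
  rw [h1]
  refine Real.abs_sin_le_abs.trans ?_
  have h2 : z.1 / 2 - n * Real.pi = (z.1 - 2 * Real.pi * n) / 2 := by ring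
  rw [h2, abs_div, abs_two]
  change _ ≤ |z.1 - 2 * Real.pi * n|
  linarith [abs_nonneg (z.1 - 2 * Real.pi * n)]

/-! ### The components of a motion. -/

section Components

variable {Γ : ℕ} {c : ℤ × ℤ → ℝ} {ω : Fin 2 → ℝ} {μ : ℝ} {γ : ℝ → Phase}
  (hγ : IsIntegralCurve γ fun _ => flowField Γ c ω μ)
include hγ

theorem hasDerivAt_motion_angle (t : ℝ) : HasDerivAt (fun t => (γ t).1) (γ t).2.2.1 t :=
  (ContinuousLinearMap.fst ℝ ℝ ((Fin 2 → ℝ) × ℝ × (Fin 2 → ℝ))).hasFDerivAt.comp_hasDerivAt t (hγ t)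

theorem hasDerivAt_motion_snd (t : ℝ) :
    HasDerivAt (fun t => (γ t).2) (flowField Γ c ω μ (γ t)).2 t :=
  (ContinuousLinearMap.snd ℝ ℝ ((Fin 2 → ℝ) × ℝ × (Fin 2 → ℝ))).hasFDerivAt.comp_hasDerivAt t (hγ t)

theorem motion_phase (t : ℝ) : (γ t).2.1 = (γ 0).2.1 + t • ω := by
  have h1 : ∀ t, HasDerivAt (fun t => (γ t).2.1) ω t := fun t =>
    (ContinuousLinearMap.fst ℝ (Fin 2 → ℝ) (ℝ × (Fin 2 → ℝ))).hasFDerivAt.comp_hasDerivAt t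
      (hasDerivAt_motion_snd hγ t)
  have h2 : ∀ t, HasDerivAt (fun t => (γ t).2.1 - t • ω) 0 t := fun t => by
    simpa using (h1 t).fun_sub ((hasDerivAt_id' t).smul_const ω)
  have h3 := is_const_of_deriv_eq_zero (fun t => (h2 t).differentiableAt)
    (fun t => (h2 t).deriv) t 0
  simp only [zero_smul, sub_zero] at h3
  rw [← h3]; simp

theorem hasDerivAt_motion_momentum (t : ℝ) :
    HasDerivAt (fun t => (γ t).2.2.1)
      (Real.sin (γ t).1 * (1 - μ * trigPoly Γ c ((γ 0).2.1 + t • ω))) t := by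
  have h1 : HasDerivAt (fun t => (γ t).2.2) _ t :=
    (ContinuousLinearMap.snd ℝ (Fin 2 → ℝ) (ℝ × (Fin 2 → ℝ))).hasFDerivAt.comp_hasDerivAt t
      (hasDerivAt_motion_snd hγ t)
  rw [← motion_phase hγ]
  exact (ContinuousLinearMap.fst ℝ ℝ (Fin 2 → ℝ)).hasFDerivAt.comp_hasDerivAt t h1

theorem hasDerivAt_motion_action (i : Fin 2) (t : ℝ) :
    HasDerivAt (fun t => (γ t).2.2.2 i)
      (-(μ * ((1 - Real.cos (γ t).1) * gradPoly Γ c i ((γ 0).2.1 + t • ω)))) t := by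
  have h1 : HasDerivAt (fun t => (γ t).2.2) _ t :=
    (ContinuousLinearMap.snd ℝ (Fin 2 → ℝ) (ℝ × (Fin 2 → ℝ))).hasFDerivAt.comp_hasDerivAt t
      (hasDerivAt_motion_snd hγ t)
  have h2 : HasDerivAt (fun t => (γ t).2.2.2) _ t :=
    (ContinuousLinearMap.snd ℝ ℝ (Fin 2 → ℝ)).hasFDerivAt.comp_hasDerivAt t h1
  rw [← motion_phase hγ]
  exact hasDerivAt_pi.1 h2 i

end Components

/-- This is the converse of `mem_stableWhisker_of_defect`. The explicit bounds on `d` and `u` place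
the solution in the ball where it is unique. -/
theorem exists_defect_of_mem_stableWhisker {Γ : ℕ} {c : ℤ × ℤ → ℝ} {ω : Fin 2 → ℝ} {μ : ℝ}
    {B : Fin 2 → ℝ} {z : Phase}
    (hz : z ∈ stableWhisker (hamiltonian (trigPoly Γ c) ω μ) B)
    (hq : |Real.cos (z.1 / 2)| ≤ 1 / 2) (hG : 4 * ‖μ • polyOrbit Γ c ω z.2.1‖ ≤ 1 / 4) :
    ∃ d u : BC, defect ((Real.cos (z.1 / 2), μ • polyOrbit Γ c ω z.2.1), (d, u)) = 0 ∧
      ‖d‖ ≤ 8 * |Real.cos (z.1 / 2)| + 32 * ‖μ • polyOrbit Γ c ω z.2.1‖ ∧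
      ‖u‖ ≤ 4 * ‖μ • polyOrbit Γ c ω z.2.1‖ ∧
      z.2.2.1 = 2 * Real.sin (z.1 / 2) * (1 + u 0) ∧
      z.2.2.2 = B + μ • whiskerAction Γ c ω z.2.1 d := by
  obtain ⟨γ, hγ, rfl, hlim, hpos⟩ := hz
  rw [hamiltonianField_eq] at hγ
  set T : ℝ → ℝ := fun t => -Real.cos ((γ t).1 / 2) with hT
  set w : ℝ → ℝ := fun t => (γ t).2.2.1 / (2 * Real.sin ((γ t).1 / 2)) with hw
  have hsin : ∀ t, 0 ≤ t → 0 < Real.sin ((γ t).1 / 2) := fun t ht =>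
    Real.sin_pos_of_pos_of_lt_pi (by linarith [(hpos t ht).1]) (by linarith [(hpos t ht).2.1])
  have hTsq : ∀ t, 1 - T t ^ 2 = Real.sin ((γ t).1 / 2) ^ 2 := fun t => by
    simp only [hT]
    linarith [Real.sin_sq_add_cos_sq ((γ t).1 / 2), neg_sq (Real.cos ((γ t).1 / 2))]
  have hsinlim : Tendsto (fun t => Real.sin ((γ t).1 / 2)) atTop (𝓝 0) :=
    squeeze_zero_norm (fun t => abs_sin_half_le_infDist (γ t) B) hlim
  have hplim : Tendsto (fun t => (γ t).2.2.1) atTop (𝓝 0) :=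
    squeeze_zero_norm (fun t => abs_momentum_le_infDist (γ t) B) hlim
  have hred : IsReducedMotion (μ • polyOrbit Γ c ω (γ 0).2.1) T w := by
    refine ⟨fun t ht => ?_, fun t ht => ?_, fun t ht => ?_, fun t ht => ?_, ?_, ?_, ?_⟩
    · have hs := (hsin t ht).ne'
      refine ((hasDerivAt_motion_angle hγ t).div_const 2).cos.neg.congr_deriv ?_
      rw [hTsq]
      simp only [hw]
      field_simp
    · have hs := (hsin t ht).ne'
      refine ((hasDerivAt_motion_momentum hγ t).div
        (((hasDerivAt_motion_angle hγ t).div_const 2).sin.const_mul 2)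
        (mul_ne_zero two_ne_zero hs)).congr_deriv ?_
      have h1 : Real.sin (γ t).1 = 2 * Real.sin ((γ t).1 / 2) * Real.cos ((γ t).1 / 2) := by
        rw [← Real.sin_two_mul]; ring_nf
      have h2 : (μ • polyOrbit Γ c ω (γ 0).2.1) t = μ * trigPoly Γ c ((γ 0).2.1 + t • ω) := by
        rw [← polyOrbit_apply]; rfl
      rw [h1, h2]
      simp only [hw, hT]
      field_simp
      ring
    · exact div_pos (hpos t ht).2.2 (by linarith [hsin t ht])
    · rw [hTsq]
      exact pow_pos (hsin t ht) 2
    · simp_rw [hTsq]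
      simpa using hsinlim.pow 2
    · have h1 : Tendsto (fun t => ((γ t).2.2.1 / 2) ^ 2) atTop (𝓝 0) := by
        simpa using (hplim.div_const 2).pow 2
      refine h1.congr' ?_
      filter_upwards [eventually_ge_atTop 0] with t ht
      have hs := (hsin t ht).ne'
      rw [hTsq]
      simp only [hw]
      field_simp
    · simp only [hT]
      linarith [(abs_le.1 hq).2]
  obtain ⟨d, u, hdef, hsl, hu, hdn, hun⟩ := hred.exists_defect_eq_zero hG
  have hT0 : -T 0 = Real.cos ((γ 0).1 / 2) := neg_neg _
  have hT0' : |T 0| = |Real.cos ((γ 0).1 / 2)| := abs_neg _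
  rw [hT0] at hdef
  rw [hT0'] at hdn
  refine ⟨d, u, hdef, hdn, hun, ?_, ?_⟩
  · have hs := (hsin 0 le_rfl).ne'
    rw [hu 0 le_rfl]
    simp only [hw]
    field_simp
  · funext i
    -- Integrating `A'` over all positive times, with limit `B`, recovers the initial action.
    have h1 : ∫ r in Ioi (0 : ℝ),
        -(μ * ((1 - Real.cos (γ r).1) * gradPoly Γ c i ((γ 0).2.1 + r • ω))) =
        B i - (γ 0).2.2.2 i := by
      have hcongr : ∀ r, 0 ≤ r →
          -μ * (2 * (1 - slope d r ^ 2) * gradPoly Γ c i ((γ 0).2.1 + r • ω)) =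
          -(μ * ((1 - Real.cos (γ r).1) * gradPoly Γ c i ((γ 0).2.1 + r • ω))) := fun r hr => by
        rw [hsl r hr]
        have h2 : Real.cos (γ r).1 = 2 * Real.cos ((γ r).1 / 2) ^ 2 - 1 := by
          rw [← Real.cos_two_mul]; ring_nf
        rw [h2]
        simp only [hT]
        ring
      refine integral_Ioi_of_hasDerivAt_of_tendsto'
        (fun r _ => hasDerivAt_motion_action hγ i r) ?_ ?_
      · have h3 : IntegrableOn (fun r => -μ * (2 * (1 - slope d r ^ 2) *
            gradPoly Γ c i ((γ 0).2.1 + r • ω))) (Ioi 0) :=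
          (integrableOn_whiskerAction Γ c ω (γ 0).2.1 d i).const_mul (-μ)
        exact h3.congr_fun (fun r hr => hcongr r (mem_Ioi.1 hr).le) measurableSet_Ioi
      · rw [tendsto_iff_norm_sub_tendsto_zero]
        exact squeeze_zero (fun t => norm_nonneg _)
          (fun t => abs_action_sub_le_infDist (γ t) B i) hlim
    have h2 : ∫ r in Ioi (0 : ℝ),
        -(μ * ((1 - Real.cos (γ r).1) * gradPoly Γ c i ((γ 0).2.1 + r • ω))) =
        -μ * whiskerAction Γ c ω (γ 0).2.1 d i := by
      rw [whiskerAction_eq, ← integral_const_mul]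
      refine setIntegral_congr_fun measurableSet_Ioi fun r hr => ?_
      have h3 : Real.cos (γ r).1 = 2 * Real.cos ((γ r).1 / 2) ^ 2 - 1 := by
        rw [← Real.cos_two_mul]; ring_nf
      simp only [hsl r (mem_Ioi.1 hr).le, h3, hT]
      ring
    rw [h2] at h1
    change (γ 0).2.2.2 i = B i + μ * whiskerAction Γ c ω (γ 0).2.1 d i
    linarith

/-! ### The linearized equations -/

theorem sourceD'_apply (d u d' u' : BC) (t : ℝ) :
    sourceD' d u d' u' t = 2 * (expW t * d t * d' t) -
      (2 * (slope d t * d' t) * u t + density d t * u' t) := rfl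

theorem sourceU'_apply (G d u G' d' u' : BC) (t : ℝ) :
    sourceU' G d u G' d' u' t = slope d t * (2 * (u t * u' t) + G' t) -
      expW t * d' t * (u t * u t + G t) - 2 * (expW t * (d' t * u t + d t * u' t)) := rfl

/-- The whiskers are Lagrangian: two solutions of the linearized equations with the same initial
angle have vanishing symplectic product. -/
theorem expIntegral_slope_mul_symm {G d u g₁ g₂ d₁ u₁ d₂ u₂ : BC} {μ : ℝ} (hμ : μ ≠ 0)
    (hd₁ : d₁ = forwardOp (sourceD' d u d₁ u₁))
    (hu₁ : u₁ = -backwardOp (sourceU' G d u (μ • g₁) d₁ u₁))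
    (hd₂ : d₂ = forwardOp (sourceD' d u d₂ u₂))
    (hu₂ : u₂ = -backwardOp (sourceU' G d u (μ • g₂) d₂ u₂)) :
    expIntegral (slope d * d₁ * g₂) = expIntegral (slope d * d₂ * g₁) := by
  have hd : ∀ {d' u' : BC}, d' = forwardOp (sourceD' d u d' u') → d' 0 = 0 ∧ ∀ t, 0 < t →
      HasDerivAt d' ((1 - 2 * Real.tanh t) * d' t + sourceD' d u d' u' t) t := by
    intro d' u' h
    refine ⟨?_, fun t ht => ?_⟩
    · rw [h, forwardOp_apply _ le_rfl]; simp
    · have h1 := hasDerivAt_forwardOp (sourceD' d u d' u') ht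
      rwa [← h] at h1
  have hu : ∀ {g' d' u' : BC}, u' = -backwardOp (sourceU' G d u (μ • g') d' u') → ∀ t, 0 < t →
      HasDerivAt u' (2 * Real.tanh t * u' t + sourceU' G d u (μ • g') d' u' t) t := by
    intro g' d' u' h t ht
    have h1 : HasDerivAt (-backwardOp (sourceU' G d u (μ • g') d' u') : BC) _ t :=
      (hasDerivAt_backwardOp (sourceU' G d u (μ • g') d' u') ht).neg
    rw [← h] at h1
    refine h1.congr_deriv ?_
    have h2 : backwardOp (sourceU' G d u (μ • g') d' u') = -u' := by
      rw [eq_neg_iff_add_eq_zero, add_comm, ← eq_neg_iff_add_eq_zero]; exact h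
    rw [h2]
    change -(2 * Real.tanh t * (-u' t) - _) = _
    ring
  set g : BC := slope d * d₁ * g₂ - slope d * d₂ * g₁ with hg
  -- In the derivative of `e^{-t}(d₁ u₂ - d₂ u₁)` all terms cancel except the forcing. The boundary
  -- term vanishes at `0` because `d₁` and `d₂` do, and at infinity by the weight.
  have hint : ∫ t in Ioi (0 : ℝ), Real.exp (-1 * t) * (μ • g) t =
      0 - expW 0 * (d₁ 0 * u₂ 0 - d₂ 0 * u₁ 0) := by
    refine integral_Ioi_of_hasDerivAt_of_tendsto
      (f := fun t => expW t * (d₁ t * u₂ t - d₂ t * u₁ t)) ?_ (fun t ht => ?_)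
      (integrableOn_exp_mul _ _ (by norm_num)) ?_
    · have := expW.continuous
      have := d₁.continuous
      have := d₂.continuous
      have := u₁.continuous
      have := u₂.continuous
      exact Continuous.continuousWithinAt (by fun_prop)
    · refine ((hasDerivAt_expW ht).mul ((((hd hd₁).2 t ht).fun_mul (hu hu₂ t ht)).fun_sub
        (((hd hd₂).2 t ht).fun_mul (hu hu₁ t ht)))).congr_deriv ?_
      rw [neg_one_mul, ← expW_apply (mem_Ioi.1 ht).le, sourceD'_apply, sourceD'_apply,
        sourceU'_apply, sourceU'_apply]
      change _ = expW t * (μ * (slope d t * d₁ t * g₂ t - slope d t * d₂ t * g₁ t))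
      rw [show (μ • g₁) t = μ * g₁ t from rfl, show (μ • g₂) t = μ * g₂ t from rfl]
      ring
    · exact tendsto_expW_mul (d₁ * u₂ - d₂ * u₁)
  rw [(hd hd₁).1, (hd hd₂).1, ← expIntegral_apply, map_smul, smul_eq_mul] at hint
  have h0 : expIntegral g = 0 := by
    have : μ * expIntegral g = 0 := by rw [hint]; ring
    exact (mul_eq_zero.1 this).resolve_left hμ
  rw [hg, map_sub, sub_eq_zero] at h0
  exact h0

theorem hasDerivAt_whiskerAction (Γ : ℕ) (c : ℤ × ℤ → ℝ) (ω φ : Fin 2 → ℝ) {d : ℝ → BC} {d' : BC}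
    (i j : Fin 2) (hd : HasDerivAt d d' 0) :
    HasDerivAt (fun s : ℝ => whiskerAction Γ c ω (φ + s • Pi.single j 1) (d s) i)
      (4 * expIntegral (slope (d 0) * d' * gradOrbit Γ c ω i φ) +
        2 * expIntegral (density (d 0) * hessOrbit Γ c ω i j φ)) 0 := by
  have h1 := ((hasDerivAt_density hd).mul (hasDerivAt_gradOrbit Γ c ω i φ j 0)).const_smul (2 : ℝ)
  refine (expIntegral.hasFDerivAt.comp_hasDerivAt (0 : ℝ) h1).congr_deriv ?_
  simp only [zero_smul, add_zero, smul_add, map_add, map_smul, smul_mul_assoc, smul_eq_mul]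
  ring

/-! ### The stable whisker as a graph -/

/-- The parameters `(μ, q, φ)`. -/
abbrev Param : Type := ℝ × ℝ × (Fin 2 → ℝ)

/-- The initial value and the forcing that belong to `(μ, q, φ)`. -/
def inputData (Γ : ℕ) (c : ℤ × ℤ → ℝ) (ω : Fin 2 → ℝ) (x : Param) : ℝ × BC :=
  (Real.cos (x.2.1 / 2), x.1 • polyOrbit Γ c ω x.2.2)

theorem contDiff_inputData (Γ : ℕ) (c : ℤ × ℤ → ℝ) (ω : Fin 2 → ℝ) {n : WithTop ℕ∞} :
    ContDiff ℝ n (inputData Γ c ω) := by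
  unfold inputData
  have := contDiff_polyOrbit Γ c ω (n := n)
  fun_prop

/-- The parameters near `μ = 0`, `q = π`. -/
def paramDomain (a : ℝ) : Set Param := {x | |x.1| < a ∧ |x.2.1 - Real.pi| < a}

theorem isOpen_paramDomain (a : ℝ) : IsOpen (paramDomain a) := by
  have h1 : Continuous fun x : Param => |x.1| := by fun_prop
  have h2 : Continuous fun x : Param => |x.2.1 - Real.pi| := by fun_prop
  exact (isOpen_lt h1 continuous_const).inter (isOpen_lt h2 continuous_const)

/-- `P` and `A` describe the stable whiskers as graphs over the angles with `q` near `π`. -/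
structure IsStableGraph (Γ : ℕ) (c : ℤ × ℤ → ℝ) (ω : Fin 2 → ℝ) (a : ℝ) (P : Param → ℝ)
    (A : Param → Fin 2 → ℝ) : Prop where
  pos : 0 < a
  contDiffOn_momentum : ContDiffOn ℝ 1 P (paramDomain a)
  contDiffOn_action : ContDiffOn ℝ 1 A (paramDomain a)
  momentum_pos : ∀ x ∈ paramDomain a, 0 < P x
  momentum_le : ∀ x ∈ paramDomain a, P x ≤ 4
  action_periodic : ∀ μ q φ (n : Fin 2 → ℤ),
    A (μ, q, φ + fun i => 2 * Real.pi * n i) = A (μ, q, φ)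
  mem_iff : ∀ x ∈ paramDomain a, ∀ (B : Fin 2 → ℝ) (p : ℝ) (A' : Fin 2 → ℝ),
    ((x.2.1, x.2.2, p, A') : Phase) ∈ stableWhisker (hamiltonian (trigPoly Γ c) ω x.1) B ↔
      p = P x ∧ A' = B + x.1 • A x
  symm : ∀ x ∈ paramDomain a, x.1 ≠ 0 → ∀ i j,
    fderiv ℝ (fun φ => A (x.1, x.2.1, φ) i) x.2.2 (Pi.single j 1) =
      fderiv ℝ (fun φ => A (x.1, x.2.1, φ) j) x.2.2 (Pi.single i 1)

theorem abs_cos_half_le (q : ℝ) : |Real.cos (q / 2)| ≤ |q - Real.pi| := by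
  have h1 : Real.cos (q / 2) = Real.sin ((Real.pi - q) / 2) := by
    rw [← Real.cos_pi_div_two_sub]; ring_nf
  rw [h1]
  refine Real.abs_sin_le_abs.trans ?_
  rw [abs_div, abs_two, abs_sub_comm]
  linarith [abs_nonneg (q - Real.pi)]

/-- The graph functions are read off from the solution map at the data `(cos (q/2), μ f(φ + tω))`.
The constructed motions lie in the whisker, and uniqueness in the ball shows that nothing else does.
-/
theorem exists_isStableGraph (Γ : ℕ) (c : ℤ × ℤ → ℝ) (ω : Fin 2 → ℝ) :
    ∃ (a : ℝ) (P : Param → ℝ) (A : Param → Fin 2 → ℝ), IsStableGraph Γ c ω a P A := by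
  obtain ⟨Ψ, ε, hε, hΨ, hsol, huniq⟩ := exists_solutionMap
  obtain ⟨C, hC, hCb⟩ := exists_norm_polyOrbit_le Γ c ω
  -- If `|cos (q/2)|` and `‖G‖` are below `ε₀`, then `‖d‖ ≤ 8|cos (q/2)| + 32‖G‖ < 40 ε₀ < ε`; the
  -- bound `1/16` secures `4‖G‖ ≤ 1/4`.
  set ε₀ : ℝ := min (ε / 41) (1 / 16) with hε₀
  have hε₀pos : 0 < ε₀ := lt_min (by positivity) (by norm_num)
  have hε₀1 : 41 * ε₀ ≤ ε := by linarith [min_le_left (ε / 41) (1 / 16)]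
  have hε₀2 : ε₀ ≤ 1 / 16 := min_le_right _ _
  set a : ℝ := ε₀ / (C + 1) with ha
  have hapos : 0 < a := by positivity
  have haC : a * (C + 1) = ε₀ := by rw [ha]; field_simp
  have hale : a ≤ ε₀ := by nlinarith
  have hcos : ∀ x ∈ paramDomain a, |Real.cos (x.2.1 / 2)| < ε₀ := fun x hx =>
    (abs_cos_half_le _).trans_lt (hx.2.trans_le hale)
  have hG : ∀ x ∈ paramDomain a, ‖x.1 • polyOrbit Γ c ω x.2.2‖ < ε₀ := fun x hx => by
    rw [norm_smul, Real.norm_eq_abs]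
    have h1 := hCb x.2.2
    have h2 := hx.1
    have h3 := abs_nonneg x.1
    nlinarith [norm_nonneg (polyOrbit Γ c ω x.2.2)]
  have hball : ∀ x ∈ paramDomain a, inputData Γ c ω x ∈ Metric.ball (0 : ℝ × BC) ε := fun x hx => by
    rw [mem_ball_zero_iff]
    exact max_lt ((hcos x hx).trans (by linarith)) ((hG x hx).trans (by linarith))
  have hq : ∀ x ∈ paramDomain a, 0 < x.2.1 ∧ x.2.1 < 2 * Real.pi := fun x hx => by
    have h1 := abs_lt.1 hx.2
    have := Real.pi_gt_three
    constructor <;> linarith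
  set Φ : Param → BC × BC := fun x => Ψ (inputData Γ c ω x) with hΦ
  have hΦc : ContDiffOn ℝ 1 Φ (paramDomain a) :=
    hΨ.comp (contDiff_inputData Γ c ω).contDiffOn hball
  have hΦu : ∀ x ∈ paramDomain a, ‖(Φ x).2‖ < 1 := fun x hx =>
    (norm_snd_le _).trans_lt (hsol _ (hball x hx)).1
  have hΦz : ∀ x ∈ paramDomain a, defect (inputData Γ c ω x, Φ x) = 0 := fun x hx =>
    (hsol _ (hball x hx)).2
  refine ⟨a, fun x => 2 * Real.sin (x.2.1 / 2) * (1 + (Φ x).2 0),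
    fun x => whiskerAction Γ c ω x.2.2 (Φ x).1, hapos, ?_, ?_, fun x hx => ?_,
    fun x hx => ?_, fun μ q φ n => ?_, fun x hx B p A' => ?_,
    fun x hx hx0 i j => ?_⟩
  · have h1 : ContDiffOn ℝ 1 (fun x => (Φ x).2 0) (paramDomain a) :=
      (BoundedContinuousFunction.evalCLM ℝ (0 : ℝ) : BC →L[ℝ] ℝ).contDiff.comp_contDiffOn
        (contDiff_snd.comp_contDiffOn hΦc)
    have h2 : ContDiff ℝ 1 fun x : Param => 2 * Real.sin (x.2.1 / 2) := by fun_prop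
    exact h2.contDiffOn.mul (contDiffOn_const.add h1)
  · refine contDiffOn_pi.2 fun i => ?_
    have h1 : ContDiffOn ℝ 1 (fun x => (Φ x).1) (paramDomain a) := contDiff_fst.comp_contDiffOn hΦc
    have h2 : ContDiff ℝ 1 density := by unfold density; fun_prop
    have h3 : ContDiff ℝ 1 fun x : Param => gradOrbit Γ c ω i x.2.2 :=
      (contDiff_gradOrbit Γ c ω i).comp (contDiff_snd.comp contDiff_snd)
    exact expIntegral.contDiff.comp_contDiffOn
      (((h2.comp_contDiffOn h1).mul h3.contDiffOn).const_smul (2 : ℝ))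
  · have h1 := Real.sin_pos_of_pos_of_lt_pi (x := x.2.1 / 2) (by linarith [(hq x hx).1])
      (by linarith [(hq x hx).2])
    have h2 := (abs_le.1 ((Φ x).2.abs_apply_le 0)).1
    have h3 : 0 < 1 + (Φ x).2 0 := by linarith [hΦu x hx]
    positivity
  · have h1 := Real.sin_le_one (x.2.1 / 2)
    have h2 := (abs_le.1 ((Φ x).2.abs_apply_le 0))
    have h3 : 0 < 1 + (Φ x).2 0 := by linarith [hΦu x hx]
    have h4 : 1 + (Φ x).2 0 ≤ 2 := by linarith [hΦu x hx]
    change 2 * Real.sin (x.2.1 / 2) * (1 + (Φ x).2 0) ≤ 4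
    nlinarith
  · funext i
    simp only [hΦ, inputData, polyOrbit_add_two_pi, whiskerAction, gradOrbit_add_two_pi]
  · have hmem := mem_stableWhisker_of_defect (B := B) (hq x hx).1 (hq x hx).2 (hΦu x hx) (hΦz x hx)
    constructor
    · intro h
      obtain ⟨d, u, h1, h2, h3, h4, h5⟩ := exists_defect_of_mem_stableWhisker h
        ((hcos x hx).le.trans (by linarith)) (by have := hG x hx; dsimp only; linarith)
      have h6 : (d, u) = Φ x := by
        refine huniq _ (hball x hx) _ ?_ h1
        rw [mem_ball_zero_iff]
        have h7 := hcos x hx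
        have h8 := hG x hx
        dsimp only at h2 h3
        exact max_lt (by change ‖d‖ < ε; linarith) (by change ‖u‖ < ε; linarith)
      rw [← h6]
      exact ⟨h4, h5⟩
    · rintro ⟨rfl, rfl⟩
      exact hmem
  -- Differentiating `defect = 0` along `φ_j` with `q` fixed leaves the initial value unchanged. The
  -- derivatives of `(d, u)` therefore solve the linearized equations with `d'(0) = 0`, as the
  -- Lagrangian identity requires; the Hessian term is symmetric by itself.
  · have hline : ∀ s : ℝ, ∀ j : Fin 2,
        ((x.1, x.2.1, x.2.2 + s • Pi.single j 1) : Param) ∈ paramDomain a := fun s j => hx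
    have hder : ∀ j : Fin 2, ∃ y : BC × BC,
        HasDerivAt (fun s : ℝ => Φ (x.1, x.2.1, x.2.2 + s • Pi.single j 1)) y 0 := fun j => by
      have h1 : DifferentiableAt ℝ (fun s : ℝ =>
          ((x.1, x.2.1, x.2.2 + s • Pi.single j 1) : Param)) 0 := by fun_prop
      have h2 : DifferentiableAt ℝ Φ (x.1, x.2.1, x.2.2 + (0 : ℝ) • Pi.single j 1) :=
        (hΦc.contDiffAt ((isOpen_paramDomain a).mem_nhds (hline 0 j))).differentiableAt
          (by norm_num)
      have h3 : DifferentiableAt ℝ (fun s : ℝ => Φ (x.1, x.2.1, x.2.2 + s • Pi.single j 1)) 0 :=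
        DifferentiableAt.comp (g := Φ) (0 : ℝ) h2 h1
      exact ⟨_, h3.hasDerivAt⟩
    choose y hy using hder
    have hx0' : ∀ j : Fin 2, ((x.1, x.2.1, x.2.2 + (0 : ℝ) • Pi.single j 1) : Param) = x :=
      fun j => by simp
    have hlin : ∀ j : Fin 2,
        (y j).1 = forwardOp (sourceD' (Φ x).1 (Φ x).2 (y j).1 (y j).2) ∧
        (y j).2 = -backwardOp (sourceU' (x.1 • polyOrbit Γ c ω x.2.2) (Φ x).1 (Φ x).2
          (x.1 • gradOrbit Γ c ω j x.2.2) (y j).1 (y j).2) := fun j => by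
      have h1 := (ContinuousLinearMap.fst ℝ BC BC).hasFDerivAt.comp_hasDerivAt (0 : ℝ) (hy j)
      have h2 := (ContinuousLinearMap.snd ℝ BC BC).hasFDerivAt.comp_hasDerivAt (0 : ℝ) (hy j)
      have h3 := hasDerivAt_defect (hasDerivAt_const (0 : ℝ) (Real.cos (x.2.1 / 2)))
        ((hasDerivAt_polyOrbit Γ c ω x.2.2 j 0).const_smul x.1) h1 h2
      have h4 : (fun s : ℝ => defect ((Real.cos (x.2.1 / 2),
          (x.1 • fun s : ℝ => polyOrbit Γ c ω (x.2.2 + s • Pi.single j 1)) s),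
          ((ContinuousLinearMap.fst ℝ BC BC ∘ fun s : ℝ =>
            Φ (x.1, x.2.1, x.2.2 + s • Pi.single j 1)) s,
          (ContinuousLinearMap.snd ℝ BC BC ∘ fun s : ℝ =>
            Φ (x.1, x.2.1, x.2.2 + s • Pi.single j 1)) s))) = fun _ => 0 :=
        funext fun s => hΦz _ (hline s j)
      rw [h4] at h3
      have h5 := h3.unique (hasDerivAt_const (0 : ℝ) (0 : BC × BC))
      rw [Prod.mk_eq_zero] at h5
      simp only [Function.comp_apply, zero_smul, add_zero, sub_zero, Pi.smul_apply,
        ContinuousLinearMap.coe_fst', ContinuousLinearMap.coe_snd'] at h5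
      exact ⟨sub_eq_zero.1 h5.1, add_eq_zero_iff_eq_neg.1 h5.2⟩
    have hval : ∀ i j : Fin 2,
        fderiv ℝ (fun φ => whiskerAction Γ c ω φ (Φ (x.1, x.2.1, φ)).1 i) x.2.2 (Pi.single j 1) =
        4 * expIntegral (slope (Φ x).1 * (y j).1 * gradOrbit Γ c ω i x.2.2) +
        2 * expIntegral (density (Φ x).1 * hessOrbit Γ c ω i j x.2.2) := fun i j => by
      have h1 := (ContinuousLinearMap.fst ℝ BC BC).hasFDerivAt.comp_hasDerivAt (0 : ℝ) (hy j)
      have h2 := hasDerivAt_whiskerAction Γ c ω x.2.2 i j h1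
      simp only [Function.comp_apply, hx0', ContinuousLinearMap.coe_fst'] at h2
      have hd : DifferentiableAt ℝ (fun φ => whiskerAction Γ c ω φ (Φ (x.1, x.2.1, φ)).1 i)
          x.2.2 := by
        have h3 : DifferentiableAt ℝ (fun φ : Fin 2 → ℝ => ((x.1, x.2.1, φ) : Param)) x.2.2 := by
          fun_prop
        have h4 : DifferentiableAt ℝ Φ (x.1, x.2.1, x.2.2) :=
          (hΦc.contDiffAt ((isOpen_paramDomain a).mem_nhds hx)).differentiableAt (by norm_num)
        have h5 : DifferentiableAt ℝ (fun φ => (Φ (x.1, x.2.1, φ)).1) x.2.2 :=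
          (DifferentiableAt.comp x.2.2 h4 h3).fst
        have h6 : Differentiable ℝ density := by unfold density; fun_prop
        have h7 : DifferentiableAt ℝ (fun φ => density (Φ (x.1, x.2.1, φ)).1) x.2.2 :=
          DifferentiableAt.comp x.2.2 (h6 _) h5
        have h8 := (contDiff_gradOrbit Γ c ω i (n := 1)).differentiable (by norm_num) x.2.2
        exact DifferentiableAt.comp x.2.2 expIntegral.differentiableAt
          ((h7.mul h8).const_smul (2 : ℝ))
      rw [← hd.lineDeriv_eq_fderiv]
      exact h2.deriv
    change fderiv ℝ (fun φ => whiskerAction Γ c ω φ (Φ (x.1, x.2.1, φ)).1 i) x.2.2 _ =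
      fderiv ℝ (fun φ => whiskerAction Γ c ω φ (Φ (x.1, x.2.1, φ)).1 j) x.2.2 _
    rw [hval, hval, hessOrbit_symm Γ c ω i j,
      expIntegral_slope_mul_symm hx0 (hlin j).1 (hlin j).2 (hlin i).1 (hlin i).2]

/-! ### Time reversal -/

/-- The reversing symmetry `(q, φ, p, A) ↦ (2π - q, -φ, p, A)`. -/
def reflect (z : Phase) : Phase := (2 * Real.pi - z.1, -z.2.1, z.2.2.1, z.2.2.2)

theorem reflect_reflect (z : Phase) : reflect (reflect z) = z := by
  simp [reflect]

theorem isometry_reflect : Isometry reflect := by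
  refine Isometry.of_dist_eq fun z z' => ?_
  simp only [reflect, Prod.dist_eq, dist_neg_neg, dist_sub_left]

theorem reflect_mem_torus {B : Fin 2 → ℝ} {z : Phase} (hz : z ∈ torus B) :
    reflect z ∈ torus B := by
  obtain ⟨n, φ, rfl⟩ := hz
  refine ⟨1 - n, -φ, ?_⟩
  simp only [reflect, Prod.mk.injEq, and_true]
  push_cast
  ring

theorem reflect_image_torus (B : Fin 2 → ℝ) : reflect '' torus B = torus B := by
  refine Subset.antisymm ?_ fun z hz => ⟨reflect z, reflect_mem_torus hz, reflect_reflect z⟩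
  rintro _ ⟨z, hz, rfl⟩
  exact reflect_mem_torus hz

theorem infDist_reflect (B : Fin 2 → ℝ) (z : Phase) :
    Metric.infDist (reflect z) (torus B) = Metric.infDist z (torus B) := by
  conv_lhs => rw [← reflect_image_torus B]
  exact Metric.infDist_image isometry_reflect

/-- Under the reflection `sin q` and `∂f` change sign while `cos q` and `f` do not; together with `t
↦ -t` this preserves the equations. -/
theorem isIntegralCurve_reflect {Γ : ℕ} {c : ℤ × ℤ → ℝ} {ω : Fin 2 → ℝ} {μ : ℝ} {γ : ℝ → Phase}
    (hγ : IsIntegralCurve γ fun _ => flowField Γ c ω μ) :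
    IsIntegralCurve (fun t => reflect (γ (-t))) fun _ => flowField Γ c ω μ := by
  intro t
  have h0 : HasDerivAt (fun t => γ (-t)) (-flowField Γ c ω μ (γ (-t))) t := by
    have h := (hγ (-t)).scomp t (hasDerivAt_neg t)
    rw [neg_one_smul] at h
    exact h
  have hq := (ContinuousLinearMap.fst ℝ ℝ ((Fin 2 → ℝ) × ℝ × (Fin 2 → ℝ))).hasFDerivAt.comp_hasDerivAt
    t h0
  have h1 := (ContinuousLinearMap.snd ℝ ℝ ((Fin 2 → ℝ) × ℝ × (Fin 2 → ℝ))).hasFDerivAt.comp_hasDerivAt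
    t h0
  have hφ := (ContinuousLinearMap.fst ℝ (Fin 2 → ℝ) (ℝ × (Fin 2 → ℝ))).hasFDerivAt.comp_hasDerivAt t h1
  have h2 := (ContinuousLinearMap.snd ℝ (Fin 2 → ℝ) (ℝ × (Fin 2 → ℝ))).hasFDerivAt.comp_hasDerivAt t h1
  refine ((hq.const_sub (2 * Real.pi)).prodMk (hφ.neg.prodMk h2)).congr_deriv ?_
  refine Prod.ext ?_ (Prod.ext ?_ (Prod.ext ?_ ?_))
  · simp [flowField, reflect]
  · simp [flowField, reflect]
  · simp [flowField, reflect, trigPoly_neg]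
  · funext i
    simp [flowField, reflect, gradPoly_neg]

theorem reflect_mem_stableWhisker {Γ : ℕ} {c : ℤ × ℤ → ℝ} {ω : Fin 2 → ℝ} {μ : ℝ} {B : Fin 2 → ℝ}
    {z : Phase} (hz : z ∈ unstableWhisker (hamiltonian (trigPoly Γ c) ω μ) B) :
    reflect z ∈ stableWhisker (hamiltonian (trigPoly Γ c) ω μ) B := by
  obtain ⟨γ, hγ, rfl, hlim, hpos⟩ := hz
  rw [hamiltonianField_eq] at hγ
  refine ⟨fun t => reflect (γ (-t)), ?_, by simp, ?_, fun t ht => ?_⟩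
  · rw [hamiltonianField_eq]
    exact isIntegralCurve_reflect hγ
  · simp_rw [infDist_reflect]
    exact hlim.comp tendsto_neg_atTop_atBot
  · obtain ⟨h1, h2, h3⟩ := hpos (-t) (by linarith)
    refine ⟨?_, ?_, h3⟩
    · change 0 < 2 * Real.pi - (γ (-t)).1
      linarith
    · change 2 * Real.pi - (γ (-t)).1 < 2 * Real.pi
      linarith

theorem reflect_mem_unstableWhisker {Γ : ℕ} {c : ℤ × ℤ → ℝ} {ω : Fin 2 → ℝ} {μ : ℝ}
    {B : Fin 2 → ℝ} {z : Phase} (hz : z ∈ stableWhisker (hamiltonian (trigPoly Γ c) ω μ) B) :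
    reflect z ∈ unstableWhisker (hamiltonian (trigPoly Γ c) ω μ) B := by
  obtain ⟨γ, hγ, rfl, hlim, hpos⟩ := hz
  rw [hamiltonianField_eq] at hγ
  refine ⟨fun t => reflect (γ (-t)), ?_, by simp, ?_, fun t ht => ?_⟩
  · rw [hamiltonianField_eq]
    exact isIntegralCurve_reflect hγ
  · simp_rw [infDist_reflect]
    exact hlim.comp tendsto_neg_atBot_atTop
  · obtain ⟨h1, h2, h3⟩ := hpos (-t) (by linarith)
    refine ⟨?_, ?_, h3⟩
    · change 0 < 2 * Real.pi - (γ (-t)).1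
      linarith
    · change 2 * Real.pi - (γ (-t)).1 < 2 * Real.pi
      linarith

theorem mem_unstableWhisker_iff {Γ : ℕ} {c : ℤ × ℤ → ℝ} {ω : Fin 2 → ℝ} {μ : ℝ} {B : Fin 2 → ℝ}
    {z : Phase} : z ∈ unstableWhisker (hamiltonian (trigPoly Γ c) ω μ) B ↔
      reflect z ∈ stableWhisker (hamiltonian (trigPoly Γ c) ω μ) B := by
  refine ⟨reflect_mem_stableWhisker, fun h => ?_⟩
  have := reflect_mem_unstableWhisker h
  rwa [reflect_reflect] at this

/-! ### Conservation of energy -/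

/-- In coordinates this is `{H, H}`, whose terms cancel in pairs. -/
theorem fderiv_hamiltonianField_eq_zero (H : Phase → ℝ) (z : Phase) :
    fderiv ℝ H z (hamiltonianField H z) = 0 := by
  set D := fderiv ℝ H z with hD
  have key : ∀ v : Phase, D v = v.1 * D (1, 0, 0, 0) + (v.2.1 0 * D (0, Pi.single 0 1, 0, 0) +
      v.2.1 1 * D (0, Pi.single 1 1, 0, 0)) + v.2.2.1 * D (0, 0, 1, 0) +
      (v.2.2.2 0 * D (0, 0, 0, Pi.single 0 1) + v.2.2.2 1 * D (0, 0, 0, Pi.single 1 1)) := by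
    intro v
    have hv : v = v.1 • ((1, 0, 0, 0) : Phase) + (v.2.1 0 • ((0, Pi.single 0 1, 0, 0) : Phase) +
        v.2.1 1 • ((0, Pi.single 1 1, 0, 0) : Phase)) + v.2.2.1 • ((0, 0, 1, 0) : Phase) +
        (v.2.2.2 0 • ((0, 0, 0, Pi.single 0 1) : Phase) +
          v.2.2.2 1 • ((0, 0, 0, Pi.single 1 1) : Phase)) := by
      refine Prod.ext ?_ (Prod.ext ?_ (Prod.ext ?_ ?_))
      · simp
      · funext i; fin_cases i <;> simp
      · simp
      · funext i; fin_cases i <;> simp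
    conv_lhs => rw [hv]
    simp only [map_add, map_smul, smul_eq_mul]
  rw [key]
  simp only [hamiltonianField, ← hD]
  ring

theorem hamiltonian_eq_of_isIntegralCurve {Γ : ℕ} {c : ℤ × ℤ → ℝ} {ω : Fin 2 → ℝ} {μ : ℝ}
    {γ : ℝ → Phase}
    (hγ : IsIntegralCurve γ fun _ => hamiltonianField (hamiltonian (trigPoly Γ c) ω μ)) (t s : ℝ) :
    hamiltonian (trigPoly Γ c) ω μ (γ t) = hamiltonian (trigPoly Γ c) ω μ (γ s) := by
  have h1 : ∀ t, HasDerivAt (fun t => hamiltonian (trigPoly Γ c) ω μ (γ t)) 0 t := fun t => by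
    have h2 := ((contDiff_hamiltonian Γ c ω μ (n := 1)).differentiable (by norm_num)
      (γ t)).hasFDerivAt.comp_hasDerivAt t (hγ t)
    rwa [fderiv_hamiltonianField_eq_zero] at h2
  exact is_const_of_deriv_eq_zero (fun t => (h1 t).differentiableAt) (fun t => (h1 t).deriv) t s

/-- Energy is constant along the motion, so it equals its limit. The value `f(φ(t))` need not
converge, but it is bounded and its factor `1 - cos q` tends to `0`. -/
theorem hamiltonian_eq_of_mem_stableWhisker {Γ : ℕ} {c : ℤ × ℤ → ℝ} {ω : Fin 2 → ℝ} {μ : ℝ}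
    {B : Fin 2 → ℝ} {z : Phase} (hz : z ∈ stableWhisker (hamiltonian (trigPoly Γ c) ω μ) B) :
    hamiltonian (trigPoly Γ c) ω μ z = ω 0 * B 0 + ω 1 * B 1 := by
  obtain ⟨γ, hγ, rfl, hlim, -⟩ := hz
  obtain ⟨C, hC, hf, -⟩ := exists_bound_trigPoly Γ c
  have hA : ∀ i, Tendsto (fun t => (γ t).2.2.2 i) atTop (𝓝 (B i)) := fun i => by
    rw [tendsto_iff_norm_sub_tendsto_zero]
    exact squeeze_zero (fun t => norm_nonneg _) (fun t => abs_action_sub_le_infDist (γ t) B i) hlim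
  have hp : Tendsto (fun t => (γ t).2.2.1) atTop (𝓝 0) :=
    squeeze_zero_norm (fun t => abs_momentum_le_infDist (γ t) B) hlim
  have hs : Tendsto (fun t => Real.sin ((γ t).1 / 2)) atTop (𝓝 0) :=
    squeeze_zero_norm (fun t => abs_sin_half_le_infDist (γ t) B) hlim
  have hcos : ∀ q : ℝ, 1 - Real.cos q = 2 * Real.sin (q / 2) ^ 2 := fun q => by
    have h2 : Real.cos q = 2 * Real.cos (q / 2) ^ 2 - 1 := by
      rw [← Real.cos_two_mul]; ring_nf
    rw [h2, Real.cos_sq']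
    ring
  have hc : Tendsto (fun t => 1 - Real.cos (γ t).1) atTop (𝓝 0) := by
    simp_rw [hcos]
    simpa using (hs.pow 2).const_mul 2
  have hcf : Tendsto (fun t => (1 - Real.cos (γ t).1) * trigPoly Γ c (γ t).2.1) atTop (𝓝 0) := by
    have h1 : Tendsto (fun t => (1 - Real.cos (γ t).1) * C) atTop (𝓝 0) := by
      simpa using hc.mul_const C
    refine squeeze_zero_norm (fun t => ?_) h1
    have h2 := Real.cos_le_one (γ t).1
    rw [Real.norm_eq_abs, abs_mul, abs_of_nonneg (by linarith)]
    gcongr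
    exact hf _
  have hH : Tendsto (fun t => hamiltonian (trigPoly Γ c) ω μ (γ t)) atTop
      (𝓝 (ω 0 * B 0 + ω 1 * B 1 + 0 ^ 2 / 2 - 0 + μ * 0)) := by
    refine (((((hA 0).const_mul (ω 0)).add ((hA 1).const_mul (ω 1))).add
      ((hp.pow 2).div_const 2)).sub hc |>.add (hcf.const_mul μ)).congr fun t => ?_
    simp only [hamiltonian]
    ring
  have hconst : (fun t => hamiltonian (trigPoly Γ c) ω μ (γ t)) =
      fun _ => hamiltonian (trigPoly Γ c) ω μ (γ 0) :=
    funext fun t => hamiltonian_eq_of_isIntegralCurve hγ t 0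
  rw [hconst] at hH
  have := tendsto_nhds_unique tendsto_const_nhds hH
  rw [this]
  ring

theorem hamiltonian_reflect (Γ : ℕ) (c : ℤ × ℤ → ℝ) (ω : Fin 2 → ℝ) (μ : ℝ) (z : Phase) :
    hamiltonian (trigPoly Γ c) ω μ (reflect z) = hamiltonian (trigPoly Γ c) ω μ z := by
  simp [hamiltonian, reflect, trigPoly_neg]

theorem hamiltonian_eq_of_mem_unstableWhisker {Γ : ℕ} {c : ℤ × ℤ → ℝ} {ω : Fin 2 → ℝ} {μ : ℝ}
    {B : Fin 2 → ℝ} {z : Phase} (hz : z ∈ unstableWhisker (hamiltonian (trigPoly Γ c) ω μ) B) :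
    hamiltonian (trigPoly Γ c) ω μ z = ω 0 * B 0 + ω 1 * B 1 := by
  rw [← hamiltonian_reflect]
  exact hamiltonian_eq_of_mem_stableWhisker (mem_unstableWhisker_iff.1 hz)

/-! ### Invariance of the whiskers -/

/-- Only forward times are kept: the branch conditions are imposed for `t ≥ 0`, so membership at
negative times is not guaranteed. -/
theorem apply_mem_stableWhisker {H : Phase → ℝ} {B : Fin 2 → ℝ} {z : Phase}
    (hz : z ∈ stableWhisker H B) : ∃ γ : ℝ → Phase, HasDerivAt γ (hamiltonianField H z) 0 ∧
      γ 0 = z ∧ ∀ t, 0 ≤ t → γ t ∈ stableWhisker H B := by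
  obtain ⟨γ, hγ, rfl, hlim, hpos⟩ := hz
  refine ⟨γ, hγ 0, rfl, fun t ht => ⟨fun s => γ (s + t), fun s => ?_, by simp, ?_, fun s hs => ?_⟩⟩
  · exact (hγ (s + t)).comp_add_const s t
  · exact hlim.comp (tendsto_atTop_add_const_right _ t tendsto_id)
  · exact hpos _ (by linarith)

theorem apply_mem_unstableWhisker {H : Phase → ℝ} {B : Fin 2 → ℝ} {z : Phase}
    (hz : z ∈ unstableWhisker H B) : ∃ γ : ℝ → Phase, HasDerivAt γ (hamiltonianField H z) 0 ∧
      γ 0 = z ∧ ∀ t, t ≤ 0 → γ t ∈ unstableWhisker H B := by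
  obtain ⟨γ, hγ, rfl, hlim, hpos⟩ := hz
  refine ⟨γ, hγ 0, rfl, fun t ht => ⟨fun s => γ (s + t), fun s => ?_, by simp, ?_, fun s hs => ?_⟩⟩
  · exact (hγ (s + t)).comp_add_const s t
  · exact hlim.comp (tendsto_atBot_add_const_right _ t tendsto_id)
  · exact hpos _ (by linarith)

/-! ### Graphs over the angles -/

/-- The angles `(q, φ)` of a point. -/
def angles : Phase →L[ℝ] ℝ × (Fin 2 → ℝ) :=
  (ContinuousLinearMap.fst ℝ ℝ ((Fin 2 → ℝ) × ℝ × (Fin 2 → ℝ))).prod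
    ((ContinuousLinearMap.fst ℝ (Fin 2 → ℝ) (ℝ × (Fin 2 → ℝ))).comp
      (ContinuousLinearMap.snd ℝ ℝ ((Fin 2 → ℝ) × ℝ × (Fin 2 → ℝ))))

/-- The momenta `(p, A)` of a point. -/
def momenta : Phase →L[ℝ] ℝ × (Fin 2 → ℝ) :=
  (ContinuousLinearMap.snd ℝ (Fin 2 → ℝ) (ℝ × (Fin 2 → ℝ))).comp
    (ContinuousLinearMap.snd ℝ ℝ ((Fin 2 → ℝ) × ℝ × (Fin 2 → ℝ)))

/-- The point with given angles and momenta. -/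
def join : (ℝ × (Fin 2 → ℝ)) × (ℝ × (Fin 2 → ℝ)) →L[ℝ] Phase :=
  ((ContinuousLinearMap.fst ℝ ℝ (Fin 2 → ℝ)).comp (ContinuousLinearMap.fst ℝ _ _)).prod
    (((ContinuousLinearMap.snd ℝ ℝ (Fin 2 → ℝ)).comp (ContinuousLinearMap.fst ℝ _ _)).prod
      (ContinuousLinearMap.snd ℝ _ _))

@[simp] theorem angles_apply (z : Phase) : angles z = (z.1, z.2.1) := rfl

@[simp] theorem momenta_apply (z : Phase) : momenta z = z.2.2 := rfl

@[simp] theorem join_apply (x y : ℝ × (Fin 2 → ℝ)) : join (x, y) = (x.1, x.2, y) := rfl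

theorem join_angles_momenta (z : Phase) : join (angles z, momenta z) = z := rfl

/-- The linear map whose kernel is the graph of `L`. -/
def graphDefect (L : (ℝ × (Fin 2 → ℝ)) →L[ℝ] ℝ × (Fin 2 → ℝ)) :
    Phase →L[ℝ] ℝ × (Fin 2 → ℝ) := momenta - L.comp angles

/-- Over the angles in `V`, the set `S` is the graph of `g`. -/
def IsGraphOver (S : Set Phase) (V : Set (ℝ × (Fin 2 → ℝ)))
    (g : ℝ × (Fin 2 → ℝ) → ℝ × (Fin 2 → ℝ)) : Prop :=
  ∀ z : Phase, angles z ∈ V → (z ∈ S ↔ momenta z = g (angles z))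

theorem IsGraphOver.hasTangentSpaceAt {S : Set Phase} {V : Set (ℝ × (Fin 2 → ℝ))}
    {g : ℝ × (Fin 2 → ℝ) → ℝ × (Fin 2 → ℝ)} (hS : IsGraphOver S V g) (hV : IsOpen V)
    (hg : ContDiffOn ℝ 1 g V) {z : Phase} (hz : angles z ∈ V) :
    HasTangentSpaceAt 3 S z (LinearMap.ker (graphDefect (fderiv ℝ g (angles z)) :
      Phase →ₗ[ℝ] ℝ × (Fin 2 → ℝ))) := by
  have hdim : Module.finrank ℝ (ℝ × (Fin 2 → ℝ)) = Module.finrank ℝ (Fin 3 → ℝ) := by simp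
  set e := ContinuousLinearEquiv.ofFinrankEq hdim
  have hd : HasFDerivAt (fun z => e (momenta z - g (angles z)))
      ((e : ℝ × (Fin 2 → ℝ) →L[ℝ] (Fin 3 → ℝ)).comp (graphDefect (fderiv ℝ g (angles z)))) z := by
    have h1 : HasFDerivAt g (fderiv ℝ g (angles z)) (angles z) :=
      ((hg.contDiffAt (hV.mem_nhds hz)).differentiableAt (by norm_num)).hasFDerivAt
    have h2 : HasFDerivAt (fun z => g (angles z)) ((fderiv ℝ g (angles z)).comp angles) z :=
      h1.comp z angles.hasFDerivAt
    exact e.hasFDerivAt.comp z (momenta.hasFDerivAt.sub h2)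
  refine ⟨angles ⁻¹' V, fun z => e (momenta z - g (angles z)), hV.preimage angles.continuous, hz,
    ?_, ?_, ?_, ?_⟩
  · exact e.contDiff.comp_contDiffOn (momenta.contDiff.contDiffOn.sub
      (hg.comp angles.contDiff.contDiffOn fun _ h => h))
  · ext z'
    simp only [mem_inter_iff, mem_preimage, mem_ofPred_eq, map_eq_zero_iff e e.injective,
      sub_eq_zero]
    constructor
    · rintro ⟨h1, h2⟩
      exact ⟨h2, (hS z' h2).1 h1⟩
    · rintro ⟨h1, h2⟩
      exact ⟨(hS z' h1).2 h2, h1⟩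
  · rw [hd.fderiv]
    intro w
    refine ⟨join (0, e.symm w), ?_⟩
    simp only [graphDefect, ContinuousLinearMap.comp_apply, sub_apply,
      join_apply, angles_apply, momenta_apply, Prod.fst_zero, Prod.snd_zero]
    rw [← Prod.zero_eq_mk, map_zero, sub_zero]
    exact e.apply_symm_apply w
  · rw [hd.fderiv]
    ext v
    simp

/-- The curve need only stay in `S` on one side of time `0`: one-sided derivatives are unique, and
this already forces the velocity to be tangent to the graph. -/
theorem IsGraphOver.fderiv_apply_eq {S : Set Phase} {V : Set (ℝ × (Fin 2 → ℝ))}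
    {g : ℝ × (Fin 2 → ℝ) → ℝ × (Fin 2 → ℝ)} (hS : IsGraphOver S V g) (hV : IsOpen V)
    (hg : ContDiffOn ℝ 1 g V) {z v : Phase} (hz : angles z ∈ V) {γ : ℝ → Phase} {J : Set ℝ}
    (hJ : UniqueDiffWithinAt ℝ J 0) (h0 : (0 : ℝ) ∈ J) (hγ : HasDerivAt γ v 0) (hγ0 : γ 0 = z)
    (hmem : ∀ t ∈ J, γ t ∈ S) :
    fderiv ℝ g (angles z) (angles v) = momenta v := by
  subst hγ0
  have h1 : HasFDerivAt g (fderiv ℝ g (angles (γ 0))) (angles (γ 0)) :=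
    ((hg.contDiffAt (hV.mem_nhds hz)).differentiableAt (by norm_num)).hasFDerivAt
  have h2 : HasDerivAt (fun t => angles (γ t)) (angles v) 0 :=
    angles.hasFDerivAt.comp_hasDerivAt 0 hγ
  have h3 : HasDerivAt (fun t => momenta (γ t)) (momenta v) 0 :=
    momenta.hasFDerivAt.comp_hasDerivAt 0 hγ
  have h4 : HasDerivAt (fun t => g (angles (γ t))) (fderiv ℝ g (angles (γ 0)) (angles v)) 0 :=
    h1.comp_hasDerivAt (0 : ℝ) h2
  have hev : ∀ᶠ t in 𝓝[J] 0, momenta (γ t) = g (angles (γ t)) := by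
    filter_upwards [self_mem_nhdsWithin,
      mem_nhdsWithin_of_mem_nhds (h2.continuousAt.preimage_mem_nhds (hV.mem_nhds hz))] with t ht ht'
    exact (hS _ ht').1 (hmem t ht)
  have h5 : HasDerivWithinAt (fun t => momenta (γ t))
      (fderiv ℝ g (angles (γ 0)) (angles v)) J 0 :=
    h4.hasDerivWithinAt.congr_of_eventuallyEq hev ((hS _ hz).1 (hmem 0 h0))
  exact hJ.eq_deriv _ h5 h3.hasDerivWithinAt

theorem fderiv_join_eq_zero {H : Phase → ℝ} {V : Set (ℝ × (Fin 2 → ℝ))}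
    {g : ℝ × (Fin 2 → ℝ) → ℝ × (Fin 2 → ℝ)} {E : ℝ} (hV : IsOpen V) (hg : ContDiffOn ℝ 1 g V)
    (hH : Differentiable ℝ H) (hE : ∀ x ∈ V, H (join (x, g x)) = E) {x : ℝ × (Fin 2 → ℝ)}
    (hx : x ∈ V) (x' : ℝ × (Fin 2 → ℝ)) :
    fderiv ℝ H (join (x, g x)) (join (x', fderiv ℝ g x x')) = 0 := by
  have h1 : HasFDerivAt g (fderiv ℝ g x) x :=
    ((hg.contDiffAt (hV.mem_nhds hx)).differentiableAt (by norm_num)).hasFDerivAt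
  have h2 := (hH (join (x, g x))).hasFDerivAt.comp x
    (join.hasFDerivAt.comp x ((hasFDerivAt_id x).prodMk h1))
  have h3 : HasFDerivAt (H ∘ (join ∘ fun x => (id x, g x)))
      (0 : ℝ × (Fin 2 → ℝ) →L[ℝ] ℝ) x := by
    refine (hasFDerivAt_const E x).congr_of_eventuallyEq ?_
    filter_upwards [hV.mem_nhds hx] with y hy using hE y hy
  have h4 := DFunLike.congr_fun (h2.unique h3) x'
  exact h4

/-- Given `v` in the kernel of `ℓ`, distribute its angles between the two graphs so that the actions
match; surjectivity of the difference of slopes allows this. The remainder is a multiple of `∂_p`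
killed by `ℓ`, hence zero. -/
theorem ker_graphDefect_sup_ker {ℓ : Phase →L[ℝ] ℝ}
    {L L' : (ℝ × (Fin 2 → ℝ)) →L[ℝ] ℝ × (Fin 2 → ℝ)}
    (hL : ∀ x, ℓ (join (x, L x)) = 0) (hL' : ∀ x, ℓ (join (x, L' x)) = 0)
    (hp : ℓ (0, 0, 1, 0) ≠ 0) (hs : ∀ s, ∃ x, (L' x).2 - (L x).2 = s) :
    LinearMap.ker (graphDefect L : Phase →ₗ[ℝ] ℝ × (Fin 2 → ℝ)) ⊔
      LinearMap.ker (graphDefect L' : Phase →ₗ[ℝ] ℝ × (Fin 2 → ℝ)) =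
      LinearMap.ker (ℓ : Phase →ₗ[ℝ] ℝ) := by
  have hker : ∀ (L : (ℝ × (Fin 2 → ℝ)) →L[ℝ] ℝ × (Fin 2 → ℝ)) (v : Phase),
      v ∈ LinearMap.ker (graphDefect L : Phase →ₗ[ℝ] ℝ × (Fin 2 → ℝ)) ↔
        momenta v = L (angles v) := fun L v => by
    rw [LinearMap.mem_ker]
    exact sub_eq_zero
  have hle : ∀ L : (ℝ × (Fin 2 → ℝ)) →L[ℝ] ℝ × (Fin 2 → ℝ), (∀ x, ℓ (join (x, L x)) = 0) →
      LinearMap.ker (graphDefect L : Phase →ₗ[ℝ] ℝ × (Fin 2 → ℝ)) ≤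
        LinearMap.ker (ℓ : Phase →ₗ[ℝ] ℝ) := fun L hL v hv => by
    have h1 := hL (angles v)
    rw [← (hker L v).1 hv, join_angles_momenta] at h1
    exact h1
  refine le_antisymm (sup_le (hle L hL) (hle L' hL')) fun v hv => ?_
  obtain ⟨x, hx⟩ := hs ((momenta v).2 - (L (angles v)).2)
  have hv0 : ℓ v = 0 := hv
  set t := join (angles v - x, L (angles v - x)) with ht
  set t' := join (x, L' x) with ht'
  have hdiff : v - t - t' = (v - t - t').2.2.1 • ((0, 0, 1, 0) : Phase) := by
    refine Prod.ext ?_ (Prod.ext ?_ (Prod.ext ?_ ?_))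
    · simp [ht, ht']
    · simp [ht, ht']
    · simp
    · have h2 : v.2.2.2 - (L (angles v)).2 = (L' x).2 - (L x).2 := hx.symm
      simp only [ht, ht', map_sub, join_apply, Prod.snd_sub, Prod.smul_snd, smul_zero]
      rw [sub_sub_eq_add_sub, ← sub_eq_zero.2 h2]
      abel
  have hzero : ℓ (v - t - t') = 0 := by
    rw [map_sub, map_sub, hv0, ht, ht', hL, hL']
    simp
  have hcomp : (v - t - t').2.2.1 = 0 := by
    rw [hdiff, map_smul, smul_eq_mul] at hzero
    exact (mul_eq_zero.1 hzero).resolve_right hp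
  rw [hcomp, zero_smul] at hdiff
  have hsum : t + t' = v := by rw [sub_sub, sub_eq_zero] at hdiff; exact hdiff.symm
  rw [← hsum]
  exact Submodule.add_mem_sup ((hker L t).2 rfl) ((hker L' t').2 rfl)

/-! ### The two whiskers as graphs -/

/-- The action of the time reversal on the parameters. -/
def reflectParam (x : Param) : Param := (x.1, 2 * Real.pi - x.2.1, -x.2.2)

/-- The difference of the actions of the two graphs. -/
def actionGap (A : Param → Fin 2 → ℝ) (x : Param) : Fin 2 → ℝ := A x - A (reflectParam x)

/-- The graph map of a whisker of `T(B)` for the parameter `μ`. -/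
def graphMap (P : Param → ℝ) (A : Param → Fin 2 → ℝ) (μ : ℝ) (B : Fin 2 → ℝ)
    (x : ℝ × (Fin 2 → ℝ)) : ℝ × (Fin 2 → ℝ) := (P (μ, x), B + μ • A (μ, x))

theorem contDiff_reflectParam : ContDiff ℝ 1 reflectParam := by
  unfold reflectParam
  fun_prop

theorem reflectParam_mem {a : ℝ} {x : Param} (hx : x ∈ paramDomain a) :
    reflectParam x ∈ paramDomain a := by
  refine ⟨hx.1, ?_⟩
  have h : 2 * Real.pi - x.2.1 - Real.pi = -(x.2.1 - Real.pi) := by ring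
  change |2 * Real.pi - x.2.1 - Real.pi| < a
  rw [h, abs_neg]
  exact hx.2

/-- The angles over which the whiskers are graphs. -/
def angleDomain (a : ℝ) : Set (ℝ × (Fin 2 → ℝ)) := {x | |x.1 - Real.pi| < a}

theorem isOpen_angleDomain (a : ℝ) : IsOpen (angleDomain a) :=
  isOpen_lt (by fun_prop) continuous_const

/-! ### Regularity and symmetry of the two graphs and of their gap. -/

section Graph

variable {Γ : ℕ} {c : ℤ × ℤ → ℝ} {ω : Fin 2 → ℝ} {a : ℝ} {P : Param → ℝ} {A : Param → Fin 2 → ℝ}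

theorem contDiffOn_graphMap {μ : ℝ} (hμ : |μ| < a) (hP : ContDiffOn ℝ 1 P (paramDomain a))
    (hA : ContDiffOn ℝ 1 A (paramDomain a)) (B : Fin 2 → ℝ) :
    ContDiffOn ℝ 1 (graphMap P A μ B) (angleDomain a) := by
  have h1 : ContDiff ℝ 1 fun x : ℝ × (Fin 2 → ℝ) => ((μ, x) : Param) := by fun_prop
  have h2 : MapsTo (fun x : ℝ × (Fin 2 → ℝ) => ((μ, x) : Param)) (angleDomain a)
      (paramDomain a) := fun x hx => ⟨hμ, hx⟩
  exact (hP.comp h1.contDiffOn h2).prodMk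
    (contDiffOn_const.add ((hA.comp h1.contDiffOn h2).const_smul μ))

theorem fderiv_graphMap_snd {μ : ℝ} (hμ : |μ| < a) (hP : ContDiffOn ℝ 1 P (paramDomain a))
    (hA : ContDiffOn ℝ 1 A (paramDomain a)) (B : Fin 2 → ℝ) {x : ℝ × (Fin 2 → ℝ)}
    (hx : x ∈ angleDomain a) (x' : ℝ × (Fin 2 → ℝ)) :
    (fderiv ℝ (graphMap P A μ B) x x').2 = μ • fderiv ℝ A (μ, x) (0, x') := by
  have h1 : HasFDerivAt (fun x : ℝ × (Fin 2 → ℝ) => ((μ, x) : Param))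
      (ContinuousLinearMap.inr ℝ ℝ (ℝ × (Fin 2 → ℝ))) x := hasFDerivAt_prodMk_right μ x
  have h2 : HasFDerivAt A (fderiv ℝ A (μ, x)) (μ, x) :=
    ((hA.contDiffAt ((isOpen_paramDomain a).mem_nhds (show (μ, x) ∈ _ from ⟨hμ, hx⟩))).differentiableAt
      (by norm_num)).hasFDerivAt
  have h3 : HasFDerivAt (graphMap P A μ B) (fderiv ℝ (graphMap P A μ B) x) x :=
    (((contDiffOn_graphMap hμ hP hA B).contDiffAt ((isOpen_angleDomain a).mem_nhds
      hx)).differentiableAt (by norm_num)).hasFDerivAt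
  have h4 : HasFDerivAt (fun x => B + μ • A (μ, x))
      (μ • (fderiv ℝ A (μ, x)).comp (ContinuousLinearMap.inr ℝ ℝ (ℝ × (Fin 2 → ℝ)))) x :=
    ((h2.comp x h1).const_smul μ).const_add B
  have h5 := (ContinuousLinearMap.snd ℝ ℝ (Fin 2 → ℝ)).hasFDerivAt.comp x h3
  exact DFunLike.congr_fun (h5.unique h4) x'

namespace IsStableGraph

theorem contDiffOn_unstableMomentum (h : IsStableGraph Γ c ω a P A) :
    ContDiffOn ℝ 1 (fun x => P (reflectParam x)) (paramDomain a) :=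
  h.contDiffOn_momentum.comp contDiff_reflectParam.contDiffOn fun _ => reflectParam_mem

theorem contDiffOn_unstableAction (h : IsStableGraph Γ c ω a P A) :
    ContDiffOn ℝ 1 (fun x => A (reflectParam x)) (paramDomain a) :=
  h.contDiffOn_action.comp contDiff_reflectParam.contDiffOn fun _ => reflectParam_mem

theorem contDiffOn_actionGap (h : IsStableGraph Γ c ω a P A) :
    ContDiffOn ℝ 1 (actionGap A) (paramDomain a) :=
  h.contDiffOn_action.sub h.contDiffOn_unstableAction

theorem mem_unstableWhisker_iff (h : IsStableGraph Γ c ω a P A) {x : Param}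
    (hx : x ∈ paramDomain a) (B : Fin 2 → ℝ) (p : ℝ) (A' : Fin 2 → ℝ) :
    ((x.2.1, x.2.2, p, A') : Phase) ∈ unstableWhisker (hamiltonian (trigPoly Γ c) ω x.1) B ↔
      p = P (reflectParam x) ∧ A' = B + x.1 • A (reflectParam x) := by
  rw [Isochronous.mem_unstableWhisker_iff]
  exact h.mem_iff (reflectParam x) (reflectParam_mem hx) B p A'

theorem isGraphOver_stable (h : IsStableGraph Γ c ω a P A) {μ : ℝ} (hμ : |μ| < a)
    (B : Fin 2 → ℝ) : IsGraphOver (stableWhisker (hamiltonian (trigPoly Γ c) ω μ) B)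
      (angleDomain a) (graphMap P A μ B) := fun z hz =>
  (h.mem_iff (μ, angles z) ⟨hμ, hz⟩ B z.2.2.1 z.2.2.2).trans
    (Prod.ext_iff (x := momenta z) (y := graphMap P A μ B (angles z))).symm

theorem isGraphOver_unstable (h : IsStableGraph Γ c ω a P A) {μ : ℝ} (hμ : |μ| < a)
    (B : Fin 2 → ℝ) : IsGraphOver (unstableWhisker (hamiltonian (trigPoly Γ c) ω μ) B)
      (angleDomain a)
      (graphMap (fun x => P (reflectParam x)) (fun x => A (reflectParam x)) μ B) := fun z hz =>
  (h.mem_unstableWhisker_iff (x := (μ, angles z)) ⟨hμ, hz⟩ B z.2.2.1 z.2.2.2).trans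
    (Prod.ext_iff (x := momenta z) (y := graphMap (fun x => P (reflectParam x))
      (fun x => A (reflectParam x)) μ B (angles z))).symm

end IsStableGraph

theorem IsGraphOver.graphMomenta_eq {S : Set Phase} {V : Set (ℝ × (Fin 2 → ℝ))}
    {g : ℝ × (Fin 2 → ℝ) → ℝ × (Fin 2 → ℝ)} (hS : IsGraphOver S V g) {q : ℝ} {φ : Fin 2 → ℝ}
    (hx : (q, φ) ∈ V) : graphMomenta S q φ = g (q, φ) := by
  have h1 : (q, φ, (g (q, φ)).1, (g (q, φ)).2) ∈ S := (hS _ hx).2 rfl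
  have h2 : (q, φ, (graphMomenta S q φ).1, (graphMomenta S q φ).2) ∈ S :=
    Classical.epsilon_spec (p := fun y : ℝ × (Fin 2 → ℝ) => (q, φ, y.1, y.2) ∈ S) ⟨_, h1⟩
  exact (hS _ hx).1 h2

namespace IsStableGraph

theorem deltaA_eq (h : IsStableGraph Γ c ω a P A) {μ q : ℝ} {φ : Fin 2 → ℝ} (hμ0 : μ ≠ 0)
    (hx : ((μ, q, φ) : Param) ∈ paramDomain a) :
    ΔA (trigPoly Γ c) ω μ q φ = actionGap A (μ, q, φ) := by
  have hq : (q, φ) ∈ angleDomain a := hx.2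
  unfold ΔA AS AU actionGap
  rw [(h.isGraphOver_stable hx.1 0).graphMomenta_eq hq,
    (h.isGraphOver_unstable hx.1 0).graphMomenta_eq hq]
  simp only [graphMap, zero_add]
  rw [inv_smul_smul₀ hμ0, inv_smul_smul₀ hμ0]

theorem unstablePoint_eq (h : IsStableGraph Γ c ω a P A) {μ q : ℝ} {φ : Fin 2 → ℝ} (hμ0 : μ ≠ 0)
    (hx : ((μ, q, φ) : Param) ∈ paramDomain a) (B : Fin 2 → ℝ) :
    unstablePoint (trigPoly Γ c) ω μ B q φ = join ((q, φ),
      graphMap (fun x => P (reflectParam x)) (fun x => A (reflectParam x)) μ B (q, φ)) := by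
  have hq : (q, φ) ∈ angleDomain a := hx.2
  unfold unstablePoint pU AU
  rw [(h.isGraphOver_unstable hx.1 0).graphMomenta_eq hq]
  simp only [graphMap, zero_add, join_apply]
  rw [inv_smul_smul₀ hμ0, mul_inv_cancel_left₀ hμ0, add_sub_cancel]

theorem actionGap_periodic (h : IsStableGraph Γ c ω a P A) (μ q : ℝ) (φ : Fin 2 → ℝ)
    (n : Fin 2 → ℤ) :
    actionGap A (μ, q, φ + fun i => 2 * Real.pi * n i) = actionGap A (μ, q, φ) := by
  have h1 : -(φ + fun i => 2 * Real.pi * (n i : ℝ)) =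
      -φ + fun i => 2 * Real.pi * ((-n) i : ℤ) := by
    funext i
    simp
    ring
  unfold actionGap reflectParam
  rw [h.action_periodic, h1, h.action_periodic]

/-- The sign from `φ ↦ -φ` cancels the sign of the difference, so the derivative of the gap is a sum
of two blocks, each symmetric because its whisker is Lagrangian. -/
theorem fderiv_actionGap_symm (h : IsStableGraph Γ c ω a P A) {x : Param}
    (hx : x ∈ paramDomain a) (hx0 : x.1 ≠ 0) (i j : Fin 2) :
    fderiv ℝ (actionGap A) x (0, 0, Pi.single j 1) i =
      fderiv ℝ (actionGap A) x (0, 0, Pi.single i 1) j := by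
  have key : ∀ x ∈ paramDomain a, ∀ i j,
      fderiv ℝ A x (0, 0, Pi.single j 1) i =
        fderiv ℝ (fun φ => A (x.1, x.2.1, φ) i) x.2.2 (Pi.single j 1) := fun x hx i j => by
    have h1 : HasFDerivAt A (fderiv ℝ A x) x :=
      ((h.contDiffOn_action.contDiffAt ((isOpen_paramDomain a).mem_nhds hx)).differentiableAt
        (by norm_num)).hasFDerivAt
    have h2 : HasFDerivAt (fun φ : Fin 2 → ℝ => ((x.1, x.2.1, φ) : Param))
        ((ContinuousLinearMap.inr ℝ ℝ (ℝ × (Fin 2 → ℝ))).comp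
          (ContinuousLinearMap.inr ℝ ℝ (Fin 2 → ℝ))) x.2.2 :=
      (hasFDerivAt_prodMk_right x.1 (x.2.1, x.2.2)).comp x.2.2
        (hasFDerivAt_prodMk_right x.2.1 x.2.2)
    have h3 := (ContinuousLinearMap.proj (R := ℝ) (φ := fun _ : Fin 2 => ℝ) i).hasFDerivAt.comp
      x.2.2 (h1.comp x.2.2 h2)
    have h4 : fderiv ℝ (fun φ => A (x.1, x.2.1, φ) i) x.2.2 = _ := h3.fderiv
    rw [h4]
    rfl
  have hsub : ∀ i j, fderiv ℝ (actionGap A) x (0, 0, Pi.single j 1) i =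
      fderiv ℝ A x (0, 0, Pi.single j 1) i +
        fderiv ℝ A (reflectParam x) (0, 0, Pi.single j 1) i := fun i j => by
    have h1 : HasFDerivAt A (fderiv ℝ A x) x :=
      ((h.contDiffOn_action.contDiffAt ((isOpen_paramDomain a).mem_nhds hx)).differentiableAt
        (by norm_num)).hasFDerivAt
    have h2 : HasFDerivAt A (fderiv ℝ A (reflectParam x)) (reflectParam x) :=
      ((h.contDiffOn_action.contDiffAt ((isOpen_paramDomain a).mem_nhds
        (reflectParam_mem hx))).differentiableAt (by norm_num)).hasFDerivAt
    have h3 : HasDerivAt (fun s : ℝ => x + s • ((0, 0, Pi.single j 1) : Param))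
        (0, 0, Pi.single j 1) 0 := by
      simpa using ((hasDerivAt_id (0 : ℝ)).smul_const ((0, 0, Pi.single j 1) : Param)).const_add x
    have h4 : HasDerivAt (fun s : ℝ => reflectParam (x + s • ((0, 0, Pi.single j 1) : Param)))
        (-(0, 0, Pi.single j 1)) 0 := by
      have h5 : (fun s : ℝ => reflectParam (x + s • ((0, 0, Pi.single j 1) : Param))) =
          fun s : ℝ => reflectParam x + s • (-(0, 0, Pi.single j 1) : Param) := by
        funext s
        refine Prod.ext ?_ (Prod.ext ?_ ?_)
        · simp [reflectParam]
        · simp [reflectParam]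
        · simp [reflectParam, add_comm]
      rw [h5]
      simpa using ((hasDerivAt_id (0 : ℝ)).smul_const
        (-(0, 0, Pi.single j 1) : Param)).const_add (reflectParam x)
    have hx0 : x + (0 : ℝ) • ((0, 0, Pi.single j 1) : Param) = x := by simp
    have h6 : HasDerivAt (fun s : ℝ => actionGap A (x + s • ((0, 0, Pi.single j 1) : Param)))
        (fderiv ℝ A x (0, 0, Pi.single j 1) -
          fderiv ℝ A (reflectParam x) (-(0, 0, Pi.single j 1))) 0 := by
      refine HasDerivAt.sub ?_ ?_
      · exact HasFDerivAt.comp_hasDerivAt (l := A) (0 : ℝ) (by rw [hx0]; exact h1) h3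
      · exact HasFDerivAt.comp_hasDerivAt (l := A) (0 : ℝ) (by rw [hx0]; exact h2) h4
    have h7 : HasFDerivAt (actionGap A) (fderiv ℝ (actionGap A) x) x :=
      ((h.contDiffOn_actionGap.contDiffAt ((isOpen_paramDomain a).mem_nhds hx)).differentiableAt
        (by norm_num)).hasFDerivAt
    have h8 : HasDerivAt (fun s : ℝ => actionGap A (x + s • ((0, 0, Pi.single j 1) : Param)))
        (fderiv ℝ (actionGap A) x (0, 0, Pi.single j 1)) 0 :=
      HasFDerivAt.comp_hasDerivAt (l := actionGap A) (0 : ℝ) (by rw [hx0]; exact h7) h3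
    rw [h8.unique h6, map_neg, sub_neg_eq_add]
    rfl
  rw [hsub, hsub, key x hx, key x hx, key _ (reflectParam_mem hx), key _ (reflectParam_mem hx),
    h.symm x hx hx0, h.symm _ (reflectParam_mem hx) hx0]

theorem Mse_apply (h : IsStableGraph Γ c ω a P A) {μ q : ℝ} {φ : Fin 2 → ℝ} (hμ0 : μ ≠ 0)
    (hx : ((μ, q, φ) : Param) ∈ paramDomain a) (i j : Fin 2) :
    Mse (trigPoly Γ c) ω μ q φ i j =
      fderiv ℝ (actionGap A) (μ, q, φ) (0, 0, Pi.single j 1) i := by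
  have h1 : HasFDerivAt (actionGap A) (fderiv ℝ (actionGap A) (μ, q, φ)) (μ, q, φ) :=
    ((h.contDiffOn_actionGap.contDiffAt ((isOpen_paramDomain a).mem_nhds hx)).differentiableAt
      (by norm_num)).hasFDerivAt
  have h2 : HasFDerivAt (fun φ : Fin 2 → ℝ => ((μ, q, φ) : Param))
      ((ContinuousLinearMap.inr ℝ ℝ (ℝ × (Fin 2 → ℝ))).comp
        (ContinuousLinearMap.inr ℝ ℝ (Fin 2 → ℝ))) φ :=
    (hasFDerivAt_prodMk_right μ (q, φ)).comp φ (hasFDerivAt_prodMk_right q φ)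
  have h3 := (ContinuousLinearMap.proj (R := ℝ) (φ := fun _ : Fin 2 => ℝ) i).hasFDerivAt.comp
    φ (h1.comp φ h2)
  have h4 : (fun φ => ΔA (trigPoly Γ c) ω μ q φ i) = fun φ => actionGap A (μ, q, φ) i :=
    funext fun φ' => by rw [h.deltaA_eq (φ := φ') hμ0 hx]
  have h5 : fderiv ℝ (fun φ => actionGap A (μ, q, φ) i) φ = _ := h3.fderiv
  rw [Mse, Matrix.of_apply, h4, h5]
  rfl

end IsStableGraph

end Graph

/-! ### Heteroclinic points -/

namespace IsStableGraph

variable {Γ : ℕ} {c : ℤ × ℤ → ℝ} {ω : Fin 2 → ℝ} {a : ℝ} {P : Param → ℝ} {A : Param → Fin 2 → ℝ}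
  {μ q δ : ℝ} {φ : Fin 2 → ℝ}

/-- Both points have the same angles, the same actions and, as `ω · ω^⊥ = 0`, the same energy; so
the values of `p²` agree, and both `p` are positive. -/
theorem momentum_eq_of_actionGap (h : IsStableGraph Γ c ω a P A)
    (hx : ((μ, q, φ) : Param) ∈ paramDomain a)
    (hgap : μ • actionGap A (μ, q, φ) = -(δ • perp ω)) :
    P (μ, q, φ) = P (reflectParam (μ, q, φ)) := by
  have hs := hamiltonian_eq_of_mem_stableWhisker
    ((h.mem_iff (μ, q, φ) hx (δ • perp ω) _ _).2 ⟨rfl, rfl⟩)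
  have hu := hamiltonian_eq_of_mem_unstableWhisker
    ((h.mem_unstableWhisker_iff hx 0 _ _).2 ⟨rfl, rfl⟩)
  have hps := h.momentum_pos _ hx
  have hpu := h.momentum_pos _ (reflectParam_mem hx)
  have h0 := congr_fun hgap 0
  have h1 := congr_fun hgap 1
  simp only [actionGap, perp, Pi.smul_apply, Pi.sub_apply, Pi.neg_apply, smul_eq_mul,
    Matrix.cons_val_zero, Matrix.cons_val_one] at h0 h1
  simp only [hamiltonian, perp, Pi.add_apply, Pi.smul_apply, smul_eq_mul, Matrix.cons_val_zero,
    Matrix.cons_val_one, Pi.zero_apply] at hs hu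
  have hsq : P (μ, q, φ) ^ 2 = P (reflectParam (μ, q, φ)) ^ 2 := by
    linear_combination 2 * hs - 2 * hu - 2 * ω 0 * h0 - 2 * ω 1 * h1
  exact (sq_eq_sq₀ hps.le hpu.le).1 hsq

theorem graphMap_eq_of_actionGap (h : IsStableGraph Γ c ω a P A)
    (hx : ((μ, q, φ) : Param) ∈ paramDomain a)
    (hgap : μ • actionGap A (μ, q, φ) = -(δ • perp ω)) (B : Fin 2 → ℝ) :
    graphMap P A μ (B + δ • perp ω) (q, φ) =
      graphMap (fun x => P (reflectParam x)) (fun x => A (reflectParam x)) μ B (q, φ) := by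
  refine Prod.ext (h.momentum_eq_of_actionGap hx hgap) ?_
  change B + δ • perp ω + μ • A (μ, q, φ) = B + μ • A (reflectParam (μ, q, φ))
  rw [actionGap, smul_sub, sub_eq_iff_eq_add] at hgap
  rw [hgap]
  abel

theorem fderiv_actionGap_eq_sub (h : IsStableGraph Γ c ω a P A) {x : Param}
    (hx : x ∈ paramDomain a) :
    fderiv ℝ (actionGap A) x = fderiv ℝ A x - fderiv ℝ (fun x => A (reflectParam x)) x :=
  fderiv_sub
    ((h.contDiffOn_action.contDiffAt ((isOpen_paramDomain a).mem_nhds hx)).differentiableAt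
      (by norm_num))
    ((h.contDiffOn_unstableAction.contDiffAt ((isOpen_paramDomain a).mem_nhds
      hx)).differentiableAt (by norm_num))

/-- At a common point the Hamiltonian field is tangent to both graphs over the same velocity `(p,
ω)` of the angles. Both graph derivatives send it to the same rate of change of the momenta, so the
gap is stationary in this direction. -/
theorem fderiv_actionGap_flow (h : IsStableGraph Γ c ω a P A) (hμ0 : μ ≠ 0)
    (hx : ((μ, q, φ) : Param) ∈ paramDomain a)
    (hgap : μ • actionGap A (μ, q, φ) = -(δ • perp ω)) :
    fderiv ℝ (actionGap A) (μ, q, φ) (0, P (μ, q, φ), ω) = 0 := by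
  have hq : (q, φ) ∈ angleDomain a := hx.2
  set gs := graphMap P A μ (0 + δ • perp ω) with hgs
  set gu := graphMap (fun x => P (reflectParam x)) (fun x => A (reflectParam x)) μ 0 with hgu
  have hg : gs (q, φ) = gu (q, φ) := h.graphMap_eq_of_actionGap hx hgap 0
  have hS := h.isGraphOver_stable hx.1 (0 + δ • perp ω)
  have hU := h.isGraphOver_unstable hx.1 0
  obtain ⟨γ, h1, h2, h3⟩ := apply_mem_stableWhisker
    ((hS (join ((q, φ), gs (q, φ))) hq).2 rfl)
  obtain ⟨γ', h1', h2', h3'⟩ := apply_mem_unstableWhisker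
    ((hU (join ((q, φ), gu (q, φ))) hq).2 rfl)
  have e1 := hS.fderiv_apply_eq (isOpen_angleDomain a) (contDiffOn_graphMap hx.1
    h.contDiffOn_momentum h.contDiffOn_action _) hq (uniqueDiffOn_Ici (0 : ℝ) 0 self_mem_Ici)
    self_mem_Ici h1 h2 fun t ht => h3 t ht
  have e2 := hU.fderiv_apply_eq (isOpen_angleDomain a) (contDiffOn_graphMap hx.1
    h.contDiffOn_unstableMomentum h.contDiffOn_unstableAction _) hq
    (uniqueDiffOn_Iic (0 : ℝ) 0 self_mem_Iic) self_mem_Iic h1' h2' fun t ht => h3' t ht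
  rw [← hgu, ← hg] at e2
  rw [← hgs] at e1
  rw [← e1, hamiltonianField_eq] at e2
  have hv : angles (flowField Γ c ω μ (join ((q, φ), gs (q, φ)))) = (P (μ, q, φ), ω) := rfl
  have hz : angles (join ((q, φ), gs (q, φ))) = (q, φ) := rfl
  rw [hv, hz] at e2
  have e3 := congr_arg Prod.snd e2
  rw [fderiv_graphMap_snd hx.1 h.contDiffOn_momentum h.contDiffOn_action _ hq,
    fderiv_graphMap_snd hx.1 h.contDiffOn_unstableMomentum h.contDiffOn_unstableAction _ hq] at e3
  have e4 := smul_right_injective _ hμ0 e3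
  rw [h.fderiv_actionGap_eq_sub hx, sub_apply, ← e4, sub_self]

/-- Each whisker lies in one energy level, so its tangent space lies in `ker dH`. Moreover `∂H/∂p =
p > 0`, and the slopes in the actions differ by `μ` times a surjection. -/
theorem transversalAt_of_actionGap (h : IsStableGraph Γ c ω a P A) (hμ0 : μ ≠ 0)
    (hx : ((μ, q, φ) : Param) ∈ paramDomain a)
    (hgap : μ • actionGap A (μ, q, φ) = -(δ • perp ω))
    (hsurj : ∀ s, ∃ x', fderiv ℝ (actionGap A) (μ, q, φ) (0, x') = s) (B : Fin 2 → ℝ) :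
    TransversalAt (hamiltonian (trigPoly Γ c) ω μ)
      (unstableWhisker (hamiltonian (trigPoly Γ c) ω μ) B)
      (stableWhisker (hamiltonian (trigPoly Γ c) ω μ) (B + δ • perp ω))
      (unstablePoint (trigPoly Γ c) ω μ B q φ) := by
  have hq : (q, φ) ∈ angleDomain a := hx.2
  have hV := isOpen_angleDomain a
  have hH : Differentiable ℝ (hamiltonian (trigPoly Γ c) ω μ) :=
    (contDiff_hamiltonian Γ c ω μ (n := 1)).differentiable (by norm_num)
  rw [h.unstablePoint_eq hμ0 hx]
  set gs := graphMap P A μ (B + δ • perp ω) with hgs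
  set gu := graphMap (fun x => P (reflectParam x)) (fun x => A (reflectParam x)) μ B with hgu
  have hg : gs (q, φ) = gu (q, φ) := h.graphMap_eq_of_actionGap hx hgap B
  have hS : IsGraphOver _ _ gs := h.isGraphOver_stable hx.1 (B + δ • perp ω)
  have hU : IsGraphOver _ _ gu := h.isGraphOver_unstable hx.1 B
  have hCs : ContDiffOn ℝ 1 gs (angleDomain a) :=
    contDiffOn_graphMap hx.1 h.contDiffOn_momentum h.contDiffOn_action _
  have hCu : ContDiffOn ℝ 1 gu (angleDomain a) :=
    contDiffOn_graphMap hx.1 h.contDiffOn_unstableMomentum h.contDiffOn_unstableAction _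
  refine ⟨(hU _ hq).2 rfl, (hS _ hq).2 hg.symm, _, _, hU.hasTangentSpaceAt hV hCu hq,
    hS.hasTangentSpaceAt hV hCs hq, ker_graphDefect_sup_ker ?_ ?_ ?_ ?_⟩
  · exact fderiv_join_eq_zero hV hCu hH (fun x hx =>
      hamiltonian_eq_of_mem_unstableWhisker ((hU (join (x, gu x)) hx).2 rfl)) hq
  · rw [← hg]
    exact fderiv_join_eq_zero hV hCs hH (fun x hx =>
      hamiltonian_eq_of_mem_stableWhisker ((hS (join (x, gs x)) hx).2 rfl)) hq
  · have h1 : fderiv ℝ (hamiltonian (trigPoly Γ c) ω μ) (join ((q, φ), gu (q, φ))) (0, 0, 1, 0) =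
        P (reflectParam (μ, q, φ)) :=
      congr_arg Prod.fst (congr_fun (hamiltonianField_eq Γ c ω μ) (join ((q, φ), gu (q, φ))))
    rw [h1]
    exact (h.momentum_pos _ (reflectParam_mem hx)).ne'
  · intro s
    obtain ⟨x', hx'⟩ := hsurj (μ⁻¹ • s)
    refine ⟨x', ?_⟩
    have hz : angles (join ((q, φ), gu (q, φ))) = (q, φ) := rfl
    rw [hz, fderiv_graphMap_snd hx.1 h.contDiffOn_momentum h.contDiffOn_action _ hq,
      fderiv_graphMap_snd hx.1 h.contDiffOn_unstableMomentum h.contDiffOn_unstableAction _ hq,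
      ← smul_sub]
    rw [h.fderiv_actionGap_eq_sub hx, sub_apply] at hx'
    rw [hx', smul_inv_smul₀ hμ0]

end IsStableGraph

/-! ### A quantitative inverse function theorem -/

section InverseFunction

variable {E F : Type*} [NormedAddCommGroup E] [NormedSpace ℝ E] [FiniteDimensional ℝ E]
  [NormedAddCommGroup F] [NormedSpace ℝ F] [FiniteDimensional ℝ F]

theorem exists_continuousLinearEquiv_of_norm_le (hdim : Module.finrank ℝ E = Module.finrank ℝ F)
    {T : E →L[ℝ] F} {N : ℝ} (hT : ∀ v, ‖v‖ ≤ N * ‖T v‖) :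
    ∃ e : E ≃L[ℝ] F, (e : E →L[ℝ] F) = T := by
  have hinj : Function.Injective (T : E →ₗ[ℝ] F) := by
    rw [← LinearMap.ker_eq_bot, LinearMap.ker_eq_bot']
    intro v hv
    have h1 := hT v
    rw [show T v = 0 from hv, norm_zero, mul_zero] at h1
    exact norm_le_zero_iff.1 h1
  refine ⟨(LinearMap.linearEquivOfInjective _ hinj hdim).toContinuousLinearEquiv, ?_⟩
  ext v
  rfl

/-- A derivative within `1/(2N)` of a map whose inverse has norm at most `N` loses at most half of
the expansion `1/N`: the inverse has derivative at most `2N`, and the ball of radius `r/2` covers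
one of radius `r/(4N)`. All sizes are explicit, as uniformity in `μ` and `φ⁰` requires. -/
theorem exists_localInverse (hdim : Module.finrank ℝ E = Module.finrank ℝ F) {Φ : E → F} {y₀ : E}
    {r N : ℝ} (hr : 0 < r) (hN : 0 < N) {T : E →L[ℝ] F} (hT : ∀ v, ‖v‖ ≤ N * ‖T v‖)
    (hΦ : ContDiffOn ℝ 1 Φ (Metric.ball y₀ r))
    (hfd : ∀ y ∈ Metric.ball y₀ r, ‖fderiv ℝ Φ y - T‖ ≤ 1 / (2 * N)) :
    ∃ g : F → E, g (Φ y₀) = y₀ ∧ ∀ w ∈ Metric.ball (Φ y₀) (r / (4 * N)),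
      g w ∈ Metric.ball y₀ r ∧ Φ (g w) = w ∧ ContDiffAt ℝ 1 g w ∧
        ∀ v, ‖fderiv ℝ g w v‖ ≤ 2 * N * ‖v‖ := by
  obtain ⟨e, rfl⟩ := exists_continuousLinearEquiv_of_norm_le hdim hT
  have hd : ∀ y ∈ Metric.ball y₀ r, ContDiffAt ℝ 1 Φ y := fun y hy =>
    hΦ.contDiffAt (Metric.isOpen_ball.mem_nhds hy)
  have hnorm : ‖(e.symm : F →L[ℝ] E)‖ ≤ N := by
    refine ContinuousLinearMap.opNorm_le_bound _ hN.le fun w => ?_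
    simpa using hT (e.symm w)
  have hc : Subsingleton E ∨ Real.toNNReal (1 / (2 * N)) < ‖(e.symm : F →L[ℝ] E)‖₊⁻¹ := by
    refine e.subsingleton_or_nnnorm_symm_pos.imp_right fun hpos => ?_
    rw [← NNReal.coe_lt_coe, Real.coe_toNNReal _ (by positivity), NNReal.coe_inv, coe_nnnorm,
      one_div]
    have h2 : 0 < ‖(e.symm : F →L[ℝ] E)‖ := hpos
    exact inv_strictAnti₀ h2 (by linarith)
  have happrox : ApproximatesLinearOn Φ (e : E →L[ℝ] F) (Metric.ball y₀ r)
      (Real.toNNReal (1 / (2 * N))) := by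
    intro x hx y hy
    rw [Real.coe_toNNReal _ (by positivity)]
    exact (convex_ball y₀ r).norm_image_sub_le_of_norm_fderiv_le'
      (fun y hy => (hd y hy).differentiableAt (by norm_num)) hfd hy hx
  set f := happrox.toOpenPartialHomeomorph Φ _ hc Metric.isOpen_ball with hf
  have hsource : f.source = Metric.ball y₀ r := rfl
  have htarget : Metric.ball (Φ y₀) (r / (4 * N)) ⊆ f.target := by
    have hsub : Metric.closedBall y₀ (r / 2) ⊆ Metric.ball y₀ r :=
      Metric.closedBall_subset_ball (by linarith)
    have h1 := happrox.closedBall_subset_target hc Metric.isOpen_ball (by positivity) hsub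
    rcases e.subsingleton_or_nnnorm_symm_pos with hs | hpos
    · intro w hw
      have : Subsingleton F := e.symm.toEquiv.subsingleton
      rw [Subsingleton.elim w (f y₀)]
      exact f.map_source (by rw [hsource]; exact Metric.mem_ball_self hr)
    refine (Metric.ball_subset_closedBall.trans (Metric.closedBall_subset_closedBall ?_)).trans h1
    rw [Real.coe_toNNReal _ (by positivity), NNReal.coe_inv, coe_nnnorm]
    have h3 : 0 < ‖(e.symm : F →L[ℝ] E)‖ := hpos
    have h4 : N⁻¹ ≤ ‖(e.symm : F →L[ℝ] E)‖⁻¹ := inv_anti₀ h3 hnorm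
    calc r / (4 * N) = (N⁻¹ - 1 / (2 * N)) * (r / 2) := by field_simp; ring
      _ ≤ _ := by gcongr
  refine ⟨f.symm, f.left_inv (by rw [hsource]; exact Metric.mem_ball_self hr), fun w hw => ?_⟩
  have hw' := htarget hw
  have hmem : f.symm w ∈ Metric.ball y₀ r := by rw [← hsource]; exact f.map_target hw'
  have hlow : ∀ v, ‖v‖ ≤ 2 * N * ‖fderiv ℝ Φ (f.symm w) v‖ := fun v => by
    have h1 := hT v
    have h2 : ‖(e : E →L[ℝ] F) v‖ ≤ ‖fderiv ℝ Φ (f.symm w) v‖ + 1 / (2 * N) * ‖v‖ := by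
      have h3 := ((fderiv ℝ Φ (f.symm w) - (e : E →L[ℝ] F)).le_of_opNorm_le (hfd _ hmem) v)
      have h4 := norm_sub_norm_le ((e : E →L[ℝ] F) v) (fderiv ℝ Φ (f.symm w) v)
      rw [norm_sub_rev] at h4
      rw [sub_apply] at h3
      linarith
    have h5 : N * ‖(e : E →L[ℝ] F) v‖ ≤ N * ‖fderiv ℝ Φ (f.symm w) v‖ + ‖v‖ / 2 := by
      calc _ ≤ N * (‖fderiv ℝ Φ (f.symm w) v‖ + 1 / (2 * N) * ‖v‖) := by gcongr
        _ = _ := by field_simp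
    linarith
  obtain ⟨e', he'⟩ := exists_continuousLinearEquiv_of_norm_le hdim hlow
  have hΦd : HasFDerivAt Φ (fderiv ℝ Φ (f.symm w)) (f.symm w) :=
    ((hd _ hmem).differentiableAt (by norm_num)).hasFDerivAt
  have hsymm : ContDiffAt ℝ 1 f.symm w :=
    f.contDiffAt_symm hw' (f₀' := e') (by rw [he']; exact hΦd) (hd _ hmem)
  refine ⟨hmem, f.right_inv hw', hsymm, fun v => ?_⟩
  have hcomp : HasFDerivAt (fun w => Φ (f.symm w))
      ((fderiv ℝ Φ (f.symm w)).comp (fderiv ℝ f.symm w)) w :=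
    hΦd.comp w (hsymm.differentiableAt (by norm_num)).hasFDerivAt
  have hid : HasFDerivAt (fun w => Φ (f.symm w)) (ContinuousLinearMap.id ℝ F) w := by
    refine (hasFDerivAt_id w).congr_of_eventuallyEq ?_
    filter_upwards [f.open_target.mem_nhds hw'] with w' hw'' using f.right_inv hw''
  have h1 := DFunLike.congr_fun (hcomp.unique hid) v
  have h2 := hlow (fderiv ℝ f.symm w v)
  rw [show fderiv ℝ Φ (f.symm w) (fderiv ℝ f.symm w v) = v from h1] at h2
  exact h2

end InverseFunction

/-! ### Uniform estimates for the derivative of the splitting -/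

theorem exists_shift_mem_Ico (φ : Fin 2 → ℝ) : ∃ n : Fin 2 → ℤ, ∀ i,
    0 ≤ φ i + 2 * Real.pi * n i ∧ φ i + 2 * Real.pi * n i < 2 * Real.pi := by
  refine ⟨fun i => -toIcoDiv Real.two_pi_pos 0 (φ i), fun i => ?_⟩
  have h1 := toIcoMod_mem_Ico' Real.two_pi_pos (φ i)
  rw [← self_sub_toIcoDiv_zsmul, zsmul_eq_mul] at h1
  push_cast
  have h2 : φ i + 2 * Real.pi * -(toIcoDiv Real.two_pi_pos 0 (φ i) : ℝ) =
      φ i - toIcoDiv Real.two_pi_pos 0 (φ i) * (2 * Real.pi) := by ring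
  rw [h2]
  exact h1

theorem isCompact_paramBox (b : ℝ) :
    IsCompact (Icc (-b) b ×ˢ Icc (Real.pi - b) (Real.pi + b) ×ˢ
      Icc (fun _ : Fin 2 => (-1 : ℝ)) (fun _ => 8) : Set Param) :=
  isCompact_Icc.prod (isCompact_Icc.prod isCompact_Icc)

/-- A function that is continuous near a strip and periodic in `φ` is bounded and uniformly
continuous on the strip. -/
theorem exists_uniform_bounds {X : Type*} [NormedAddCommGroup X] {F : Param → X} {a : ℝ}
    (ha : 0 < a) (hF : ContinuousOn F (paramDomain a))
    (hper : ∀ μ q φ (n : Fin 2 → ℤ), F (μ, q, φ + fun i => 2 * Real.pi * n i) = F (μ, q, φ)) :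
    (∃ K, ∀ x ∈ paramDomain (a / 2), ‖F x‖ ≤ K) ∧
      ∀ ε > 0, ∃ r > 0, ∀ x ∈ paramDomain (a / 2), ∀ y ∈ paramDomain (a / 2), dist x y < r →
        ‖F x - F y‖ ≤ ε := by
  -- The same shift by periods is applied to both points. It brings one into `[0, 2π)`, and the
  -- other, less than `1` away, then stays in `[-1, 8]`.
  set S : Set Param := Icc (-(a / 2)) (a / 2) ×ˢ
    Icc (Real.pi - a / 2) (Real.pi + a / 2) ×ˢ
      Icc (fun _ : Fin 2 => (-1 : ℝ)) (fun _ => 8) with hS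
  have hcomp : IsCompact S := isCompact_paramBox (a / 2)
  have hsub : S ⊆ paramDomain a := fun x hx => by
    obtain ⟨h1, h2, -⟩ := hx
    refine ⟨abs_lt.2 ⟨?_, ?_⟩, abs_lt.2 ⟨?_, ?_⟩⟩
    · linarith [h1.1]
    · linarith [h1.2]
    · linarith [h2.1]
    · linarith [h2.2]
  have hmem : ∀ x ∈ paramDomain (a / 2), (∀ i, -1 ≤ x.2.2 i ∧ x.2.2 i ≤ 8) → x ∈ S :=
    fun x hx hφ => by
      have h1 := abs_lt.1 hx.1
      have h2 := abs_lt.1 hx.2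
      refine ⟨⟨h1.1.le, h1.2.le⟩, ⟨by linarith, by linarith⟩, fun i => (hφ i).1, fun i => (hφ i).2⟩
  have hpi : 2 * Real.pi < 7 := by linarith [Real.pi_lt_d2]
  constructor
  · obtain ⟨K, hK⟩ := hcomp.exists_bound_of_continuousOn (hF.mono hsub)
    refine ⟨K, fun x hx => ?_⟩
    obtain ⟨n, hn⟩ := exists_shift_mem_Ico x.2.2
    have h1 := hK (x.1, x.2.1, x.2.2 + fun i => 2 * Real.pi * n i)
      (hmem _ hx fun i => ⟨by have := (hn i).1; change -1 ≤ x.2.2 i + 2 * Real.pi * n i; linarith,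
        by have := (hn i).2; change x.2.2 i + 2 * Real.pi * n i ≤ 8; linarith⟩)
    rwa [hper] at h1
  · intro ε hε
    obtain ⟨r, hr, hunif⟩ := Metric.uniformContinuousOn_iff.1
      (hcomp.uniformContinuousOn_of_continuous (hF.mono hsub)) ε hε
    refine ⟨min r 1, lt_min hr one_pos, fun x hx y hy hxy => ?_⟩
    obtain ⟨n, hn⟩ := exists_shift_mem_Ico x.2.2
    have hdist : ∀ i, |x.2.2 i - y.2.2 i| < 1 := fun i => by
      have h1 : dist x.2.2 y.2.2 ≤ dist x y := (le_max_right _ _).trans (le_max_right _ _)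
      have h2 := dist_le_pi_dist x.2.2 y.2.2 i
      rw [Real.dist_eq] at h2
      linarith [min_le_right r 1]
    have h1 : dist ((x.1, x.2.1, x.2.2 + fun i => 2 * Real.pi * n i) : Param)
        (y.1, y.2.1, y.2.2 + fun i => 2 * Real.pi * n i) = dist x y := by
      simp only [Prod.dist_eq, dist_add_right]
    have h2 := hunif (x.1, x.2.1, x.2.2 + fun i => 2 * Real.pi * n i)
      (hmem _ hx fun i => ⟨by have := (hn i).1; change -1 ≤ x.2.2 i + 2 * Real.pi * n i; linarith,
        by have := (hn i).2; change x.2.2 i + 2 * Real.pi * n i ≤ 8; linarith⟩)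
      (y.1, y.2.1, y.2.2 + fun i => 2 * Real.pi * n i)
      (hmem _ hy fun i => by
        have h3 := abs_lt.1 (hdist i)
        have h4 := hn i
        change -1 ≤ y.2.2 i + 2 * Real.pi * n i ∧ y.2.2 i + 2 * Real.pi * n i ≤ 8
        constructor <;> linarith)
      (by rw [h1]; exact hxy.trans_le (min_le_left _ _))
    rw [hper, hper, dist_eq_norm] at h2
    exact h2.le

theorem IsStableGraph.fderiv_actionGap_periodic {Γ : ℕ} {c : ℤ × ℤ → ℝ} {ω : Fin 2 → ℝ} {a : ℝ}
    {P : Param → ℝ} {A : Param → Fin 2 → ℝ} (h : IsStableGraph Γ c ω a P A) (μ q : ℝ)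
    (φ : Fin 2 → ℝ) (n : Fin 2 → ℤ) :
    fderiv ℝ (actionGap A) (μ, q, φ + fun i => 2 * Real.pi * n i) =
      fderiv ℝ (actionGap A) (μ, q, φ) := by
  have h1 := fderiv_comp_add_right (𝕜 := ℝ) (f := actionGap A) (x := ((μ, q, φ) : Param))
    (0, 0, fun i => 2 * Real.pi * n i)
  have h2 : (fun x : Param => actionGap A (x + (0, 0, fun i => 2 * Real.pi * n i))) =
      actionGap A := funext fun x => by
    have h3 : x + (0, 0, fun i => 2 * Real.pi * (n i : ℝ)) =
        (x.1, x.2.1, x.2.2 + fun i => 2 * Real.pi * (n i : ℝ)) := by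
      refine Prod.ext ?_ (Prod.ext ?_ ?_) <;> simp
    rw [h3]
    exact h.actionGap_periodic x.1 x.2.1 x.2.2 n
  rw [h2] at h1
  rw [h1]
  congr 1
  refine Prod.ext ?_ (Prod.ext ?_ ?_) <;> simp

/-! ### The curve of heteroclinic points -/

theorem IsDiophantine.snd_ne_zero {ω : Fin 2 → ℝ} {C τ : ℝ} (hω : IsDiophantine ω C τ) :
    ω 1 ≠ 0 := by
  obtain ⟨hC, -, h⟩ := hω
  have h1 := h (0, 1) (by simp)
  intro h0
  simp [h0] at h1
  linarith

/-! ### Linear algebra of the derivative of the splitting. -/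

/-- Cramer's rule expresses `s` and `t` as minors over the determinant. -/
theorem abs_le_of_abs_det_ge {b₀ b₁ c₀ c₁ s t K U d : ℝ} (hb₀ : |b₀| ≤ K) (hb₁ : |b₁| ≤ K)
    (hc₀ : |c₀| ≤ K) (hc₁ : |c₁| ≤ K) (hd : 0 < d) (hdet : d ≤ |b₀ * c₁ - b₁ * c₀|)
    (h₀ : |s * b₀ + t * c₀| ≤ U) (h₁ : |s * b₁ + t * c₁| ≤ U) :
    |s| ≤ 2 * K / d * U ∧ |t| ≤ 2 * K / d * U := by
  have hK : 0 ≤ K := (abs_nonneg _).trans hb₀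
  have key : ∀ x y z : ℝ, |x| ≤ K → |y| ≤ K →
      z * (b₀ * c₁ - b₁ * c₀) = x * (s * b₀ + t * c₀) + y * (s * b₁ + t * c₁) →
      |z| ≤ 2 * K / d * U := fun x y z hx hy hz => by
    have h1 : |z| * d ≤ 2 * K * U := by
      calc |z| * d ≤ |z| * |b₀ * c₁ - b₁ * c₀| := by gcongr
        _ = |x * (s * b₀ + t * c₀) + y * (s * b₁ + t * c₁)| := by rw [← abs_mul, hz]
        _ ≤ |x| * |s * b₀ + t * c₀| + |y| * |s * b₁ + t * c₁| := by
          rw [← abs_mul, ← abs_mul]; exact abs_add_le _ _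
        _ ≤ K * U + K * U := by gcongr
        _ = 2 * K * U := by ring
    rw [div_mul_eq_mul_div, le_div_iff₀ hd]
    exact h1
  exact ⟨key c₁ (-c₀) s hc₁ (by rwa [abs_neg]) (by ring),
    key (-b₁) b₀ t (by rwa [abs_neg]) hb₀ (by ring)⟩

theorem Param.apply_eq (D : Param →L[ℝ] (Fin 2 → ℝ)) (s : ℝ) (ψ : Fin 2 → ℝ) (i : Fin 2) :
    D (0, s, ψ) i = s * D (0, 1, 0) i + ψ 0 * D (0, 0, Pi.single 0 1) i +
      ψ 1 * D (0, 0, Pi.single 1 1) i := by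
  have h : ((0, s, ψ) : Param) = s • (0, 1, 0) + ψ 0 • (0, 0, Pi.single 0 1) +
      ψ 1 • (0, 0, Pi.single 1 1) := by
    refine Prod.ext ?_ (Prod.ext ?_ ?_)
    · simp
    · simp
    · funext i; fin_cases i <;> simp
  rw [h]
  simp only [map_add, map_smul, Pi.add_apply, Pi.smul_apply, smul_eq_mul]

/-- The minor determinant of `∂ΔA/∂φ`. -/
def angleDet (D : Param →L[ℝ] (Fin 2 → ℝ)) : ℝ :=
  D (0, 0, Pi.single 0 1) 0 * D (0, 0, Pi.single 1 1) 1 -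
    D (0, 0, Pi.single 1 1) 0 * D (0, 0, Pi.single 0 1) 1

theorem abs_apply_single_le (D : Param →L[ℝ] (Fin 2 → ℝ)) (i j : Fin 2) :
    |D (0, 0, Pi.single j 1) i| ≤ ‖D‖ := by
  have h1 : ‖((0, 0, Pi.single j 1) : Param)‖ ≤ 1 := by
    refine max_le (by simp) (max_le (by simp) ?_)
    refine (pi_norm_le_iff_of_nonneg zero_le_one).2 fun k => ?_
    by_cases hk : k = j
    · simp [hk]
    · simp [hk]
  exact (norm_le_pi_norm (D (0, 0, Pi.single j 1)) i).trans
    ((D.le_opNorm _).trans (mul_le_of_le_one_right (norm_nonneg _) h1))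

theorem abs_apply_one_le (D : Param →L[ℝ] (Fin 2 → ℝ)) (i : Fin 2) :
    |D (0, 1, 0) i| ≤ ‖D‖ := by
  have h1 : ‖((0, 1, 0) : Param)‖ ≤ 1 := by
    simp [Prod.norm_def]
  exact (norm_le_pi_norm (D (0, 1, 0)) i).trans
    ((D.le_opNorm _).trans (mul_le_of_le_one_right (norm_nonneg _) h1))

theorem abs_angleDet_sub_le {D D' : Param →L[ℝ] (Fin 2 → ℝ)} {K ε : ℝ} (hD : ‖D‖ ≤ K)
    (hD' : ‖D'‖ ≤ K) (h : ‖D - D'‖ ≤ ε) : |angleDet D - angleDet D'| ≤ 4 * K * ε := by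
  have hK : 0 ≤ K := (norm_nonneg _).trans hD
  have hε : 0 ≤ ε := (norm_nonneg _).trans h
  have hsub : ∀ i j, |D (0, 0, Pi.single j 1) i - D' (0, 0, Pi.single j 1) i| ≤ ε := fun i j =>
    (abs_apply_single_le (D - D') i j).trans h
  have hmul : ∀ i j k l, |D (0, 0, Pi.single j 1) i * D (0, 0, Pi.single l 1) k -
      D' (0, 0, Pi.single j 1) i * D' (0, 0, Pi.single l 1) k| ≤ 2 * K * ε := fun i j k l => by
    have h1 : D (0, 0, Pi.single j 1) i * D (0, 0, Pi.single l 1) k -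
        D' (0, 0, Pi.single j 1) i * D' (0, 0, Pi.single l 1) k =
        D (0, 0, Pi.single j 1) i * (D (0, 0, Pi.single l 1) k - D' (0, 0, Pi.single l 1) k) +
        (D (0, 0, Pi.single j 1) i - D' (0, 0, Pi.single j 1) i) * D' (0, 0, Pi.single l 1) k := by
      ring
    rw [h1]
    refine (abs_add_le _ _).trans ?_
    rw [abs_mul, abs_mul]
    calc _ ≤ K * ε + ε * K := by
          gcongr
          · exact (abs_apply_single_le D i j).trans hD
          · exact hsub k l
          · exact hsub i j
          · exact (abs_apply_single_le D' k l).trans hD'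
      _ = _ := by ring
  have h1 := hmul 0 0 1 1
  have h2 := hmul 0 1 1 0
  unfold angleDet
  rw [abs_le] at h1 h2 ⊢
  constructor <;> linarith [h1.1, h1.2, h2.1, h2.2]

theorem exists_apply_eq_of_angleDet_ne_zero {D : Param →L[ℝ] (Fin 2 → ℝ)} (h : angleDet D ≠ 0)
    (s : Fin 2 → ℝ) : ∃ x, D (0, x) = s := by
  refine ⟨(0, ![(D (0, 0, Pi.single 1 1) 1 * s 0 - D (0, 0, Pi.single 1 1) 0 * s 1) / angleDet D,
    (D (0, 0, Pi.single 0 1) 0 * s 1 - D (0, 0, Pi.single 0 1) 1 * s 0) / angleDet D]), ?_⟩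
  funext i
  rw [Param.apply_eq]
  simp only [Matrix.cons_val_zero, Matrix.cons_val_one]
  fin_cases i
  · simp only [Fin.zero_eta]
    field_simp
    unfold angleDet
    ring
  · simp only [Fin.mk_one]
    field_simp
    unfold angleDet
    ring

/-- The flow relation `p ∂_qΔA + ∂_φΔA ω = 0` turns the determinant of `∂ΔA/∂φ` into that of
`∂ΔA/∂(q, φ₁)`. -/
theorem mul_det_eq {D : Param →L[ℝ] (Fin 2 → ℝ)} {p : ℝ} {ω : Fin 2 → ℝ} (h : D (0, p, ω) = 0) :
    p * (D (0, 1, 0) 0 * D (0, 0, Pi.single 0 1) 1 - D (0, 1, 0) 1 * D (0, 0, Pi.single 0 1) 0) =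
      ω 1 * angleDet D := by
  have h0 := congr_fun h 0
  have h1 := congr_fun h 1
  rw [Param.apply_eq, Pi.zero_apply] at h0 h1
  unfold angleDet
  linear_combination D (0, 0, Pi.single 0 1) 1 * h0 - D (0, 0, Pi.single 0 1) 0 * h1

/-- A solution of `D (0, s, t, 0) = k ω^⊥` with `k ≠ 0` has `t ≠ 0`, as the symmetric block
`∂ΔA/∂φ` is definite. -/
theorem ne_zero_of_apply_eq_perp {D : Param →L[ℝ] (Fin 2 → ℝ)} {p k s t : ℝ} {ω : Fin 2 → ℝ}
    (h : D (0, p, ω) = 0) (hω : ω 1 ≠ 0) (hdet : 0 < angleDet D)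
    (hsymm : D (0, 0, Pi.single 1 1) 0 = D (0, 0, Pi.single 0 1) 1) (hk : k ≠ 0)
    (hst : D (0, s, ![t, 0]) = k • perp ω) : t ≠ 0 := by
  rintro rfl
  have h0 := congr_fun h 0
  have h1 := congr_fun h 1
  have e0 := congr_fun hst 0
  have e1 := congr_fun hst 1
  rw [Param.apply_eq] at h0 h1 e0 e1
  simp only [perp, Pi.zero_apply, Pi.smul_apply, smul_eq_mul, Matrix.cons_val_zero,
    Matrix.cons_val_one, zero_mul, add_zero] at h0 h1 e0 e1
  unfold angleDet at hdet
  set b₀ := D (0, 1, 0) 0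
  set b₁ := D (0, 1, 0) 1
  set m₀₀ := D (0, 0, Pi.single 0 1) 0
  set m₀₁ := D (0, 0, Pi.single 1 1) 0
  set m₁₀ := D (0, 0, Pi.single 0 1) 1
  set m₁₁ := D (0, 0, Pi.single 1 1) 1
  have hs : s ≠ 0 := by
    rintro rfl
    rw [zero_mul] at e0
    exact mul_ne_zero hk (neg_ne_zero.2 hω) e0.symm
  -- With `t = 0` the vector `∂_q ΔA` is a multiple of `ω^⊥`, hence orthogonal to `ω`.
  have hb : ω 0 * b₀ + ω 1 * b₁ = 0 := by
    have : s * (ω 0 * b₀ + ω 1 * b₁) = 0 := by linear_combination ω 0 * e0 + ω 1 * e1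
    exact (mul_eq_zero.1 this).resolve_left hs
  -- The left side is `m₀₀ ω · Mω` with the square completed, and the flow relation gives `ω · Mω =
  -- -p ω · ∂_q ΔA = 0`.
  have hquad : (m₀₀ * ω 0 + m₀₁ * ω 1) ^ 2 + (m₀₀ * m₁₁ - m₀₁ * m₁₀) * ω 1 ^ 2 = 0 := by
    rw [← hsymm] at h1 ⊢
    linear_combination m₀₀ * ω 0 * h0 + m₀₀ * ω 1 * h1 - m₀₀ * p * hb
  have h2 : 0 < ω 1 ^ 2 := by positivity
  nlinarith [sq_nonneg (m₀₀ * ω 0 + m₀₁ * ω 1), mul_pos hdet h2]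

/-- The inclusion of the angles `(q, φ₁)` into the parameters. -/
def inclusion : ℝ × ℝ →L[ℝ] Param :=
  (0 : ℝ × ℝ →L[ℝ] ℝ).prod ((ContinuousLinearMap.fst ℝ ℝ ℝ).prod
    (ContinuousLinearMap.pi ![ContinuousLinearMap.snd ℝ ℝ ℝ, 0]))

theorem inclusion_apply (y : ℝ × ℝ) : inclusion y = (0, y.1, ![y.2, 0]) := by
  refine Prod.ext rfl (Prod.ext rfl ?_)
  funext i
  fin_cases i <;> simp [inclusion]

theorem norm_inclusion_apply (y : ℝ × ℝ) : ‖inclusion y‖ ≤ ‖y‖ := by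
  rw [inclusion_apply]
  refine max_le (by simp) (max_le (norm_fst_le y) ?_)
  refine (pi_norm_le_iff_of_nonneg (norm_nonneg _)).2 fun i => ?_
  fin_cases i
  · exact norm_snd_le y
  · simp

theorem norm_comp_inclusion_le (D : Param →L[ℝ] (Fin 2 → ℝ)) : ‖D.comp inclusion‖ ≤ ‖D‖ := by
  refine ContinuousLinearMap.opNorm_le_bound _ (norm_nonneg _) fun y => ?_
  exact (D.le_opNorm _).trans (mul_le_mul_of_nonneg_left (norm_inclusion_apply y) (norm_nonneg _))

/-- By the flow relation and `p ≤ 4`, the determinant in `(q, φ₁)` is at least `|ω₂| m / 4`;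
Cramer's rule then bounds the inverse. -/
theorem norm_le_of_flow {D : Param →L[ℝ] (Fin 2 → ℝ)} {p m K : ℝ} {ω : Fin 2 → ℝ}
    (h : D (0, p, ω) = 0) (hp : 0 < p) (hp4 : p ≤ 4) (hω : ω 1 ≠ 0) (hm : 0 < m)
    (hdet : m ≤ angleDet D) (hD : ‖D‖ ≤ K) (y : ℝ × ℝ) :
    ‖y‖ ≤ 2 * K / (|ω 1| * m / 4) * ‖D.comp inclusion y‖ := by
  have hω' : 0 < |ω 1| := abs_pos.2 hω
  have h1 : |ω 1| * m / 4 ≤ |D (0, 1, 0) 0 * D (0, 0, Pi.single 0 1) 1 -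
      D (0, 1, 0) 1 * D (0, 0, Pi.single 0 1) 0| := by
    have h2 := congr_arg abs (mul_det_eq h)
    rw [abs_mul, abs_mul, abs_of_pos hp, abs_of_pos (hm.trans_le hdet)] at h2
    set d := |D (0, 1, 0) 0 * D (0, 0, Pi.single 0 1) 1 -
      D (0, 1, 0) 1 * D (0, 0, Pi.single 0 1) 0|
    have h3 : 0 ≤ d := abs_nonneg _
    have h4 : |ω 1| * m ≤ |ω 1| * angleDet D := by gcongr
    have h5 : p * d ≤ 4 * d := by gcongr
    linarith
  have hU : ∀ i, |y.1 * D (0, 1, 0) i + y.2 * D (0, 0, Pi.single 0 1) i| ≤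
      ‖D.comp inclusion y‖ := fun i => by
    have h2 := norm_le_pi_norm (D.comp inclusion y) i
    rw [ContinuousLinearMap.comp_apply, inclusion_apply, Param.apply_eq] at h2
    simpa [Real.norm_eq_abs, inclusion_apply] using h2
  obtain ⟨h2, h3⟩ := abs_le_of_abs_det_ge ((abs_apply_one_le D 0).trans hD)
    ((abs_apply_one_le D 1).trans hD) ((abs_apply_single_le D 0 0).trans hD)
    ((abs_apply_single_le D 1 0).trans hD) (by positivity) h1 (hU 0) (hU 1)
  exact max_le h2 h3

theorem paramDomain_subset {a b : ℝ} (h : a ≤ b) : paramDomain a ⊆ paramDomain b :=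
  fun _ hx => ⟨hx.1.trans_le h, hx.2.trans_le h⟩

theorem inclusion_add (μ t : ℝ) (y : ℝ × ℝ) :
    (μ, 0, ![0, t]) + inclusion y = ((μ, y.1, ![y.2, t]) : Param) := by
  rw [inclusion_apply]
  refine Prod.ext ?_ (Prod.ext ?_ ?_)
  · simp
  · simp
  · funext i; fin_cases i <;> simp

/-! ### Uniform local inversion of the splitting at homoclinic points. -/

namespace IsStableGraph

variable {Γ : ℕ} {c : ℤ × ℤ → ℝ} {ω : Fin 2 → ℝ} {a : ℝ} {P : Param → ℝ} {A : Param → Fin 2 → ℝ}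

theorem actionGap_eq_zero_of_splitting (h : IsStableGraph Γ c ω a P A) {m μ : ℝ}
    {φ₀ : Fin 2 → ℝ} (hμ0 : μ ≠ 0) (hx : ((μ, Real.pi, φ₀) : Param) ∈ paramDomain a)
    (hsplit : SplittingCondition (trigPoly Γ c) ω m μ φ₀) :
    actionGap A (μ, Real.pi, φ₀) = 0 := by
  have h1 := hsplit.1
  rw [splittingMap, h.deltaA_eq hμ0 hx, zero_smul, zero_add] at h1
  exact (smul_eq_zero.1 h1).resolve_left hμ0

theorem le_angleDet_of_splitting (h : IsStableGraph Γ c ω a P A) {m μ : ℝ}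
    {φ₀ : Fin 2 → ℝ} (hμ0 : μ ≠ 0) (hx : ((μ, Real.pi, φ₀) : Param) ∈ paramDomain a)
    (hsplit : SplittingCondition (trigPoly Γ c) ω m μ φ₀) :
    m ≤ angleDet (fderiv ℝ (actionGap A) (μ, Real.pi, φ₀)) := by
  have h1 := hsplit.2
  rw [Matrix.det_fin_two, h.Mse_apply hμ0 hx, h.Mse_apply hμ0 hx, h.Mse_apply hμ0 hx,
    h.Mse_apply hμ0 hx] at h1
  exact h1

/-- Near a point of the splitting condition the splitting is a local diffeomorphism in `(q, φ₁)`,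
uniformly in the point. -/
theorem exists_inverse_actionGap (h : IsStableGraph Γ c ω a P A) (hω : ω 1 ≠ 0) {m : ℝ}
    (hm : 0 < m) : ∃ ρ > 0, ∃ N > 0, ∀ μ : ℝ, 0 < μ → μ < a / 2 → ∀ φ₀ : Fin 2 → ℝ,
      SplittingCondition (trigPoly Γ c) ω m μ φ₀ → ∃ g : (Fin 2 → ℝ) → ℝ × ℝ,
        g 0 = (Real.pi, φ₀ 0) ∧ ∀ w ∈ Metric.ball (0 : Fin 2 → ℝ) ρ,
          ((μ, (g w).1, ![(g w).2, φ₀ 1]) : Param) ∈ paramDomain a ∧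
          actionGap A (μ, (g w).1, ![(g w).2, φ₀ 1]) = w ∧ ContDiffAt ℝ 1 g w ∧
          (∀ v, ‖fderiv ℝ g w v‖ ≤ N * ‖v‖) ∧
          0 < angleDet (fderiv ℝ (actionGap A) (μ, (g w).1, ![(g w).2, φ₀ 1])) := by
  have hopen := isOpen_paramDomain a
  have hcont : ContinuousOn (fderiv ℝ (actionGap A)) (paramDomain a) :=
    h.contDiffOn_actionGap.continuousOn_fderiv_of_isOpen hopen (by norm_num)
  obtain ⟨⟨K', hK'⟩, hunif⟩ := exists_uniform_bounds h.pos hcont h.fderiv_actionGap_periodic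
  set K := max K' 1 with hKdef
  have hK0 : 0 < K := lt_max_of_lt_right one_pos
  have hK : ∀ x ∈ paramDomain (a / 2), ‖fderiv ℝ (actionGap A) x‖ ≤ K := fun x hx =>
    (hK' x hx).trans (le_max_left _ _)
  have hω' : 0 < |ω 1| := abs_pos.2 hω
  set N := 2 * K / (|ω 1| * m / 4) with hN
  have hN0 : 0 < N := by positivity
  -- The bound `1/(2N)` is what the local inverse needs; `m/(8K)` changes the determinant by at most
  -- `4K · m/(8K) = m/2`, so it stays positive.
  obtain ⟨r', hr', hunif⟩ := hunif (min (1 / (2 * N)) (m / (8 * K))) (by positivity)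
  have ha := h.pos
  set r := min r' (a / 2) with hr
  have hr0 : 0 < r := lt_min hr' (by linarith)
  refine ⟨r / (4 * N), by positivity, 2 * N, by positivity, fun μ hμ0 hμ φ₀ hsplit => ?_⟩
  have hsub : paramDomain (a / 2) ⊆ paramDomain a := paramDomain_subset (by linarith)
  have hx₀ : ((μ, Real.pi, φ₀) : Param) ∈ paramDomain (a / 2) := by
    refine ⟨by rwa [abs_of_pos hμ0], ?_⟩
    change |Real.pi - Real.pi| < a / 2
    rw [sub_self, abs_zero]
    linarith
  have hgap₀ := h.actionGap_eq_zero_of_splitting hμ0.ne' (hsub hx₀) hsplit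
  have hdet₀ := h.le_angleDet_of_splitting hμ0.ne' (hsub hx₀) hsplit
  have hflow := h.fderiv_actionGap_flow (δ := 0) hμ0.ne' (hsub hx₀) (by rw [hgap₀]; simp)
  set y₀ : ℝ × ℝ := (Real.pi, φ₀ 0) with hy₀
  set x : ℝ × ℝ → Param := fun y => (μ, 0, ![0, φ₀ 1]) + inclusion y with hxdef
  have hx : ∀ y, x y = (μ, y.1, ![y.2, φ₀ 1]) := inclusion_add μ (φ₀ 1)
  have hxy₀ : x y₀ = (μ, Real.pi, φ₀) := by
    rw [hx]
    refine Prod.ext rfl (Prod.ext rfl ?_)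
    funext i
    fin_cases i <;> rfl
  have hdist : ∀ y ∈ Metric.ball y₀ r, x y ∈ paramDomain (a / 2) ∧
      dist (x y) (μ, Real.pi, φ₀) < r' := fun y hy => by
    have h1 : dist y y₀ < r := hy
    constructor
    · rw [hx]
      refine ⟨by rwa [abs_of_pos hμ0], ?_⟩
      have h2 : dist y.1 Real.pi ≤ dist y y₀ := le_max_left _ _
      rw [Real.dist_eq] at h2
      exact h2.trans_lt (h1.trans_le (min_le_right _ _))
    · rw [← hxy₀, hxdef, dist_add_left, dist_eq_norm, ← map_sub]
      refine (norm_inclusion_apply _).trans_lt ?_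
      rw [← dist_eq_norm]
      exact h1.trans_le (min_le_left _ _)
  have hxd : ∀ y, HasFDerivAt x inclusion y := fun y => inclusion.hasFDerivAt.const_add _
  have hfd : ∀ y ∈ Metric.ball y₀ r, HasFDerivAt (fun y => actionGap A (x y))
      ((fderiv ℝ (actionGap A) (x y)).comp inclusion) y := fun y hy =>
    HasFDerivAt.comp (g := actionGap A) y ((h.contDiffOn_actionGap.contDiffAt (hopen.mem_nhds
      (hsub (hdist y hy).1))).differentiableAt (by norm_num)).hasFDerivAt (hxd y)
  have hdiff : ∀ y ∈ Metric.ball y₀ r, ‖fderiv ℝ (actionGap A) (x y) -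
      fderiv ℝ (actionGap A) (μ, Real.pi, φ₀)‖ ≤ min (1 / (2 * N)) (m / (8 * K)) := fun y hy =>
    hunif _ (hdist y hy).1 _ hx₀ (hdist y hy).2
  obtain ⟨g, hg0, hg⟩ := exists_localInverse (Φ := fun y => actionGap A (x y)) (y₀ := y₀)
    (T := (fderiv ℝ (actionGap A) (μ, Real.pi, φ₀)).comp inclusion) (by simp) hr0 hN0
    (norm_le_of_flow hflow (h.momentum_pos _ (hsub hx₀)) (h.momentum_le _ (hsub hx₀)) hω hm hdet₀
      (hK _ hx₀))
    (h.contDiffOn_actionGap.comp (by rw [hxdef]; fun_prop) fun y hy => hsub (hdist y hy).1)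
    (fun y hy => by
      rw [(hfd y hy).fderiv, ← ContinuousLinearMap.sub_comp]
      exact (norm_comp_inclusion_le _).trans ((hdiff y hy).trans (min_le_left _ _)))
  rw [show actionGap A (x y₀) = 0 by rw [hxy₀]; exact hgap₀] at hg0 hg
  refine ⟨g, hg0, fun w hw => ?_⟩
  obtain ⟨h1, h2, h3, h4⟩ := hg w hw
  rw [← hx]
  refine ⟨hsub (hdist _ h1).1, h2, h3, h4, ?_⟩
  have h5 := abs_angleDet_sub_le (hK _ (hdist _ h1).1) (hK _ hx₀)
    ((hdiff _ h1).trans (min_le_right _ _))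
  have h6 : 4 * K * (m / (8 * K)) = m / 2 := by field_simp; norm_num
  rw [h6] at h5
  linarith [(abs_le.1 h5).1]

end IsStableGraph

end Isochronous

end

/-! ### The heteroclinic curve, its transversality and its derivatives. -/

theorem mainTheorem5 (Γ : ℕ) (c : ℤ × ℤ → ℝ)
    (hsymm : ∀ k ∈ Isochronous.waveVectors Γ, c (-k) = c k)
    (hpos : ∀ k ∈ Isochronous.waveVectors Γ, 0 < c k)
    (ω : Fin 2 → ℝ) (C τ : ℝ) (hω : Isochronous.IsDiophantine ω C τ)
    (m : ℝ) (hm : 0 < m) :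
    ∃ μ₀ > 0, ∃ κ > 0, ∃ K > 0, ∀ μ : ℝ, 0 < μ → μ < μ₀ → ∀ φ₀ : Fin 2 → ℝ,
      Isochronous.SplittingCondition (Isochronous.trigPoly Γ c) ω m μ φ₀ →
      ∃ q φ₁ : ℝ → ℝ, q 0 = Real.pi ∧ φ₁ 0 = φ₀ 0 ∧
        ContDiffOn ℝ 1 q (Set.Ioo (-(κ * μ)) (κ * μ)) ∧
        ContDiffOn ℝ 1 φ₁ (Set.Ioo (-(κ * μ)) (κ * μ)) ∧
        ∀ δ ∈ Set.Ioo (-(κ * μ)) (κ * μ),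
          (∀ B : Fin 2 → ℝ,
            Isochronous.TransversalAt
              (Isochronous.hamiltonian (Isochronous.trigPoly Γ c) ω μ)
              (Isochronous.unstableWhisker
                (Isochronous.hamiltonian (Isochronous.trigPoly Γ c) ω μ) B)
              (Isochronous.stableWhisker
                (Isochronous.hamiltonian (Isochronous.trigPoly Γ c) ω μ)
                (B + δ • Isochronous.perp ω))
              (Isochronous.unstablePoint (Isochronous.trigPoly Γ c) ω μ B
                (q δ) ![φ₁ δ, φ₀ 1])) ∧
          deriv φ₁ δ ≠ 0 ∧ |deriv φ₁ δ| ≤ K / μ ∧ |deriv q δ| ≤ K / μ := by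
  obtain ⟨a, P, A, h⟩ := Isochronous.exists_isStableGraph Γ c ω
  have ha := h.pos
  have hω1 := hω.snd_ne_zero
  obtain ⟨ρ, hρ, N, hN, hinv⟩ := h.exists_inverse_actionGap hω1 hm
  set ν := ‖Isochronous.perp ω‖ + 1 with hν
  have hν0 : 0 < ν := by positivity
  -- `μ < a/2` keeps the parameters in the strip of uniform estimates. For `|δ| < ρμ/ν` the target
  -- `-(δ/μ) ω^⊥` lies in the ball of radius `ρ`, and its velocity has norm at most `ν/μ`, which the
  -- inverse magnifies by at most `N`.
  refine ⟨a / 2, by linarith, ρ / ν, by positivity, N * ν, by positivity,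
    fun μ hμ0 hμ φ₀ hsplit => ?_⟩
  obtain ⟨g, hg0, hg⟩ := hinv μ hμ0 hμ φ₀ hsplit
  set w : ℝ → Fin 2 → ℝ := fun δ => (-(δ / μ)) • Isochronous.perp ω with hw
  have hwmem : ∀ δ ∈ Set.Ioo (-(ρ / ν * μ)) (ρ / ν * μ), w δ ∈ Metric.ball (0 : Fin 2 → ℝ) ρ := by
    intro δ hδ
    have h1 : |δ| < ρ / ν * μ := abs_lt.2 hδ
    rw [mem_ball_zero_iff, hw, norm_smul, norm_neg, norm_div, Real.norm_eq_abs, Real.norm_eq_abs,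
      abs_of_pos hμ0]
    have h2 : |δ| / μ < ρ / ν := by rwa [div_lt_iff₀ hμ0]
    calc |δ| / μ * ‖Isochronous.perp ω‖ ≤ |δ| / μ * ν := by gcongr; linarith
      _ < ρ / ν * ν := by gcongr
      _ = ρ := by field_simp
  have hwd : ∀ δ, HasDerivAt w ((-μ⁻¹) • Isochronous.perp ω) δ := fun δ => by
    have h1 : HasDerivAt (fun δ : ℝ => -(δ / μ)) (-μ⁻¹) δ := by
      have h2 := ((hasDerivAt_id δ).div_const μ).neg
      rw [one_div] at h2
      exact h2
    exact h1.smul_const _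
  have hyd : ∀ δ ∈ Set.Ioo (-(ρ / ν * μ)) (ρ / ν * μ), HasDerivAt (fun δ => g (w δ))
      (fderiv ℝ g (w δ) ((-μ⁻¹) • Isochronous.perp ω)) δ := fun δ hδ =>
    ((hg _ (hwmem δ hδ)).2.2.1.differentiableAt (by norm_num)).hasFDerivAt.comp_hasDerivAt δ
      (hwd δ)
  have hyc : ContDiffOn ℝ 1 (fun δ => g (w δ)) (Set.Ioo (-(ρ / ν * μ)) (ρ / ν * μ)) := by
    intro δ hδ
    have h1 : ContDiffAt ℝ 1 w δ := by rw [hw]; fun_prop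
    exact ((hg _ (hwmem δ hδ)).2.2.1.comp δ h1).contDiffWithinAt
  have hw0 : g (w 0) = (Real.pi, φ₀ 0) := by rw [← hg0, hw]; simp
  refine ⟨fun δ => (g (w δ)).1, fun δ => (g (w δ)).2, by simp only [hw0], by simp only [hw0],
    hyc.fst, hyc.snd, fun δ hδ => ?_⟩
  obtain ⟨hx, hgap, hgc, hbound, hdet⟩ := hg _ (hwmem δ hδ)
  set y' := fderiv ℝ g (w δ) ((-μ⁻¹) • Isochronous.perp ω) with hy'
  have hgap' : μ • Isochronous.actionGap A (μ, (g (w δ)).1, ![(g (w δ)).2, φ₀ 1]) =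
      -(δ • Isochronous.perp ω) := by
    rw [hgap, hw, smul_smul, ← neg_smul]
    congr 1
    field_simp
  have hq : HasDerivAt (fun δ => (g (w δ)).1) y'.1 δ := (hyd δ hδ).fst
  have hφ : HasDerivAt (fun δ => (g (w δ)).2) y'.2 δ := (hyd δ hδ).snd
  have hnorm : ‖y'‖ ≤ N * ν / μ := by
    refine (hbound _).trans ?_
    rw [norm_smul, norm_neg, norm_inv, Real.norm_eq_abs, abs_of_pos hμ0, mul_div_assoc]
    gcongr
    rw [inv_mul_eq_div]
    gcongr
    linarith
  refine ⟨fun B => h.transversalAt_of_actionGap hμ0.ne' hx hgap'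
    (Isochronous.exists_apply_eq_of_angleDet_ne_zero hdet.ne') B, ?_, ?_, ?_⟩
  · rw [hφ.deriv]
    refine Isochronous.ne_zero_of_apply_eq_perp (s := y'.1) (k := -μ⁻¹)
      (h.fderiv_actionGap_flow hμ0.ne' hx hgap') hω1 hdet
      (h.fderiv_actionGap_symm hx hμ0.ne' 0 1) (neg_ne_zero.2 (inv_ne_zero hμ0.ne')) ?_
    -- Differentiating `ΔA(q(δ), φ₁(δ), φ₂⁰) = -(δ/μ) ω^⊥` in two ways shows that `(q', φ₁')` solves
    -- the linear system with right-hand side `-μ⁻¹ ω^⊥`.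
    have h1 : HasDerivAt (fun δ => Isochronous.actionGap A
        ((μ, 0, ![0, φ₀ 1]) + Isochronous.inclusion (g (w δ))))
        (fderiv ℝ (Isochronous.actionGap A) (μ, (g (w δ)).1, ![(g (w δ)).2, φ₀ 1])
          (Isochronous.inclusion y')) δ := by
      have h2 : HasDerivAt (fun δ => (μ, 0, ![0, φ₀ 1]) + Isochronous.inclusion (g (w δ)))
          (Isochronous.inclusion y') δ :=
        (Isochronous.inclusion.hasFDerivAt.comp_hasDerivAt δ (hyd δ hδ)).const_add _
      refine HasFDerivAt.comp_hasDerivAt (l := Isochronous.actionGap A) δ ?_ h2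
      rw [Isochronous.inclusion_add]
      exact ((h.contDiffOn_actionGap.contDiffAt ((Isochronous.isOpen_paramDomain a).mem_nhds
        hx)).differentiableAt (by norm_num)).hasFDerivAt
    have h3 : HasDerivAt (fun δ => Isochronous.actionGap A
        ((μ, 0, ![0, φ₀ 1]) + Isochronous.inclusion (g (w δ))))
        ((-μ⁻¹) • Isochronous.perp ω) δ := by
      refine (hwd δ).congr_of_eventuallyEq ?_
      filter_upwards [isOpen_Ioo.mem_nhds hδ] with δ' hδ'
      rw [Isochronous.inclusion_add]
      exact (hg _ (hwmem δ' hδ')).2.1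
    rw [← Isochronous.inclusion_apply]
    exact h1.unique h3
  · rw [hφ.deriv]
    exact (norm_snd_le y').trans hnorm
  · rw [hq.deriv]
    exact (norm_fst_le y').trans hnorm
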